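/- Let $H=-\Delta+|x|^2$ on $\mathbb R^2$, let $E_k$ ($k\ge 0$) be its eigenspace for the eigenvalue $2k+2$, and let $\Pi_N$ be the orthogonal projector onto $\bigoplus_{k=0}^N E_k$, extended to tempered distributions. For $\sigma>0$ let $\mathcal H^{-\sigma}(\mathbb R^2)$ be the space of tempered distributions $u$ with $\|u\|_{\mathcal H^{-\sigma}}=\|H^{-\sigma/2}u\|_{L^2}<\infty$ (equivalently, the dual of $\mathcal H^{\sigma}$ with the dual norm), and let $X^{-1}(\mathbb R^2)=\bigcap_{\sigma>1}\mathcal H^{-\sigma}(\mathbb R^2)$, with the topology given by these norms and its Borel $\sigma$-algebra. With $x^\perp=(-x_2,x_1)$, set $$\mathcal T(f_1,f_2,f_3)(z)=\int_{\mathbb R}\int_{\mathbb R^2} f_1(x+z)\,f_2(\lambda x^\perp+z)\,\overline{f_3(x+\lambda x^\perp+z)}\,dx\,d\lambda ,\qquad \mathcal T_N(u)=\Pi_N\mathcal T(\Pi_Nu,\Pi_Nu,\Pi_Nu).$$ Let $(g_n)_{n\ge0}$ be independent standard complex Gaussian variables (density $\pi^{-1}e^{-|z|^2}$) on a probability space $(\Omega,\mathcal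 F,\mathbf p)$, let $\phi_n(x)=(\pi\, n!)^{-1/2}(x_1+ix_2)^n e^{-|x|^2/2}$, and let the white noise measure $\mu=\mathbf p\circ\gamma^{-1}$ be the law on $X^{-1}(\mathbb R^2)$ of $\gamma=\sum_{n\ge0}g_n\phi_n$; it is a probability measure. **Proposition.** For all real $p\ge2$ and $\sigma>1$, every $\mathcal T_N$ belongs to $L^p(X^{-1}(\mathbb R^2),d\mu;\mathcal H^{-\sigma}(\mathbb R^2))$, and $(\mathcal T_N)_{N\ge1}$ is a Cauchy sequence in this space. More precisely, there are $\delta>0$ and $C>0$ (depending on $p$ and $\sigma$) such that for all integers $1\le M<N$ $$\int_{X^{-1}(\mathbb R^2)}\|\mathcal T_N(u)-\mathcal T_M(u)\|_{\mathcal H^{-\sigma}}^p\,d\mu(u)\le C M^{-\delta}.$$ Consequently there is a map $\mathcal T:X^{-1}(\mathbb R^2)\to X^{-1}(\mathbb R^2)$, $\mathcal T(u)=\mathcal T(u,u,u)$ (determined $\mu$-almost everywhere), which for all real $p\ge2$ and $\sigma>1$ is the limit of $(\mathcal T_N)$ in $L^p(d\mu;\mathcal H^{-\sigma})$ and satisfies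 $\|\mathcal T(u)\|_{L^p_\mu\mathcal H^{-\sigma}}\le C_{p,\sigma}<\infty$. -/

import Mathlib

open MeasureTheory ProbabilityTheory Filter Topology
open scoped SchwartzMap ENNReal

noncomputable section

namespace CR

/-- The plane `ℝ²` with its Euclidean norm and Lebesgue measure. -/
abbrev Plane : Type := EuclideanSpace ℝ (Fin 2)

/-! ### The harmonic oscillator and its eigenspaces -/

/-- The harmonic oscillator `H = -Δ + |x|²` on Schwartz functions. -/
def oscillator : 𝓢(Plane, ℂ) →L[ℂ] 𝓢(Plane, ℂ) :=
  SchwartzMap.smulLeftCLM ℂ (fun x : Plane => ((‖x‖ ^ 2 : ℝ) : ℂ))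
    - LineDeriv.laplacianCLM ℂ Plane 𝓢(Plane, ℂ)

/-- The eigenspace `E_k` of `H` for the eigenvalue `2k + 2`. It consists of Schwartz functions
and has dimension `k + 1`. -/
def eigenspace (k : ℕ) : Submodule ℂ 𝓢(Plane, ℂ) :=
  Module.End.eigenspace (oscillator : 𝓢(Plane, ℂ) →ₗ[ℂ] 𝓢(Plane, ℂ)) (2 * (k : ℂ) + 2)

/-- `E_k` as a closed subspace of `L²(ℝ²)`. -/
def eigenspaceL2 (k : ℕ) : Submodule ℂ (Lp ℂ 2 (volume : Measure Plane)) :=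
  ((eigenspace k).map
    (SchwartzMap.toLpCLM ℂ ℂ 2 (volume : Measure Plane) :
      𝓢(Plane, ℂ) →ₗ[ℂ] Lp ℂ 2 (volume : Measure Plane))).topologicalClosure

instance (k : ℕ) : CompleteSpace (eigenspaceL2 k) :=
  Submodule.topologicalClosure.completeSpace _

/-- The `L²` norm of the orthogonal projection of a Schwartz function onto `E_k`. -/
def compNorm (k : ℕ) (ψ : 𝓢(Plane, ℂ)) : ℝ :=
  ‖(eigenspaceL2 k).starProjection (ψ.toLp 2)‖

/-- The norm of the harmonic Sobolev space `ℋ^σ(ℝ²)` on Schwartz functions: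
`‖H^{σ/2} ψ‖_{L²} = (∑ₖ (2k+2)^σ ‖Πₖ ψ‖²_{L²})^{1/2}`, where `Πₖ` is the orthogonal projector
onto `E_k`. The series converges for every `σ`, see `summable_sobNorm`. -/
def sobNorm (σ : ℝ) (ψ : 𝓢(Plane, ℂ)) : ℝ :=
  √(∑' k : ℕ, (2 * (k : ℝ) + 2) ^ σ * compNorm k ψ ^ 2)

lemma temperate_normSq : Function.HasTemperateGrowth fun x : Plane => ((‖x‖ ^ 2 : ℝ) : ℂ) :=
  Function.Complex.hasTemperateGrowth_ofReal.comp (Function.hasTemperateGrowth_norm_sq (H := Plane))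

lemma oscillator_eq (f : 𝓢(Plane, ℂ)) :
    oscillator f = SchwartzMap.smulLeftCLM ℂ (fun x : Plane => ((‖x‖ ^ 2 : ℝ) : ℂ)) f
      - Laplacian.laplacian f := by
  simp [oscillator]

lemma oscillator_apply (f : 𝓢(Plane, ℂ)) (x : Plane) :
    oscillator f x = ((‖x‖ ^ 2 : ℝ) : ℂ) * f x - Laplacian.laplacian f x := by
  rw [oscillator_eq, sub_apply, SchwartzMap.smulLeftCLM_apply_apply temperate_normSq,
    smul_eq_mul]

lemma mem_eigenspace {k : ℕ} {f : 𝓢(Plane, ℂ)} :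
    f ∈ eigenspace k ↔ oscillator f = (2 * (k : ℂ) + 2) • f := by
  simp [eigenspace]

/-- Complex conjugation on Schwartz functions. -/
def conjSchwartz (f : 𝓢(Plane, ℂ)) : 𝓢(Plane, ℂ) :=
  SchwartzMap.postcompCLM (𝕜 := ℝ) (Complex.conjCLE : ℂ →L[ℝ] ℂ) f

lemma conjSchwartz_apply (f : 𝓢(Plane, ℂ)) (x : Plane) :
    conjSchwartz f x = starRingEnd ℂ (f x) := rfl

lemma laplacian_conj (f : 𝓢(Plane, ℂ)) (x : Plane) :
    Laplacian.laplacian (conjSchwartz f) x = starRingEnd ℂ (Laplacian.laplacian f x) := by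
  rw [SchwartzMap.laplacian_apply, SchwartzMap.laplacian_apply]
  exact congrFun (InnerProductSpace.laplacian_CLE_comp_left (l := Complex.conjCLE)
    (f := (f : Plane → ℂ))) x

lemma oscillator_conj (f : 𝓢(Plane, ℂ)) :
    oscillator (conjSchwartz f) = conjSchwartz (oscillator f) := by
  ext x
  simp only [oscillator_apply, laplacian_conj, conjSchwartz_apply, map_sub, map_mul,
    Complex.conj_ofReal]

/-- `E_k` is stable under complex conjugation. -/
lemma conjSchwartz_mem {k : ℕ} {f : 𝓢(Plane, ℂ)} (hf : f ∈ eigenspace k) :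
    conjSchwartz f ∈ eigenspace k := by
  rw [mem_eigenspace] at hf ⊢
  rw [oscillator_conj, hf]
  ext x
  simp [conjSchwartz_apply, Complex.conj_ofNat]

lemma integral_oscillator (f g : 𝓢(Plane, ℂ)) :
    ∫ x, f x * oscillator g x = ∫ x, oscillator f x * g x := by
  have h := SchwartzMap.integral_mul_laplacian_right_eq_left (μ := volume) f g
  have i1 : Integrable fun x => f x * Laplacian.laplacian g x :=
    (SchwartzMap.pairing (ContinuousLinearMap.mul ℂ ℂ) f (Laplacian.laplacian g)).integrable
  have i2 : Integrable fun x => Laplacian.laplacian f x * g x :=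
    (SchwartzMap.pairing (ContinuousLinearMap.mul ℂ ℂ) (Laplacian.laplacian f) g).integrable
  have i3 : Integrable fun x => f x * (((‖x‖ ^ 2 : ℝ) : ℂ) * g x) := by
    have := (SchwartzMap.pairing (ContinuousLinearMap.mul ℂ ℂ) f
      (SchwartzMap.smulLeftCLM ℂ (fun x : Plane => ((‖x‖ ^ 2 : ℝ) : ℂ)) g)).integrable
      (μ := volume)
    refine this.congr (ae_of_all _ fun x => ?_)
    rw [SchwartzMap.pairing_apply_apply, SchwartzMap.smulLeftCLM_apply_apply temperate_normSq]
    rfl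
  have e : ∀ x, oscillator f x * g x
      = f x * (((‖x‖ ^ 2 : ℝ) : ℂ) * g x) - Laplacian.laplacian f x * g x := fun x => by
    rw [oscillator_apply]; ring
  simp only [e]
  rw [integral_sub i3 i2, ← h]
  simp only [oscillator_apply, mul_sub]
  rw [integral_sub i3 i1]

lemma inner_toLp (f g : 𝓢(Plane, ℂ)) :
    inner ℂ (f.toLp 2 : Lp ℂ 2 (volume : Measure Plane)) (g.toLp 2)
      = ∫ x, starRingEnd ℂ (f x) * g x := by
  refine (SchwartzMap.inner_toL2_toL2_eq f g volume).trans ?_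
  simp only [RCLike.inner_apply, mul_comm]

/-- `H` is symmetric. -/
lemma inner_oscillator (f g : 𝓢(Plane, ℂ)) :
    inner ℂ ((oscillator f).toLp 2 : Lp ℂ 2 (volume : Measure Plane)) (g.toLp 2)
      = inner ℂ (f.toLp 2 : Lp ℂ 2 (volume : Measure Plane)) ((oscillator g).toLp 2) := by
  rw [inner_toLp, inner_toLp]
  have h := integral_oscillator (conjSchwartz f) g
  rw [oscillator_conj] at h
  simp only [conjSchwartz_apply] at h
  exact h.symm

lemma toLp_mem {k : ℕ} {f : 𝓢(Plane, ℂ)} (hf : f ∈ eigenspace k) :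
    (f.toLp 2 : Lp ℂ 2 (volume : Measure Plane)) ∈ eigenspaceL2 k :=
  Submodule.le_topologicalClosure _ (Submodule.mem_map.2 ⟨f, hf, rfl⟩)

lemma inner_oscillator_of_mem (k : ℕ) (ψ : 𝓢(Plane, ℂ)) {v : Lp ℂ 2 (volume : Measure Plane)}
    (hv : v ∈ eigenspaceL2 k) :
    inner ℂ v ((oscillator ψ).toLp 2) = (2 * (k : ℂ) + 2) * inner ℂ v (ψ.toLp 2) := by
  have hcl : IsClosed {v : Lp ℂ 2 (volume : Measure Plane) |
      inner ℂ v ((oscillator ψ).toLp 2) = (2 * (k : ℂ) + 2) * inner ℂ v (ψ.toLp 2)} :=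
    isClosed_eq (by fun_prop) (by fun_prop)
  refine closure_minimal ?_ hcl hv
  rintro _ ⟨f, hf, rfl⟩
  change inner ℂ (f.toLp 2 volume) _ = _ * inner ℂ (f.toLp 2 volume) _
  have hf' := mem_eigenspace.1 hf
  rw [← inner_oscillator, hf']
  have : ((2 * (k : ℂ) + 2) • f).toLp 2 (volume : Measure Plane) =
      (2 * (k : ℂ) + 2) • f.toLp 2 volume := map_smul (SchwartzMap.toLpCLM ℂ ℂ 2 volume) _ f
  rw [this, inner_smul_left]
  simp only [map_add, map_mul, map_natCast, Complex.conj_ofNat]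

lemma inner_eq_zero {j k : ℕ} (hjk : j ≠ k) {v w : Lp ℂ 2 (volume : Measure Plane)}
    (hv : v ∈ eigenspaceL2 j) (hw : w ∈ eigenspaceL2 k) : inner ℂ v w = 0 := by
  have hcl : IsClosed {w : Lp ℂ 2 (volume : Measure Plane) | inner ℂ v w = 0} :=
    isClosed_eq (by fun_prop) (by fun_prop)
  refine closure_minimal ?_ hcl hw
  rintro _ ⟨f, hf, rfl⟩
  change inner ℂ v (f.toLp 2 volume) = 0
  have h := inner_oscillator_of_mem j f hv
  rw [mem_eigenspace.1 hf] at h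
  have : ((2 * (k : ℂ) + 2) • f).toLp 2 (volume : Measure Plane) =
      (2 * (k : ℂ) + 2) • f.toLp 2 volume := map_smul (SchwartzMap.toLpCLM ℂ ℂ 2 volume) _ f
  rw [this, inner_smul_right, ← sub_eq_zero, ← sub_mul, mul_eq_zero] at h
  refine h.resolve_left fun h0 => hjk ?_
  have h1 : (2 : ℂ) * ((k : ℂ) - j) = 0 := by linear_combination h0
  have h2 : (k : ℂ) = j := by
    rcases mul_eq_zero.1 h1 with h | h
    · norm_num at h
    · exact sub_eq_zero.1 h
  exact_mod_cast h2.symm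

lemma compNorm_oscillator (k : ℕ) (ψ : 𝓢(Plane, ℂ)) :
    compNorm k (oscillator ψ) = (2 * (k : ℝ) + 2) * compNorm k ψ := by
  have h : (eigenspaceL2 k).starProjection ((oscillator ψ).toLp 2)
      = (2 * (k : ℂ) + 2) • (eigenspaceL2 k).starProjection (ψ.toLp 2) := by
    refine Submodule.eq_starProjection_of_mem_of_inner_eq_zero
      (Submodule.smul_mem _ _ (Submodule.starProjection_apply_mem _ _)) (fun w hw => ?_)
    have h1 := inner_oscillator_of_mem k ψ hw
    have h2 : inner ℂ w (ψ.toLp 2 volume - (eigenspaceL2 k).starProjection (ψ.toLp 2)) = 0 :=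
      inner_eq_zero_symm.1 (Submodule.starProjection_inner_eq_zero _ w hw)
    rw [inner_eq_zero_symm, inner_sub_right, inner_smul_right, h1, ← mul_sub, ← inner_sub_right,
      h2, mul_zero]
  rw [compNorm, h, norm_smul, compNorm]
  congr 1
  have : (2 * (k : ℂ) + 2) = ((2 * (k : ℝ) + 2 : ℝ) : ℂ) := by push_cast; ring
  rw [this, Complex.norm_real, Real.norm_of_nonneg (by positivity)]

lemma summable_compNorm (ψ : 𝓢(Plane, ℂ)) : Summable fun k => compNorm k ψ ^ 2 := by
  have hV : OrthogonalFamily ℂ (fun k => eigenspaceL2 k) fun k => (eigenspaceL2 k).subtypeₗᵢ :=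
    fun j k hjk v w => inner_eq_zero hjk v.2 w.2
  refine summable_of_sum_le (c := ‖ψ.toLp 2 (volume : Measure Plane)‖ ^ 2)
    (fun k => sq_nonneg _) fun s => ?_
  set v : Lp ℂ 2 (volume : Measure Plane) := ψ.toLp 2 with hv
  set w : Lp ℂ 2 (volume : Measure Plane) :=
    ∑ k ∈ s, (eigenspaceL2 k).starProjection v with hw
  have h1 : ‖w‖ ^ 2 = ∑ k ∈ s, compNorm k ψ ^ 2 :=
    hV.norm_sum (fun k => ⟨_, Submodule.starProjection_apply_mem (eigenspaceL2 k) v⟩) s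
  have h2 : RCLike.re (inner ℂ w v) = ∑ k ∈ s, compNorm k ψ ^ 2 := by
    rw [hw, sum_inner, map_sum]
    exact Finset.sum_congr rfl fun k _ => Submodule.re_inner_starProjection_eq_normSq _ v
  have h3 : RCLike.re (inner ℂ w v) ≤ ‖w‖ * ‖v‖ := re_inner_le_norm w v
  rw [h2, ← h1] at h3
  rw [← h1]
  nlinarith [norm_nonneg w, norm_nonneg v, sq_nonneg (‖w‖ - ‖v‖)]

lemma summable_sobNorm (σ : ℝ) (ψ : 𝓢(Plane, ℂ)) :
    Summable fun k : ℕ => (2 * (k : ℝ) + 2) ^ σ * compNorm k ψ ^ 2 := by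
  obtain ⟨m, hm⟩ := exists_nat_ge σ
  have hit : ∀ (m : ℕ) (k : ℕ),
      compNorm k ((oscillator ^ m) ψ) = (2 * (k : ℝ) + 2) ^ m * compNorm k ψ := by
    intro m k
    induction m with
    | zero => simp
    | succ m ih =>
      rw [pow_succ', mul_apply_eq_comp, compNorm_oscillator, ih]
      ring
  refine (summable_compNorm ((oscillator ^ m) ψ)).of_nonneg_of_le
    (fun k => by positivity) fun k => ?_
  rw [hit, mul_pow]
  refine mul_le_mul_of_nonneg_right ?_ (sq_nonneg _)
  have h1 : (1 : ℝ) ≤ 2 * (k : ℝ) + 2 := by linarith [(k.cast_nonneg : (0 : ℝ) ≤ k)]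
  rw [← pow_mul, ← Real.rpow_natCast]
  refine Real.rpow_le_rpow_of_exponent_le h1 (hm.trans ?_)
  push_cast
  linarith [(m.cast_nonneg : (0 : ℝ) ≤ m)]

lemma compNorm_le_sobNorm (σ : ℝ) (k : ℕ) (ψ : 𝓢(Plane, ℂ)) :
    √((2 * (k : ℝ) + 2) ^ σ) * compNorm k ψ ≤ sobNorm σ ψ := by
  have h0 : 0 ≤ compNorm k ψ := norm_nonneg _
  rw [sobNorm]
  nth_rewrite 1 [← Real.sqrt_sq h0]
  rw [← Real.sqrt_mul (by positivity)]
  exact Real.sqrt_le_sqrt ((summable_sobNorm σ ψ).le_tsum k fun j _ => by positivity)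

/-! ### The Sobolev spaces of negative order and `X^{-1}(ℝ²)` -/

/-- `ℋ^{-σ}(ℝ²)` as a space of tempered distributions: those `u` which are bounded for the
`ℋ^σ` norm, that is, the dual of `ℋ^σ(ℝ²)` for the pairing extending `∫ u ψ`. -/
def negSobolev (σ : ℝ) : Submodule ℂ 𝓢'(Plane, ℂ) where
  carrier := {u | ∃ C : ℝ, 0 ≤ C ∧ ∀ ψ, ‖u ψ‖ ≤ C * sobNorm σ ψ}
  add_mem' := by
    rintro u v ⟨C, hC, h⟩ ⟨D, hD, h'⟩
    refine ⟨C + D, by positivity, fun ψ => ?_⟩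
    rw [add_mul]
    exact (norm_add_le _ _).trans (add_le_add (h ψ) (h' ψ))
  zero_mem' := ⟨0, le_rfl, fun ψ => by simp⟩
  smul_mem' := by
    rintro c u ⟨C, hC, h⟩
    refine ⟨‖c‖ * C, by positivity, fun ψ => ?_⟩
    rw [mul_assoc]
    exact (norm_smul_le c (u ψ)).trans (mul_le_mul_of_nonneg_left (h ψ) (norm_nonneg c))

/-- The space `ℋ^{-σ}(ℝ²)`, to be equipped with its norm. -/
def HNeg (σ : ℝ) : Type := negSobolev σ

instance (σ : ℝ) : AddCommGroup (HNeg σ) := inferInstanceAs (AddCommGroup (negSobolev σ))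

/-- The underlying tempered distribution. -/
def HNeg.toDist {σ : ℝ} (u : HNeg σ) : 𝓢'(Plane, ℂ) := u.1

/-- The norm of `ℋ^{-σ}(ℝ²)`, dual to the norm of `ℋ^σ(ℝ²)`: the least `C` with
`|u(ψ)| ≤ C ‖ψ‖_{ℋ^σ}` for all `ψ`. It equals `‖H^{-σ/2} u‖_{L²}`. -/
def HNeg.norm {σ : ℝ} (u : HNeg σ) : ℝ :=
  sInf {C : ℝ | 0 ≤ C ∧ ∀ ψ, ‖u.toDist ψ‖ ≤ C * sobNorm σ ψ}

lemma sobNorm_nonneg (σ : ℝ) (ψ : 𝓢(Plane, ℂ)) : 0 ≤ sobNorm σ ψ := Real.sqrt_nonneg _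

lemma HNeg.norm_nonneg {σ : ℝ} (u : HNeg σ) : 0 ≤ u.norm :=
  Real.sInf_nonneg fun _ h => h.1

lemma HNeg.norm_le {σ : ℝ} (u : HNeg σ) {C : ℝ} (hC : 0 ≤ C)
    (h : ∀ ψ, ‖u.toDist ψ‖ ≤ C * sobNorm σ ψ) : u.norm ≤ C :=
  csInf_le ⟨0, fun _ h => h.1⟩ ⟨hC, h⟩

lemma HNeg.le_norm {σ : ℝ} (u : HNeg σ) (ψ : 𝓢(Plane, ℂ)) :
    ‖u.toDist ψ‖ ≤ u.norm * sobNorm σ ψ := by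
  obtain ⟨C, hC, h⟩ := u.2
  rcases (sobNorm_nonneg σ ψ).eq_or_lt with h0 | h0
  · have h2 : ‖u.toDist ψ‖ ≤ C * sobNorm σ ψ := h ψ
    rw [← h0] at h2 ⊢
    simpa using h2
  · rw [← div_le_iff₀ h0]
    refine le_csInf ⟨C, hC, h⟩ ?_
    rintro D ⟨-, hD⟩
    rw [div_le_iff₀ h0]
    exact hD ψ

instance (σ : ℝ) : NormedAddCommGroup (HNeg σ) :=
  AddGroupNorm.toNormedAddCommGroup
    { toFun := HNeg.norm
      map_zero' := le_antisymm
        (HNeg.norm_le _ le_rfl fun ψ => by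
          change ‖(0 : 𝓢'(Plane, ℂ)) ψ‖ ≤ _
          simp) (HNeg.norm_nonneg _)
      add_le' := fun u v => HNeg.norm_le _ (add_nonneg u.norm_nonneg v.norm_nonneg) fun ψ => by
        rw [add_mul]
        exact (norm_add_le (u.toDist ψ) (v.toDist ψ)).trans
          (add_le_add (u.le_norm ψ) (v.le_norm ψ))
      neg' := fun u => by
        have h : ∀ ψ, ‖(-u).toDist ψ‖ = ‖u.toDist ψ‖ := fun ψ => norm_neg (u.toDist ψ)
        simp only [HNeg.norm, h]
      eq_zero_of_map_eq_zero' := fun u hu => by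
        refine Subtype.ext (DFunLike.ext _ _ fun ψ => ?_)
        have h := u.le_norm ψ
        change u.norm = 0 at hu
        rw [hu, zero_mul] at h
        exact norm_le_zero_iff.1 h }

/-- `X^{-1}(ℝ²) = ⋂_{σ > 1} ℋ^{-σ}(ℝ²)`. -/
def negSobolevInter : Submodule ℂ 𝓢'(Plane, ℂ) := ⨅ σ : {σ : ℝ // 1 < σ}, negSobolev σ

/-- The space `X^{-1}(ℝ²)`, to be equipped with its topology. -/
def XNegOne : Type := negSobolevInter

instance : AddCommGroup XNegOne := inferInstanceAs (AddCommGroup negSobolevInter)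

/-- The underlying tempered distribution. -/
def XNegOne.toDist (u : XNegOne) : 𝓢'(Plane, ℂ) := u.1

/-- The inclusion of `X^{-1}(ℝ²)` into `ℋ^{-σ}(ℝ²)`, `σ > 1`. -/
def XNegOne.toHNeg {σ : ℝ} (hσ : 1 < σ) (u : XNegOne) : HNeg σ :=
  ⟨u.1, (Submodule.mem_iInf _).1 u.2 ⟨σ, hσ⟩⟩

/-- `X^{-1}(ℝ²)` carries the topology given by all the norms of `ℋ^{-σ}(ℝ²)`, `σ > 1`. -/
instance : TopologicalSpace XNegOne :=
  ⨅ σ : {σ : ℝ // 1 < σ}, TopologicalSpace.induced (XNegOne.toHNeg σ.2) inferInstance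

instance : MeasurableSpace XNegOne := borel XNegOne

instance : BorelSpace XNegOne := ⟨rfl⟩

/-! ### Spectral projectors and the truncated nonlinearity -/

open Classical in
/-- The orthogonal projection onto `E_k` of the function or distribution whose pairing with test
functions is `ℓ`: the unique `φ ∈ E_k` with `∫ χ φ = ℓ(χ)` for all `χ ∈ E_k`. (As `E_k` is stable
under complex conjugation, this says that `φ` and `ℓ` have the same `L²` scalar products with
`E_k`. Such a `φ` exists since `E_k` has finite dimension.) -/
def eigenComponent (k : ℕ) (ℓ : 𝓢(Plane, ℂ) → ℂ) : 𝓢(Plane, ℂ) :=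
  if h : ∃ φ ∈ eigenspace k, ∀ χ ∈ eigenspace k, ∫ x, χ x * φ x = ℓ χ then h.choose else 0

/-- The orthogonal projector `Π_N` onto `⨁_{k ≤ N} E_k`. -/
def spectralProj (N : ℕ) (ℓ : 𝓢(Plane, ℂ) → ℂ) : 𝓢(Plane, ℂ) :=
  ∑ k ∈ Finset.range (N + 1), eigenComponent k ℓ

/-- `x^⊥ = (-x₂, x₁)`. -/
def perp (x : Plane) : Plane := !₂[-x 1, x 0]

/-- The trilinear operator of the continuous resonant system,
`𝒯(f₁, f₂, f₃)(z) = ∫_ℝ ∫_{ℝ²} f₁(x + z) f₂(λx^⊥ + z) conj(f₃(x + λx^⊥ + z)) dx dλ`. -/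
def trilinear (f₁ f₂ f₃ : Plane → ℂ) (z : Plane) : ℂ :=
  ∫ l : ℝ, ∫ x : Plane,
    f₁ (x + z) * f₂ (l • perp x + z) * starRingEnd ℂ (f₃ (x + l • perp x + z))

/-- `𝒯_N(u) = Π_N 𝒯(Π_N u, Π_N u, Π_N u)`, as a function. -/
def truncFun (N : ℕ) (u : XNegOne) : 𝓢(Plane, ℂ) :=
  let v : 𝓢(Plane, ℂ) := spectralProj N fun ψ => u.toDist ψ
  spectralProj N fun ψ => ∫ z, ψ z * trilinear v v v z

lemma eigenspace_le_negSobolev {k : ℕ} {f : 𝓢(Plane, ℂ)} (hf : f ∈ eigenspace k) (σ : ℝ) :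
    SchwartzMap.toTemperedDistributionCLM Plane ℂ volume f ∈ negSobolev σ := by
  have hpos : 0 < √((2 * (k : ℝ) + 2) ^ σ) := Real.sqrt_pos.2 (by positivity)
  refine ⟨‖(conjSchwartz f).toLp 2 (volume : Measure Plane)‖ * (√((2 * (k : ℝ) + 2) ^ σ))⁻¹,
    by positivity, fun ψ => ?_⟩
  rw [SchwartzMap.toTemperedDistributionCLM_apply_apply volume f ψ]
  have h1 : ∫ x, ψ x • f x = inner ℂ ((conjSchwartz f).toLp 2 : Lp ℂ 2 (volume : Measure Plane))
      ((eigenspaceL2 k).starProjection (ψ.toLp 2)) := by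
    rw [← Submodule.inner_starProjection_left_eq_right,
      Submodule.starProjection_eq_self_iff.2 (toLp_mem (conjSchwartz_mem hf)),
      inner_toLp]
    simp only [conjSchwartz_apply, Complex.conj_conj, smul_eq_mul, mul_comm]
  rw [h1, mul_assoc]
  refine (norm_inner_le_norm _ _).trans (mul_le_mul_of_nonneg_left ?_ (norm_nonneg _))
  rw [← div_eq_inv_mul, le_div_iff₀' hpos]
  exact compNorm_le_sobNorm σ k ψ

lemma eigenComponent_mem (k : ℕ) (ℓ : 𝓢(Plane, ℂ) → ℂ) : eigenComponent k ℓ ∈ eigenspace k := by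
  unfold eigenComponent
  split_ifs with h
  · exact h.choose_spec.1
  · exact zero_mem _

lemma spectralProj_mem (N : ℕ) (ℓ : 𝓢(Plane, ℂ) → ℂ) :
    SchwartzMap.toTemperedDistributionCLM Plane ℂ volume (spectralProj N ℓ)
      ∈ negSobolevInter := by
  rw [spectralProj, map_sum]
  exact sum_mem fun k _ => (Submodule.mem_iInf _).2 fun σ =>
    eigenspace_le_negSobolev (eigenComponent_mem k ℓ) σ

/-- `𝒯_N(u) = Π_N 𝒯(Π_N u, Π_N u, Π_N u)`, as an element of `X^{-1}(ℝ²)`. -/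
def trunc (N : ℕ) (u : XNegOne) : XNegOne :=
  ⟨SchwartzMap.toTemperedDistributionCLM Plane ℂ volume (truncFun N u), spectralProj_mem N _⟩

/-! ### The white noise measure -/

lemma exists_gaussian : ∃ G : 𝓢(Plane, ℂ), ∀ x, G x = Real.exp (-(‖x‖ ^ 2 / 2)) := by
  have hq : Function.HasTemperateGrowth fun x : Plane => -(‖x‖ ^ 2 / 2) := by
    have e : (fun x : Plane => -(‖x‖ ^ 2 / 2)) = (fun _ => -(1 / 2) : Plane → ℝ)
        * fun x => ‖x‖ ^ 2 := by
      funext x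
      simp only [Pi.mul_apply]
      ring
    rw [e]
    exact (Function.HasTemperateGrowth.const _).mul
      (Function.hasTemperateGrowth_norm_sq (H := Plane))
  have hexp : ContDiff ℝ ((⊤ : ℕ∞) : WithTop ℕ∞) Real.exp := Real.contDiff_exp
  have key : ∀ k n : ℕ, ∃ C : ℝ, ∀ x : Plane,
      ‖x‖ ^ k * ‖iteratedFDeriv ℝ n (Real.exp ∘ fun x : Plane => -(‖x‖ ^ 2 / 2)) x‖ ≤ C := by
    intro k n
    obtain ⟨m, C, hC, hb⟩ := hq.norm_iteratedFDeriv_le_uniform n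
    have hbd : ∀ x : Plane,
        ‖iteratedFDeriv ℝ n (Real.exp ∘ fun x : Plane => -(‖x‖ ^ 2 / 2)) x‖
          ≤ n.factorial * Real.exp (-(‖x‖ ^ 2 / 2)) * ((C + 1) * (1 + ‖x‖) ^ m) ^ n := by
      intro x
      refine norm_iteratedFDeriv_comp_le (N := ((⊤ : ℕ∞) : WithTop ℕ∞)) hexp hq.1 (by exact_mod_cast le_top) x
        (fun i _ => ?_) fun i hi hin => ?_
      · rw [norm_iteratedFDeriv_eq_norm_iteratedDeriv, iteratedDeriv_eq_iterate,
          Real.iter_deriv_exp, Real.norm_of_nonneg (Real.exp_pos _).le]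
      · have h1 : (1 : ℝ) ≤ (C + 1) * (1 + ‖x‖) ^ m := by
          have : (1 : ℝ) ≤ (1 + ‖x‖) ^ m := one_le_pow₀ (by linarith [norm_nonneg x])
          nlinarith
        refine (hb i hin x).trans (le_trans ?_ (le_self_pow₀ h1 (by omega)))
        have : (0 : ℝ) ≤ (1 + ‖x‖) ^ m := by positivity
        nlinarith
    refine ⟨n.factorial * (C + 1) ^ n * ((k + m * n).factorial * Real.exp (3 / 2)), fun x => ?_⟩
    have hr : 0 ≤ ‖x‖ := norm_nonneg x
    have h1 : (1 + ‖x‖) ^ (k + m * n) * Real.exp (-(‖x‖ ^ 2 / 2))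
        ≤ (k + m * n).factorial * Real.exp (3 / 2) := by
      have h2 := Real.pow_div_factorial_le_exp (1 + ‖x‖) (by positivity) (k + m * n)
      rw [div_le_iff₀ (by positivity)] at h2
      calc (1 + ‖x‖) ^ (k + m * n) * Real.exp (-(‖x‖ ^ 2 / 2))
          ≤ Real.exp (1 + ‖x‖) * (k + m * n).factorial * Real.exp (-(‖x‖ ^ 2 / 2)) := by gcongr
        _ = (k + m * n).factorial * Real.exp (1 + ‖x‖ + -(‖x‖ ^ 2 / 2)) := by
          rw [Real.exp_add (1 + ‖x‖)]; ring
        _ ≤ _ := by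
          gcongr
          nlinarith [sq_nonneg (‖x‖ - 1)]
    calc ‖x‖ ^ k * _
        ≤ (1 + ‖x‖) ^ k * (n.factorial * Real.exp (-(‖x‖ ^ 2 / 2))
            * ((C + 1) * (1 + ‖x‖) ^ m) ^ n) := by
          gcongr
          · linarith
          · exact hbd x
      _ = n.factorial * (C + 1) ^ n
            * ((1 + ‖x‖) ^ (k + m * n) * Real.exp (-(‖x‖ ^ 2 / 2))) := by
          rw [mul_pow, ← pow_mul, pow_add]; ring
      _ ≤ _ := by gcongr
  let G : 𝓢(Plane, ℝ) :=
    { toFun := Real.exp ∘ fun x : Plane => -(‖x‖ ^ 2 / 2)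
      smooth' := hexp.comp hq.1
      decay' := key }
  exact ⟨SchwartzMap.postcompCLM (𝕜 := ℝ) Complex.ofRealCLM G, fun x => rfl⟩

lemma exists_holHermite (n : ℕ) : ∃ φ : 𝓢(Plane, ℂ), ∀ x : Plane,
    φ x = (1 / √(Real.pi * n.factorial) : ℝ) * ((x 0 : ℂ) + Complex.I * (x 1 : ℂ)) ^ n
      * Real.exp (-(‖x‖ ^ 2 / 2)) := by
  obtain ⟨G, hG⟩ := exists_gaussian
  have hc : ∀ i : Fin 2, Function.HasTemperateGrowth fun x : Plane => (x i : ℂ) := fun i =>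
    Function.Complex.hasTemperateGrowth_ofReal.comp
      (EuclideanSpace.proj i : Plane →L[ℝ] ℝ).hasTemperateGrowth
  have h : Function.HasTemperateGrowth fun x : Plane =>
      ((1 / √(Real.pi * n.factorial) : ℝ) : ℂ)
        * ((x 0 : ℂ) + Complex.I * (x 1 : ℂ)) ^ n :=
    (Function.HasTemperateGrowth.const _).mul
      (((hc 0).add ((Function.HasTemperateGrowth.const _).mul (hc 1))).pow n)
  exact ⟨SchwartzMap.smulLeftCLM ℂ _ G, fun x => by
    rw [SchwartzMap.smulLeftCLM_apply_apply h, hG, smul_eq_mul]⟩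

/-- The holomorphic Hermite function `φₙ(x) = (π n!)^{-1/2} (x₁ + i x₂)ⁿ exp(-|x|²/2)`; its values
are given by `holHermite_apply`. -/
def holHermite (n : ℕ) : 𝓢(Plane, ℂ) := (exists_holHermite n).choose

lemma holHermite_apply (n : ℕ) (x : Plane) :
    holHermite n x = (1 / √(Real.pi * n.factorial) : ℝ)
      * ((x 0 : ℂ) + Complex.I * (x 1 : ℂ)) ^ n * Real.exp (-(‖x‖ ^ 2 / 2)) :=
  (exists_holHermite n).choose_spec x

/-- The standard complex Gaussian law `𝒩_ℂ(0, 1)`, with density `π⁻¹ exp(-|z|²)`. -/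
def stdComplexGaussian : Measure ℂ :=
  volume.withDensity fun z => ENNReal.ofReal (Real.pi⁻¹ * Real.exp (-‖z‖ ^ 2))

/-- The random series `γ = ∑ₙ gₙ φₙ`, as a tempered distribution. -/
def noiseDist {Ω : Type*} (g : ℕ → Ω → ℂ) (ω : Ω) : 𝓢'(Plane, ℂ) :=
  ∑' n : ℕ, g n ω • SchwartzMap.toTemperedDistributionCLM Plane ℂ volume (holHermite n)

open Classical in
/-- `γ` as a random variable with values in `X^{-1}(ℝ²)` (it takes its values there almost surely;
it is replaced by `0` where it does not). -/
def noise {Ω : Type*} (g : ℕ → Ω → ℂ) (ω : Ω) : XNegOne :=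
  if h : noiseDist g ω ∈ negSobolevInter then ⟨noiseDist g ω, h⟩ else 0

/-- The white noise measure `μ = 𝐩 ∘ γ⁻¹` on `X^{-1}(ℝ²)`. -/
def whiteNoise {Ω : Type*} [MeasurableSpace Ω] (P : Measure Ω) (g : ℕ → Ω → ℂ) :
    Measure XNegOne :=
  P.map (noise g)

end CR

end

open CR

/-! The noise lives on the span of the holomorphic functions `hol n`, and there the trilinear
operator becomes local: up to the factor 2π² it is the orthogonal projection of |v|²v onto this span
(`trilinear_eq_sum`). In complex coordinates x^⊥ = ix, and after the substitution q = (1 + iλ)x + z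
the three Gaussians combine into one that does not depend on λ (`norm_sq_rectangle`). The dependence
on λ is then polynomial in the Cayley transform of λ, and averaging against dλ/(1 + λ²) gives π
times the value of that polynomial at 0 (`integral_inv_mul_eval_cayley`). Expanding the remaining
Gaussian integral in monomials identifies it with the projection of |v|²v. Almost surely every
spectral component of the noise is a multiple of the corresponding φₖ (`holSet`), so this formula
computes 𝒯_N(u) from the Gaussian coefficients (`trunc_eq`, `ae_trunc_eq`).

No renormalization is needed, because the value at z of a truncated noise is a Gaussian whose
variance is at most ∑ |φₙ(z)|² = 1/π (`hasSum_norm_hol_sq`). Hence the moments of |v|²v are bounded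
uniformly in z and N (`exists_cubic_bound`), while those of a difference are controlled by the tail
of that series (`exists_cubic_sub_bound`).

To pass from pointwise moments to ℋ^{-σ}, fix 1 < s < min(σ, 2). Since |φₙ|² concentrates near |z|²
≈ n, the weight (1 + |z|²)^{±s} acts on φₙ like (n + 1)^{±s}. Radial weights keep the φₙ orthogonal,
so duality gives a weighted Bessel inequality (`sum_rpow_mul_norm_coeff_sq_le`). The weight with
exponent -s has finite mass because s > 1, which allows Jensen's inequality and Tonelli
(`exists_holX_resCoeff_bound`).

The difference 𝒯_N - 𝒯_M splits into the low frequencies of a difference of cubic terms, small by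
the tail of the variance (`exists_lintegral_tail_bound`), and the high frequencies of one cubic
term, small by the gap σ - s (`exists_truncX_bounds`). The polynomial rate makes the sequence
indexed by powers of two converge almost surely in X^{-1}, and Fatou's lemma upgrades this to
convergence of the whole sequence in every L^p. -/

namespace CR

/-! ### Complex coordinates and the holomorphic Hermite functions -/

/-- The identification of `ℂ` with the plane. -/
noncomputable def toPlane : ℂ ≃ₗᵢ[ℝ] Plane := Complex.orthonormalBasisOneI.repr

lemma toPlane_zero (z : ℂ) : toPlane z 0 = z.re := by
  simp [toPlane, Complex.orthonormalBasisOneI_repr_apply]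

lemma toPlane_one (z : ℂ) : toPlane z 1 = z.im := by
  simp [toPlane, Complex.orthonormalBasisOneI_repr_apply]

lemma measurePreserving_toPlane : MeasurePreserving toPlane := toPlane.measurePreserving

lemma measurableEmbedding_toPlane : MeasurableEmbedding toPlane :=
  toPlane.toHomeomorph.measurableEmbedding

lemma integral_plane (f : Plane → ℂ) : ∫ x, f x = ∫ z : ℂ, f (toPlane z) :=
  (measurePreserving_toPlane.integral_comp measurableEmbedding_toPlane f).symm

lemma holHermite_toPlane (n : ℕ) (z : ℂ) : holHermite n (toPlane z)
    = (1 / √(Real.pi * n.factorial) : ℝ) * z ^ n * Real.exp (-(‖z‖ ^ 2 / 2)) := by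
  rw [holHermite_apply, toPlane_zero, toPlane_one, LinearIsometryEquiv.norm_map,
    mul_comm Complex.I, Complex.re_add_im]

/-- The holomorphic Hermite functions in complex coordinates. -/
noncomputable def hol (n : ℕ) (z : ℂ) : ℂ := holHermite n (toPlane z)

lemma hol_eq (n : ℕ) (z : ℂ) : hol n z
    = (1 / √(Real.pi * n.factorial) : ℝ) * z ^ n * Real.exp (-(‖z‖ ^ 2 / 2)) :=
  holHermite_toPlane n z

lemma continuous_hol (n : ℕ) : Continuous (hol n) :=
  (holHermite n).continuous.comp toPlane.continuous

lemma norm_hol_sq (n : ℕ) (z : ℂ) :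
    ‖hol n z‖ ^ 2 = (Real.pi * n.factorial)⁻¹ * ‖z‖ ^ (2 * n) * Real.exp (-‖z‖ ^ 2) := by
  rw [hol_eq, norm_mul, norm_mul, norm_pow, Complex.norm_real, Complex.norm_real,
    Real.norm_of_nonneg (by positivity), Real.norm_of_nonneg (by positivity), mul_pow, mul_pow,
    div_pow, Real.sq_sqrt (by positivity), ← Real.exp_nat_mul, ← pow_mul]
  congr 2
  · ring
  · ring
  · push_cast; ring

lemma integral_norm_pow_mul_exp (n : ℕ) {b : ℝ} (hb : 0 < b) :
    ∫ z : ℂ, ‖z‖ ^ (2 * n) * Real.exp (-b * ‖z‖ ^ 2)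
      = Real.pi * n.factorial / b ^ (n + 1) := by
  have h := Complex.integral_rpow_mul_exp_neg_mul_rpow (p := 2) (q := 2 * n) (b := b)
    (by norm_num) (by linarith [(n.cast_nonneg : (0 : ℝ) ≤ n)]) hb
  have e1 : (2 * (n : ℝ) + 2) / 2 = n + 1 := by ring
  have e2 : -(2 * (n : ℝ) + 2) / 2 = -((n + 1 : ℕ) : ℝ) := by push_cast; ring
  rw [e1, e2, Real.Gamma_nat_eq_factorial, Real.rpow_neg hb.le, Real.rpow_natCast] at h
  have e3 : ∀ z : ℂ, ‖z‖ ^ (2 * n) * Real.exp (-b * ‖z‖ ^ 2)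
      = ‖z‖ ^ (2 * (n : ℝ)) * Real.exp (-b * ‖z‖ ^ (2 : ℝ)) := fun z => by
    rw [← Real.rpow_natCast, ← Real.rpow_natCast]; push_cast; rfl
  simp only [e3, h]
  field_simp

lemma integrable_norm_pow_mul_exp (n : ℕ) {b : ℝ} (hb : 0 < b) :
    Integrable fun z : ℂ => ‖z‖ ^ (2 * n) * Real.exp (-b * ‖z‖ ^ 2) := by
  -- A non-integrable function has integral 0 by convention, so a nonzero value of the integral
  -- proves integrability.
  refine Integrable.of_integral_ne_zero ?_
  rw [integral_norm_pow_mul_exp n hb]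
  positivity

lemma integral_norm_hol_sq (n : ℕ) : ∫ z, ‖hol n z‖ ^ 2 = 1 := by
  have h := integral_norm_pow_mul_exp n (b := 1) one_pos
  simp only [norm_hol_sq, mul_assoc, integral_const_mul]
  simp only [neg_mul, one_mul, one_pow, div_one] at h
  rw [h]
  exact inv_mul_cancel₀ (by positivity)

lemma integrable_norm_hol_sq (n : ℕ) : Integrable fun z => ‖hol n z‖ ^ 2 :=
  Integrable.of_integral_ne_zero (by rw [integral_norm_hol_sq]; exact one_ne_zero)

/-- The raising relation between the densities `|φₙ|²`. -/
lemma norm_sq_mul_norm_hol_sq (n : ℕ) (z : ℂ) :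
    ‖z‖ ^ 2 * ‖hol n z‖ ^ 2 = (n + 1) * ‖hol (n + 1) z‖ ^ 2 := by
  rw [norm_hol_sq, norm_hol_sq, Nat.factorial_succ]
  push_cast
  field_simp
  ring

/-- This is the exponential series at |z|² against exp(-|z|²). The sum is the variance of the full
noise at z; that it is finite and independent of z is what keeps the cubic term under control. -/
lemma hasSum_norm_hol_sq (z : ℂ) : HasSum (fun n => ‖hol n z‖ ^ 2) Real.pi⁻¹ := by
  have h : HasSum (fun n : ℕ => (‖z‖ ^ 2) ^ n / n.factorial) (Real.exp (‖z‖ ^ 2)) := by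
    rw [Real.exp_eq_exp_ℝ]
    exact NormedSpace.expSeries_div_hasSum_exp (𝔸 := ℝ) _
  have h2 := (h.mul_left (Real.pi⁻¹ * Real.exp (-‖z‖ ^ 2)))
  rw [mul_assoc, ← Real.exp_add] at h2
  simp only [neg_add_cancel, Real.exp_zero, mul_one] at h2
  refine h2.congr_fun ?_
  intro n
  rw [norm_hol_sq, mul_inv, pow_mul]
  ring

lemma sum_norm_hol_sq_le (s : Finset ℕ) (z : ℂ) : ∑ n ∈ s, ‖hol n z‖ ^ 2 ≤ Real.pi⁻¹ :=
  sum_le_hasSum s (fun _ _ => sq_nonneg _) (hasSum_norm_hol_sq z)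

/-- Restriction to a coordinate line: r is the coordinate that moves, q the square of the fixed one,
and ε the coefficient of the moving coordinate in x₁ + i x₂. -/
lemma hasDerivAt_pow_mul_gaussian (w ε : ℂ) (r q : ℝ) (n : ℕ) :
    HasDerivAt (fun t : ℝ => (w + t * ε) ^ n
        * ((Real.exp (-(((r + t) ^ 2 + q) / 2)) : ℝ) : ℂ))
      ((n * w ^ (n - 1) * ε - r * w ^ n) * ((Real.exp (-((r ^ 2 + q) / 2)) : ℝ) : ℂ)) 0 := by
  have h1 : HasDerivAt (fun t : ℝ => w + (t : ℂ) * ε) ε 0 := by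
    simpa using ((Complex.ofRealCLM.hasDerivAt (x := (0 : ℝ))).mul_const ε).const_add w
  have h2 : HasDerivAt (fun t : ℝ => Real.exp (-(((r + t) ^ 2 + q) / 2)))
      (Real.exp (-((r ^ 2 + q) / 2)) * (-r)) 0 := by
    have : HasDerivAt (fun t : ℝ => -(((r + t) ^ 2 + q) / 2)) (-r) 0 := by
      have h := (((((hasDerivAt_id (0 : ℝ)).const_add r).pow 2).add_const q).div_const 2).fun_neg
      refine h.congr_deriv ?_
      norm_num
    simpa using this.exp
  have h3 := (h1.fun_pow n).mul h2.ofReal_comp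
  refine h3.congr_deriv ?_
  push_cast
  simp only [zero_mul, add_zero]
  ring

/-- The unnormalized function `zⁿ exp(-(a²+b²)/2)`, `z = a + i b`. -/
noncomputable def powGauss (n : ℕ) (x : Plane) : ℂ :=
  ((x 0 : ℂ) + Complex.I * (x 1 : ℂ)) ^ n * ((Real.exp (-(‖x‖ ^ 2 / 2)) : ℝ) : ℂ)

lemma normSq_plane (x : Plane) : ‖x‖ ^ 2 = x 0 ^ 2 + x 1 ^ 2 := by
  rw [EuclideanSpace.norm_sq_eq, Fin.sum_univ_two]
  simp

/-- The coefficient of the `i`-th coordinate in `x₁ + i x₂`. -/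
noncomputable def coordCoeff (i : Fin 2) : ℂ := if i = 0 then 1 else Complex.I

lemma hasDerivAt_powGauss (n : ℕ) (x : Plane) (i : Fin 2) :
    HasDerivAt (fun t : ℝ => powGauss n (x + t • EuclideanSpace.single i 1))
      (n * coordCoeff i * powGauss (n - 1) x - x i * powGauss n x) 0 := by
  fin_cases i
  · refine ((hasDerivAt_pow_mul_gaussian ((x 0 : ℂ) + Complex.I * (x 1 : ℂ)) 1 (x 0) (x 1 ^ 2)
      n).congr_deriv ?_).congr_of_eventuallyEq (Eventually.of_forall fun t => ?_)
    · simp only [powGauss, normSq_plane, coordCoeff]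
      simp
      ring
    · simp only [powGauss, normSq_plane]
      simp
      ring_nf
  · refine ((hasDerivAt_pow_mul_gaussian ((x 0 : ℂ) + Complex.I * (x 1 : ℂ)) Complex.I (x 1)
      (x 0 ^ 2) n).congr_deriv ?_).congr_of_eventuallyEq (Eventually.of_forall fun t => ?_)
    · simp only [powGauss, normSq_plane, coordCoeff]
      simp
      ring_nf
    · simp only [powGauss, normSq_plane]
      simp
      ring_nf

lemma hasDerivAt_coord (x : Plane) (i : Fin 2) :
    HasDerivAt (fun t : ℝ => (((x + t • EuclideanSpace.single i 1 : Plane) i : ℝ) : ℂ)) 1 0 := by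
  have : HasDerivAt (fun t : ℝ => x i + t) 1 0 := by
    simpa using (hasDerivAt_id (0 : ℝ)).const_add (x i)
  simpa using this.ofReal_comp

lemma lineDeriv_schwartz_eq {f : 𝓢(Plane, ℂ)} {m x : Plane} {c : ℂ}
    (h : HasDerivAt (fun t : ℝ => f (x + t • m)) c 0) :
    LineDeriv.lineDerivOp m f x = c := by
  rw [SchwartzMap.lineDerivOp_apply]
  exact h.deriv

lemma holHermite_eq_powGauss (n : ℕ) (x : Plane) :
    holHermite n x = (1 / √(Real.pi * n.factorial) : ℝ) * powGauss n x := by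
  rw [holHermite_apply, powGauss, mul_assoc]

lemma lineDeriv_holHermite (n : ℕ) (i : Fin 2) (x : Plane) :
    LineDeriv.lineDerivOp (EuclideanSpace.single i 1 : Plane) (holHermite n) x
      = (1 / √(Real.pi * n.factorial) : ℝ)
        * (n * coordCoeff i * powGauss (n - 1) x - x i * powGauss n x) := by
  refine lineDeriv_schwartz_eq ?_
  simp only [holHermite_eq_powGauss]
  exact (hasDerivAt_powGauss n x i).const_mul _

lemma lineDeriv_lineDeriv_holHermite (n : ℕ) (i : Fin 2) (x : Plane) :
    LineDeriv.lineDerivOp (EuclideanSpace.single i 1 : Plane)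
      (LineDeriv.lineDerivOp (EuclideanSpace.single i 1 : Plane) (holHermite n)) x
      = (1 / √(Real.pi * n.factorial) : ℝ)
        * (n * coordCoeff i * ((n - 1 : ℕ) * coordCoeff i * powGauss (n - 1 - 1) x
            - x i * powGauss (n - 1) x)
          - (powGauss n x + x i * (n * coordCoeff i * powGauss (n - 1) x
            - x i * powGauss n x))) := by
  refine lineDeriv_schwartz_eq ?_
  simp only [lineDeriv_holHermite]
  refine ((((hasDerivAt_powGauss (n - 1) x i).const_mul _).sub
    ((hasDerivAt_coord x i).mul (hasDerivAt_powGauss n x i))).const_mul _).congr_deriv ?_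
  simp

/-- The second derivatives of the holomorphic factor cancel because 1 + I² = 0, and the mixed terms
add up by Euler's identity. -/
lemma laplacian_holHermite (n : ℕ) (x : Plane) :
    Laplacian.laplacian (holHermite n) x
      = ((‖x‖ ^ 2 : ℝ) : ℂ) * holHermite n x - (2 * (n : ℂ) + 2) * holHermite n x := by
  rw [SchwartzMap.laplacian_eq_sum (EuclideanSpace.basisFun (Fin 2) ℝ), Fin.sum_univ_two, add_apply,
    EuclideanSpace.basisFun_apply, EuclideanSpace.basisFun_apply, lineDeriv_lineDeriv_holHermite,
    lineDeriv_lineDeriv_holHermite, holHermite_eq_powGauss, normSq_plane]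
  simp only [coordCoeff]
  -- Euler's identity z · n z^(n-1) = n z^n. The factor n makes the truncated n - 1 harmless at n =
  -- 0.
  have h : (n : ℂ) * (((x 0 : ℂ) + Complex.I * (x 1 : ℂ)) * powGauss (n - 1) x)
      = n * powGauss n x := by
    rcases n with _ | n
    · simp
    · simp only [powGauss, Nat.add_sub_cancel, pow_succ]
      ring
  push_cast
  linear_combination (1 / ((√(Real.pi * n.factorial) : ℝ) : ℂ)) * (-2 * h
    + n * (n - 1 : ℕ) * powGauss (n - 1 - 1) x * Complex.I_sq)

lemma holHermite_mem (n : ℕ) : holHermite n ∈ eigenspace n := by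
  rw [mem_eigenspace]
  ext x
  rw [oscillator_apply, laplacian_holHermite, smul_apply, smul_eq_mul]
  ring

lemma hol_mul (n : ℕ) (a : Circle) (z : ℂ) : hol n (a * z) = (a : ℂ) ^ n * hol n z := by
  rw [hol_eq, hol_eq, norm_mul, Circle.norm_coe, one_mul, mul_pow]
  ring

/-- The holomorphic Hermite functions are orthogonal for every radial weight. -/
lemma integral_radial_conj_hol_mul_hol (w : ℝ → ℂ) {m n : ℕ} (hmn : m ≠ n) :
    ∫ z : ℂ, w ‖z‖ * (starRingEnd ℂ (hol m z) * hol n z) = 0 := by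
  -- The rotation by π/(n - m) multiplies the integrand by exp(iπ) = -1, so the integral equals its
  -- opposite. No integrability is needed.
  set a : Circle := Circle.exp (Real.pi / ((n : ℝ) - m)) with ha
  have hne : (n : ℂ) - m ≠ 0 := sub_ne_zero.2 (by exact_mod_cast hmn.symm)
  have hph : starRingEnd ℂ ((a : ℂ) ^ m) * (a : ℂ) ^ n = -1 := by
    rw [map_pow, ← Circle.coe_inv_eq_conj, ha, ← Circle.exp_neg, Circle.coe_exp, Circle.coe_exp,
      ← Complex.exp_nat_mul, ← Complex.exp_nat_mul, ← Complex.exp_add, ← Complex.exp_pi_mul_I]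
    congr 1
    push_cast
    field_simp
    ring
  have h := (rotation a).measurePreserving.integral_comp
    (rotation a).toHomeomorph.measurableEmbedding
    fun z : ℂ => w ‖z‖ * (starRingEnd ℂ (hol m z) * hol n z)
  have h2 : ∀ z : ℂ, w ‖rotation a z‖ * (starRingEnd ℂ (hol m (rotation a z))
      * hol n (rotation a z)) = -(w ‖z‖ * (starRingEnd ℂ (hol m z) * hol n z)) := fun z => by
    rw [LinearIsometryEquiv.norm_map, rotation_apply, hol_mul, hol_mul, map_mul]
    linear_combination w ‖z‖ * starRingEnd ℂ (hol m z) * hol n z * hph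
  simp only [h2, integral_neg] at h
  have h3 : (2 : ℂ) * ∫ z : ℂ, w ‖z‖ * (starRingEnd ℂ (hol m z) * hol n z) = 0 := by
    linear_combination -h
  exact (mul_eq_zero.1 h3).resolve_left two_ne_zero

lemma integral_conj_holHermite_mul_holHermite (m n : ℕ) :
    ∫ x, starRingEnd ℂ (holHermite m x) * holHermite n x = if m = n then 1 else 0 := by
  rw [integral_plane]
  change ∫ z, starRingEnd ℂ (hol m z) * hol n z = _
  split_ifs with h
  · subst h
    have e : ∀ z, starRingEnd ℂ (hol m z) * hol m z = ((‖hol m z‖ ^ 2 : ℝ) : ℂ) := fun z => by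
      rw [Complex.conj_mul']
      push_cast
      rfl
    simp only [e]
    have h := integral_complex_ofReal (μ := volume) (f := fun z : ℂ => ‖hol m z‖ ^ 2)
    rw [integral_norm_hol_sq] at h
    exact h.trans Complex.ofReal_one
  · simpa using integral_radial_conj_hol_mul_hol (fun _ => 1) h

lemma norm_toLp_conj_holHermite (n : ℕ) :
    ‖(conjSchwartz (holHermite n)).toLp 2 (volume : Measure Plane)‖ = 1 := by
  have h := inner_toLp (conjSchwartz (holHermite n)) (conjSchwartz (holHermite n))
  rw [inner_self_eq_norm_sq_to_K] at h
  simp only [conjSchwartz_apply, Complex.conj_conj] at h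
  have h2 := integral_conj_holHermite_mul_holHermite n n
  rw [if_pos rfl] at h2
  simp only [mul_comm] at h h2
  rw [h2] at h
  have h3 : (‖(conjSchwartz (holHermite n)).toLp 2 (volume : Measure Plane)‖ ^ 2 : ℝ) = 1 := by
    apply Complex.ofReal_injective
    rw [Complex.ofReal_pow]
    exact h
  exact (pow_eq_one_iff_of_nonneg (norm_nonneg _) two_ne_zero).1 h3

/-! ### Weighted norms of the holomorphic Hermite functions -/

/-- The radial weight `(1 + |z|²)^s`. -/
noncomputable def radWeight (s : ℝ) (z : ℂ) : ℝ := (1 + ‖z‖ ^ 2) ^ s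

lemma radWeight_pos (s : ℝ) (z : ℂ) : 0 < radWeight s z := by
  unfold radWeight; positivity

lemma continuous_radWeight (s : ℝ) : Continuous (radWeight s) :=
  (by fun_prop : Continuous fun z : ℂ => 1 + ‖z‖ ^ 2).rpow_const
    fun z => Or.inl (by positivity)

lemma integrable_radWeight_neg {s : ℝ} (hs : 1 < s) : Integrable (radWeight (-s)) := by
  have h := integrable_rpow_neg_one_add_norm_sq (E := ℂ) (μ := volume) (r := 2 * s)
    (by rw [Complex.finrank_real_complex]; push_cast; linarith)
  refine h.congr (ae_of_all _ fun z => ?_)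
  simp only [radWeight]
  congr 1
  ring

/-- A crude interpolation between the exponents 0 and 2: it reduces every weight with 0 ≤ s ≤ 2 to
the case s = 2, where the raising relation applies. -/
lemma rpow_le_one_add_sq {x s : ℝ} (hx : 0 ≤ x) (hs0 : 0 ≤ s) (hs : s ≤ 2) :
    x ^ s ≤ 1 + x ^ 2 := by
  rcases le_total x 1 with h | h
  · have := Real.rpow_le_one hx h hs0
    nlinarith [sq_nonneg x]
  · have := Real.rpow_le_rpow_of_exponent_le h hs
    rw [Real.rpow_two] at this
    linarith

lemma one_add_norm_sq_sq_mul (n : ℕ) (z : ℂ) : (1 + ‖z‖ ^ 2) ^ 2 * ‖hol n z‖ ^ 2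
    = ‖hol n z‖ ^ 2 + 2 * (n + 1) * ‖hol (n + 1) z‖ ^ 2
      + (n + 1) * (n + 2) * ‖hol (n + 2) z‖ ^ 2 := by
  have h1 := norm_sq_mul_norm_hol_sq n z
  have h2 := norm_sq_mul_norm_hol_sq (n + 1) z
  push_cast at h2
  linear_combination (2 + ‖z‖ ^ 2) * h1 + (n + 1) * h2

lemma radWeight_mul_le (n : ℕ) {s : ℝ} (hs0 : 0 ≤ s) (hs : s ≤ 2) (z : ℂ) :
    radWeight s z * ‖hol n z‖ ^ 2 ≤ ((n : ℝ) + 1) ^ s * (‖hol n z‖ ^ 2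
      + (‖hol n z‖ ^ 2 + 2 * (n + 1) * ‖hol (n + 1) z‖ ^ 2
      + (n + 1) * (n + 2) * ‖hol (n + 2) z‖ ^ 2) / (n + 1) ^ 2) := by
  have hn : (0 : ℝ) < n + 1 := by positivity
  -- This ratio is of order one where |φₙ|² has its mass, so interpolating at this scale loses only
  -- a constant.
  have h := rpow_le_one_add_sq (x := (1 + ‖z‖ ^ 2) / (n + 1)) (by positivity) hs0 hs
  rw [Real.div_rpow (by positivity) hn.le, div_le_iff₀ (by positivity)] at h
  rw [← one_add_norm_sq_sq_mul]
  calc radWeight s z * ‖hol n z‖ ^ 2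
      ≤ ((1 + ((1 + ‖z‖ ^ 2) / (n + 1)) ^ 2) * ((n : ℝ) + 1) ^ s) * ‖hol n z‖ ^ 2 := by
        gcongr
        exact h
    _ = _ := by field_simp

lemma integrable_radWeight_mul (n : ℕ) {s : ℝ} (hs0 : 0 ≤ s) (hs : s ≤ 2) :
    Integrable fun z => radWeight s z * ‖hol n z‖ ^ 2 := by
  refine Integrable.mono' (((integrable_norm_hol_sq n).add ((((integrable_norm_hol_sq n).add
    ((integrable_norm_hol_sq (n + 1)).const_mul (2 * (n + 1)))).add
    ((integrable_norm_hol_sq (n + 2)).const_mul ((n + 1) * (n + 2)))).div_const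
      (((n : ℝ) + 1) ^ 2))).const_mul (((n : ℝ) + 1) ^ s))
    ((continuous_radWeight s).mul ((continuous_hol n).norm.pow 2)).aestronglyMeasurable
    (ae_of_all _ fun z => ?_)
  rw [Real.norm_of_nonneg (mul_nonneg (radWeight_pos s z).le (sq_nonneg _))]
  exact radWeight_mul_le n hs0 hs z

lemma integral_radWeight_mul_le (n : ℕ) {s : ℝ} (hs0 : 0 ≤ s) (hs : s ≤ 2) :
    ∫ z, radWeight s z * ‖hol n z‖ ^ 2 ≤ 6 * ((n : ℝ) + 1) ^ s := by
  have i0 := integrable_norm_hol_sq n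
  have i1 := (integrable_norm_hol_sq (n + 1)).const_mul (2 * ((n : ℝ) + 1))
  have i2 := (integrable_norm_hol_sq (n + 2)).const_mul (((n : ℝ) + 1) * (n + 2))
  have h := integral_mono (integrable_radWeight_mul n hs0 hs)
    ((i0.add (((i0.add i1).add i2).div_const (((n : ℝ) + 1) ^ 2))).const_mul
      (((n : ℝ) + 1) ^ s)) (radWeight_mul_le n hs0 hs)
  refine h.trans ?_
  simp only [Pi.add_apply]
  have i3 := ((i0.add i1).add i2).div_const (((n : ℝ) + 1) ^ 2)
  have i4 := i0.fun_add i1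
  simp only [Pi.add_apply] at i3 i4
  rw [integral_const_mul, integral_add i0 i3, integral_div, integral_add i4 i2,
    integral_add i0 i1, integral_const_mul, integral_const_mul, integral_norm_hol_sq,
    integral_norm_hol_sq, integral_norm_hol_sq, mul_comm]
  refine mul_le_mul_of_nonneg_right ?_ (by positivity)
  -- The bracket is 1 + (1 + 2(n+1) + (n+1)(n+2))/(n+1)², which equals 6 at n = 0 and is smaller
  -- afterwards.
  rw [← le_sub_iff_add_le', div_le_iff₀ (by positivity)]
  nlinarith [(n.cast_nonneg : (0 : ℝ) ≤ n)]

/-- The raising relation read backwards: (m+1)(m+2)|φ_{m+2}|² = |z|⁴|φ_m|², and the weight absorbs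
|z|⁴. For n = 0 and n = 1 it suffices that the weight is at most 1. -/
lemma integral_neg_two_radWeight_mul_le (n : ℕ) :
    ∫ z, radWeight (-2) z * ‖hol n z‖ ^ 2 ≤ 5 / ((n : ℝ) + 1) ^ 2 := by
  have hle : ∀ z, radWeight (-2) z ≤ 1 := fun z =>
    Real.rpow_le_one_of_one_le_of_nonpos (by nlinarith [sq_nonneg ‖z‖]) (by norm_num)
  rcases n with _ | _ | m
  iterate 2
    refine (integral_mono_of_nonneg (ae_of_all _ fun z => mul_nonneg (radWeight_pos _ z).le
      (sq_nonneg _)) (integrable_norm_hol_sq _) (ae_of_all _ fun z =>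
        mul_le_of_le_one_left (sq_nonneg _) (hle z))).trans ?_
    rw [integral_norm_hol_sq]
    norm_num
  · have hb : ∀ z, radWeight (-2) z * ‖hol (m + 1 + 1) z‖ ^ 2
        ≤ (((m : ℝ) + 1) * (m + 2))⁻¹ * ‖hol m z‖ ^ 2 := fun z => by
      have h1 := norm_sq_mul_norm_hol_sq m z
      have h2 := norm_sq_mul_norm_hol_sq (m + 1) z
      push_cast at h2
      rw [radWeight, Real.rpow_neg (by positivity), Real.rpow_two, ← div_eq_inv_mul,
        ← div_eq_inv_mul, div_le_div_iff₀ (by positivity) (by positivity)]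
      have h3 : ‖hol (m + 1 + 1) z‖ ^ 2 * (((m : ℝ) + 1) * (m + 2))
          = ‖hol m z‖ ^ 2 * (‖z‖ ^ 2) ^ 2 := by
        linear_combination (-((m : ℝ) + 1)) * h2 - ‖z‖ ^ 2 * h1
      rw [h3]
      gcongr
      linarith
    refine (integral_mono_of_nonneg (ae_of_all _ fun z => mul_nonneg (radWeight_pos _ z).le
      (sq_nonneg _)) ((integrable_norm_hol_sq m).const_mul _) (ae_of_all _ hb)).trans ?_
    rw [integral_const_mul, integral_norm_hol_sq, mul_one, inv_eq_one_div,
      div_le_div_iff₀ (by positivity) (by positivity)]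
    push_cast
    nlinarith [(m.cast_nonneg : (0 : ℝ) ≤ m)]

/-- The same interpolation, now with the inverse ratio (n + 1)/(1 + |z|²). The constant is 1 + 5,
the 5 coming from the case s = 2. -/
lemma integral_radWeight_neg_mul_le (n : ℕ) {s : ℝ} (hs0 : 0 ≤ s) (hs : s ≤ 2) :
    ∫ z, radWeight (-s) z * ‖hol n z‖ ^ 2 ≤ 6 * ((n : ℝ) + 1) ^ (-s) := by
  have hn : (0 : ℝ) < n + 1 := by positivity
  have hi : Integrable fun z => radWeight (-2) z * ‖hol n z‖ ^ 2 := by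
    refine (integrable_norm_hol_sq n).mono'
      ((continuous_radWeight _).mul ((continuous_hol n).norm.pow 2)).aestronglyMeasurable
      (ae_of_all _ fun z => ?_)
    rw [Real.norm_of_nonneg (mul_nonneg (radWeight_pos _ z).le (sq_nonneg _))]
    exact mul_le_of_le_one_left (sq_nonneg _) (Real.rpow_le_one_of_one_le_of_nonpos
      (by nlinarith [sq_nonneg ‖z‖]) (by norm_num))
  have hb : ∀ z, radWeight (-s) z * ‖hol n z‖ ^ 2 ≤ ((n : ℝ) + 1) ^ (-s) * (‖hol n z‖ ^ 2
      + ((n : ℝ) + 1) ^ 2 * (radWeight (-2) z * ‖hol n z‖ ^ 2)) := fun z => by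
    have h := rpow_le_one_add_sq (x := (n + 1) / (1 + ‖z‖ ^ 2)) (by positivity) hs0 hs
    rw [Real.div_rpow hn.le (by positivity), div_le_iff₀ (by positivity)] at h
    have h0 : 0 < radWeight s z := radWeight_pos s z
    have h2 : radWeight (-s) z ≤ ((n : ℝ) + 1) ^ (-s)
        * (1 + ((n : ℝ) + 1) ^ 2 * radWeight (-2) z) := by
      simp only [radWeight] at h0 ⊢
      rw [Real.rpow_neg (by positivity), Real.rpow_neg (by positivity),
        Real.rpow_neg (by positivity), Real.rpow_two, ← div_eq_inv_mul,
        le_div_iff₀ (by positivity), ← div_eq_inv_mul, div_le_iff₀ h0]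
      rw [div_pow] at h
      exact h
    calc _ ≤ ((n : ℝ) + 1) ^ (-s) * (1 + ((n : ℝ) + 1) ^ 2 * radWeight (-2) z)
          * ‖hol n z‖ ^ 2 := by gcongr
      _ = _ := by ring
  refine (integral_mono_of_nonneg (ae_of_all _ fun z => mul_nonneg (radWeight_pos _ z).le
    (sq_nonneg _)) (((integrable_norm_hol_sq n).add (hi.const_mul _)).const_mul _)
    (ae_of_all _ hb)).trans ?_
  simp only [Pi.add_apply]
  rw [integral_const_mul, integral_add (integrable_norm_hol_sq n) (hi.const_mul _),
    integral_const_mul, integral_norm_hol_sq, mul_comm]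
  refine mul_le_mul_of_nonneg_right ?_ (by positivity)
  have := mul_le_mul_of_nonneg_left (integral_neg_two_radWeight_mul_le n)
    (by positivity : (0 : ℝ) ≤ ((n : ℝ) + 1) ^ 2)
  rw [mul_div_cancel₀ _ (by positivity)] at this
  linarith

end CR

namespace CR

/-! ### Tempered distributions bounded for the harmonic Sobolev norms -/

lemma one_le_eigenvalue (k : ℕ) : (1 : ℝ) ≤ 2 * (k : ℝ) + 2 := by
  linarith [(k.cast_nonneg : (0 : ℝ) ≤ k)]

lemma compNorm_oscillator_pow (m k : ℕ) (ψ : 𝓢(Plane, ℂ)) :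
    compNorm k ((oscillator ^ m) ψ) = (2 * (k : ℝ) + 2) ^ m * compNorm k ψ := by
  induction m with
  | zero => simp
  | succ m ih =>
    rw [pow_succ', mul_apply_eq_comp, compNorm_oscillator, ih]
    ring

lemma sum_compNorm_sq_le (s : Finset ℕ) (ψ : 𝓢(Plane, ℂ)) :
    ∑ k ∈ s, compNorm k ψ ^ 2 ≤ ‖ψ.toLp 2 (volume : Measure Plane)‖ ^ 2 := by
  have hV : OrthogonalFamily ℂ (fun k => eigenspaceL2 k) fun k => (eigenspaceL2 k).subtypeₗᵢ :=
    fun j k hjk v w => inner_eq_zero hjk v.2 w.2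
  set v : Lp ℂ 2 (volume : Measure Plane) := ψ.toLp 2 with hv
  set w : Lp ℂ 2 (volume : Measure Plane) :=
    ∑ k ∈ s, (eigenspaceL2 k).starProjection v with hw
  have h1 : ‖w‖ ^ 2 = ∑ k ∈ s, compNorm k ψ ^ 2 :=
    hV.norm_sum (fun k => ⟨_, Submodule.starProjection_apply_mem (eigenspaceL2 k) v⟩) s
  have h2 : RCLike.re (inner ℂ w v) = ∑ k ∈ s, compNorm k ψ ^ 2 := by
    rw [hw, sum_inner, map_sum]
    exact Finset.sum_congr rfl fun k _ => Submodule.re_inner_starProjection_eq_normSq _ v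
  have h3 : RCLike.re (inner ℂ w v) ≤ ‖w‖ * ‖v‖ := re_inner_le_norm w v
  rw [h2, ← h1] at h3
  rw [← h1]
  nlinarith [norm_nonneg w, norm_nonneg v, sq_nonneg (‖w‖ - ‖v‖)]

lemma sobNorm_mono {σ τ : ℝ} (h : σ ≤ τ) (ψ : 𝓢(Plane, ℂ)) : sobNorm σ ψ ≤ sobNorm τ ψ := by
  refine Real.sqrt_le_sqrt ((summable_sobNorm σ ψ).tsum_le_tsum (fun k => ?_)
    (summable_sobNorm τ ψ))
  exact mul_le_mul_of_nonneg_right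
    (Real.rpow_le_rpow_of_exponent_le (one_le_eigenvalue k) h) (sq_nonneg _)

/-- For m ≥ σ the weight (2k+2)^σ is at most (2k+2)^(2m), so this is Bessel's inequality for H^m ψ.
It makes the Sobolev norms continuous on the Schwartz space. -/
lemma exists_sobNorm_le (σ : ℝ) : ∃ m : ℕ, ∀ ψ : 𝓢(Plane, ℂ),
    sobNorm σ ψ ≤ ‖((oscillator ^ m) ψ).toLp 2 (volume : Measure Plane)‖ := by
  obtain ⟨m, hm⟩ := exists_nat_ge σ
  refine ⟨m, fun ψ => Real.sqrt_le_iff.2 ⟨norm_nonneg _, ?_⟩⟩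
  refine (summable_sobNorm σ ψ).tsum_le_of_sum_le fun s => ?_
  refine le_trans (Finset.sum_le_sum fun k _ => ?_) (sum_compNorm_sq_le s _)
  rw [compNorm_oscillator_pow, mul_pow]
  refine mul_le_mul_of_nonneg_right ?_ (sq_nonneg _)
  rw [← pow_mul, ← Real.rpow_natCast]
  refine Real.rpow_le_rpow_of_exponent_le (one_le_eigenvalue k) (hm.trans ?_)
  push_cast
  linarith [(m.cast_nonneg : (0 : ℝ) ≤ m)]

/-- A linear functional bounded for a harmonic Sobolev norm is a tempered distribution. -/
lemma exists_dist_of_bound (ℓ : 𝓢(Plane, ℂ) →ₗ[ℂ] ℂ) {σ C : ℝ} (hC : 0 ≤ C)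
    (h : ∀ ψ, ‖ℓ ψ‖ ≤ C * sobNorm σ ψ) : ∃ u : 𝓢'(Plane, ℂ), ∀ ψ, u ψ = ℓ ψ := by
  obtain ⟨m, hm⟩ := exists_sobNorm_le σ
  have hcont : Continuous ℓ := by
    refine continuous_of_continuousAt_zero ℓ ?_
    have h1 : Continuous fun ψ : 𝓢(Plane, ℂ) =>
        C * ‖SchwartzMap.toLpCLM ℂ ℂ 2 (volume : Measure Plane) ((oscillator ^ m) ψ)‖ := by
      fun_prop
    have h2 := h1.tendsto 0
    simp only [map_zero, norm_zero, mul_zero] at h2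
    rw [ContinuousAt, map_zero]
    exact squeeze_zero_norm (fun ψ => (h ψ).trans (mul_le_mul_of_nonneg_left (hm ψ) hC)) h2
  exact ⟨ContinuousLinearMap.toPointwiseConvergenceCLM _ _ _ _
    (⟨ℓ, hcont⟩ : 𝓢(Plane, ℂ) →L[ℂ] ℂ), fun ψ => rfl⟩

lemma negSobolev_mono {σ τ : ℝ} (h : σ ≤ τ) : negSobolev σ ≤ negSobolev τ := by
  rintro u ⟨C, hC, hu⟩
  exact ⟨C, hC, fun ψ => (hu ψ).trans (mul_le_mul_of_nonneg_left (sobNorm_mono h ψ) hC)⟩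

lemma HNeg.norm_le_of_forall {σ : ℝ} (u : HNeg σ) {C : ℝ} (hC : 0 ≤ C)
    (h : ∀ ψ, ‖u.toDist ψ‖ ≤ C * sobNorm σ ψ) : ‖u‖ ≤ C := u.norm_le hC h

lemma HNeg.norm_toDist_le {σ : ℝ} (u : HNeg σ) (ψ : 𝓢(Plane, ℂ)) :
    ‖u.toDist ψ‖ ≤ ‖u‖ * sobNorm σ ψ := u.le_norm ψ

lemma HNeg.toDist_sub {σ : ℝ} (u v : HNeg σ) (ψ : 𝓢(Plane, ℂ)) :
    (u - v).toDist ψ = u.toDist ψ - v.toDist ψ := rfl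

lemma HNeg.ext {σ : ℝ} {u v : HNeg σ} (h : ∀ ψ, u.toDist ψ = v.toDist ψ) : u = v :=
  Subtype.ext (DFunLike.ext _ _ h)

lemma HNeg.continuous_toDist {σ : ℝ} (ψ : 𝓢(Plane, ℂ)) :
    Continuous fun u : HNeg σ => u.toDist ψ := by
  refine continuous_iff_continuousAt.2 fun u => tendsto_iff_norm_sub_tendsto_zero.2 ?_
  have h : Tendsto (fun v : HNeg σ => ‖v - u‖ * sobNorm σ ψ) (𝓝 u) (𝓝 (0 * sobNorm σ ψ)) :=
    (tendsto_iff_norm_sub_tendsto_zero.1 tendsto_id).mul_const _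
  rw [zero_mul] at h
  exact squeeze_zero (fun v => _root_.norm_nonneg _) (fun v => (v - u).norm_toDist_le ψ) h

/-- A Cauchy sequence converges when paired with each ψ, at a rate uniform relative to `sobNorm σ
ψ`. The limit functional is therefore bounded for this norm, hence tempered, and the uniform rate is
convergence in norm. -/
instance HNeg.instCompleteSpace (σ : ℝ) : CompleteSpace (HNeg σ) := by
  refine Metric.complete_of_cauchySeq_tendsto fun u hu => ?_
  have hdist : ∀ m n ψ, ‖(u m).toDist ψ - (u n).toDist ψ‖ ≤ dist (u m) (u n) * sobNorm σ ψ :=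
    fun m n ψ => by
      rw [dist_eq_norm]
      exact (u m - u n).norm_toDist_le ψ
  have hlim : ∀ ψ, ∃ l, Tendsto (fun n => (u n).toDist ψ) atTop (𝓝 l) := fun ψ => by
    refine cauchySeq_tendsto_of_complete (Metric.cauchySeq_iff'.2 fun ε hε => ?_)
    obtain ⟨N, hN⟩ := Metric.cauchySeq_iff'.1 hu (ε / (sobNorm σ ψ + 1))
      (div_pos hε (by linarith [sobNorm_nonneg σ ψ]))
    refine ⟨N, fun n hn => ?_⟩
    rw [dist_eq_norm]
    refine (hdist n N ψ).trans_lt ?_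
    have h0 := sobNorm_nonneg σ ψ
    have h1 := hN n hn
    rw [lt_div_iff₀ (by linarith)] at h1
    nlinarith [dist_nonneg (x := u n) (y := u N)]
  choose l hl using hlim
  have hbd : ∀ ε > 0, ∃ N, ∀ n ≥ N, ∀ ψ, ‖(u n).toDist ψ - l ψ‖ ≤ ε * sobNorm σ ψ := by
    intro ε hε
    obtain ⟨N, hN⟩ := Metric.cauchySeq_iff.1 hu ε hε
    refine ⟨N, fun n hn ψ => ?_⟩
    refine le_of_tendsto ((tendsto_const_nhds.sub (hl ψ)).norm)
      (eventually_atTop.2 ⟨N, fun m hm => (hdist n m ψ).trans ?_⟩)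
    exact mul_le_mul_of_nonneg_right (hN n hn m hm).le (sobNorm_nonneg σ ψ)
  let ℓ : 𝓢(Plane, ℂ) →ₗ[ℂ] ℂ :=
    { toFun := l
      map_add' := fun ψ χ => by
        refine tendsto_nhds_unique (hl (ψ + χ)) ?_
        simp only [map_add]
        exact (hl ψ).add (hl χ)
      map_smul' := fun c ψ => by
        refine tendsto_nhds_unique (hl (c • ψ)) ?_
        simp only [map_smul]
        exact (hl ψ).const_smul c }
  obtain ⟨N, hN⟩ := hbd 1 one_pos
  have hℓ : ∀ ψ, ‖ℓ ψ‖ ≤ (‖u N‖ + 1) * sobNorm σ ψ := fun ψ => by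
    have h1 := hN N le_rfl ψ
    have h2 := (u N).norm_toDist_le ψ
    have h3 : ‖ℓ ψ‖ ≤ ‖(u N).toDist ψ‖ + ‖(u N).toDist ψ - l ψ‖ := norm_le_norm_add_norm_sub _ _
    linarith
  obtain ⟨v, hv⟩ := exists_dist_of_bound ℓ (by positivity) hℓ
  let w : HNeg σ := ⟨v, ‖u N‖ + 1, by positivity, fun ψ => by rw [hv]; exact hℓ ψ⟩
  refine ⟨w, Metric.tendsto_atTop.2 fun ε hε => ?_⟩
  obtain ⟨N, hN⟩ := hbd (ε / 2) (half_pos hε)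
  refine ⟨N, fun n hn => ?_⟩
  rw [dist_eq_norm]
  refine lt_of_le_of_lt ((u n - w).norm_le_of_forall (half_pos hε).le fun ψ => ?_) (half_lt_self hε)
  rw [HNeg.toDist_sub]
  have : w.toDist ψ = l ψ := hv ψ
  rw [this]
  exact hN n hn ψ

/-- The inclusion `ℋ^{-σ} ⊆ ℋ^{-τ}` for `σ ≤ τ`. -/
def HNeg.incl {σ τ : ℝ} (h : σ ≤ τ) (u : HNeg σ) : HNeg τ := ⟨u.1, negSobolev_mono h u.2⟩

lemma HNeg.norm_incl_le {σ τ : ℝ} (h : σ ≤ τ) (u : HNeg σ) : ‖u.incl h‖ ≤ ‖u‖ :=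
  HNeg.norm_le_of_forall _ (norm_nonneg _) fun ψ =>
    (u.norm_toDist_le ψ).trans (mul_le_mul_of_nonneg_left (sobNorm_mono h ψ) (norm_nonneg _))

lemma HNeg.continuous_incl {σ τ : ℝ} (h : σ ≤ τ) : Continuous (HNeg.incl h) := by
  refine continuous_iff_continuousAt.2 fun u => tendsto_iff_norm_sub_tendsto_zero.2 ?_
  exact squeeze_zero (fun v => norm_nonneg _) (fun v => HNeg.norm_incl_le h (v - u))
    (tendsto_iff_norm_sub_tendsto_zero.1 tendsto_id)

/-! ### The space `X^{-1}` -/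

/-- A sequence of orders decreasing to `1`. -/
noncomputable def order (n : ℕ) : ℝ := 1 + 1 / ((n : ℝ) + 1)

lemma one_lt_order (n : ℕ) : 1 < order n := by
  unfold order
  have : 0 < 1 / ((n : ℝ) + 1) := by positivity
  linarith

lemma exists_order_le {σ : ℝ} (hσ : 1 < σ) : ∃ n, order n ≤ σ := by
  obtain ⟨n, hn⟩ := exists_nat_one_div_lt (sub_pos.2 hσ)
  exact ⟨n, by unfold order; linarith⟩

lemma XNegOne.ext {u v : XNegOne} (h : ∀ ψ, u.toDist ψ = v.toDist ψ) : u = v :=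
  Subtype.ext (DFunLike.ext _ _ h)

lemma XNegOne.toHNeg_sub {σ : ℝ} (hσ : 1 < σ) (u v : XNegOne) :
    (u - v).toHNeg hσ = u.toHNeg hσ - v.toHNeg hσ := rfl

lemma XNegOne.continuous_toHNeg {σ : ℝ} (hσ : 1 < σ) :
    Continuous (XNegOne.toHNeg hσ) :=
  continuous_iInf_dom (i := ⟨σ, hσ⟩) continuous_induced_dom

lemma XNegOne.continuous_toDist (ψ : 𝓢(Plane, ℂ)) :
    Continuous fun u : XNegOne => u.toDist ψ :=
  (HNeg.continuous_toDist ψ).comp (XNegOne.continuous_toHNeg (one_lt_order 0))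

/-- The norms decrease as the order grows, so orders tending to 1 already define the topology. Being
a countable family, they make the space pseudometrizable, as is needed for the measurability of
almost everywhere limits. -/
lemma XNegOne.isInducing : IsInducing
    fun (u : XNegOne) (n : ℕ) => u.toHNeg (one_lt_order n) := by
  refine ⟨le_antisymm ?_ ?_⟩
  · exact continuous_iff_le_induced.1
      (continuous_pi fun n => XNegOne.continuous_toHNeg (one_lt_order n))
  · refine le_iInf fun σ => ?_
    obtain ⟨n, hn⟩ := exists_order_le σ.2
    have e : XNegOne.toHNeg σ.2 = (fun v : ∀ n, HNeg (order n) => (v n).incl hn) ∘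
        fun (u : XNegOne) (n : ℕ) => u.toHNeg (one_lt_order n) := rfl
    rw [e, ← induced_compose]
    exact induced_mono ((HNeg.continuous_incl hn).comp (continuous_apply n)).le_induced

instance : TopologicalSpace.PseudoMetrizableSpace XNegOne :=
  XNegOne.isInducing.pseudoMetrizableSpace

lemma XNegOne.tendsto_iff {ι : Type*} {l : Filter ι} {f : ι → XNegOne} {u : XNegOne} :
    Tendsto f l (𝓝 u) ↔
      ∀ n, Tendsto (fun i => (f i).toHNeg (one_lt_order n)) l (𝓝 (u.toHNeg (one_lt_order n))) := by
  rw [XNegOne.isInducing.tendsto_nhds_iff, tendsto_pi_nhds]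
  rfl

/-- Convergence in every `ℋ^{-σ}` implies convergence in `X^{-1}`. -/
lemma XNegOne.exists_tendsto {f : ℕ → XNegOne}
    (h : ∀ n, ∃ l, Tendsto (fun i => (f i).toHNeg (one_lt_order n)) atTop (𝓝 l)) :
    ∃ u, Tendsto f atTop (𝓝 u) := by
  choose l hl using h
  -- The limits found in the different spaces are one and the same distribution, since pairings with
  -- test functions are continuous in each of them.
  have e : ∀ n ψ, (l n).toDist ψ = (l 0).toDist ψ := fun n ψ =>
    tendsto_nhds_unique (((HNeg.continuous_toDist ψ).tendsto _).comp (hl n))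
      (((HNeg.continuous_toDist ψ).tendsto _).comp (hl 0))
  have hmem : (l 0).toDist ∈ negSobolevInter := by
    refine (Submodule.mem_iInf _).2 fun σ => ?_
    obtain ⟨n, hn⟩ := exists_order_le σ.2
    have : (l 0).toDist = (l n).toDist := DFunLike.ext _ _ fun ψ => (e n ψ).symm
    rw [this]
    exact negSobolev_mono hn (l n).2
  refine ⟨⟨(l 0).toDist, hmem⟩, XNegOne.tendsto_iff.2 fun n => ?_⟩
  have : XNegOne.toHNeg (one_lt_order n) ⟨(l 0).toDist, hmem⟩ = l n :=
    HNeg.ext fun ψ => (e n ψ).symm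
  rw [this]
  exact hl n

/-! ### Finite combinations of holomorphic Hermite functions -/

/-- The pairing of a test function with `φₙ`. -/
noncomputable def holPair (n : ℕ) (ψ : 𝓢(Plane, ℂ)) : ℂ := ∫ x, ψ x * holHermite n x

/-- The pairing is the scalar product of ψ with the conjugate of φₙ, a unit vector of the
eigenspace, so only the component of ψ in that eigenspace counts. -/
lemma norm_holPair_le (n : ℕ) (ψ : 𝓢(Plane, ℂ)) : ‖holPair n ψ‖ ≤ compNorm n ψ := by
  have h1 : holPair n ψ = inner ℂ
      ((conjSchwartz (holHermite n)).toLp 2 : Lp ℂ 2 (volume : Measure Plane))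
      ((eigenspaceL2 n).starProjection (ψ.toLp 2)) := by
    rw [← Submodule.inner_starProjection_left_eq_right,
      Submodule.starProjection_eq_self_iff.2 (toLp_mem (conjSchwartz_mem (holHermite_mem n))),
      inner_toLp]
    simp only [holPair, conjSchwartz_apply, Complex.conj_conj, mul_comm]
  rw [h1]
  refine (norm_inner_le_norm _ _).trans ?_
  rw [norm_toLp_conj_holHermite, one_mul, compNorm]

/-- Cauchy–Schwarz between the weighted `ℓ²` norm of coefficients and the Sobolev norm. -/
lemma sum_norm_mul_holPair_le (σ : ℝ) (D : Finset ℕ) (a : ℕ → ℂ) (ψ : 𝓢(Plane, ℂ)) :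
    ∑ n ∈ D, ‖a n * holPair n ψ‖
      ≤ √(∑ n ∈ D, (2 * (n : ℝ) + 2) ^ (-σ) * ‖a n‖ ^ 2) * sobNorm σ ψ := by
  have h := Real.sum_mul_le_sqrt_mul_sqrt D
    (fun n => √((2 * (n : ℝ) + 2) ^ (-σ)) * ‖a n‖)
    (fun n => √((2 * (n : ℝ) + 2) ^ σ) * ‖holPair n ψ‖)
  have e1 : ∀ n : ℕ, √((2 * (n : ℝ) + 2) ^ (-σ)) * ‖a n‖
      * (√((2 * (n : ℝ) + 2) ^ σ) * ‖holPair n ψ‖) = ‖a n * holPair n ψ‖ := fun n => by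
    have : √((2 * (n : ℝ) + 2) ^ (-σ)) * √((2 * (n : ℝ) + 2) ^ σ) = 1 := by
      rw [← Real.sqrt_mul (by positivity), ← Real.rpow_add (by positivity), neg_add_cancel,
        Real.rpow_zero, Real.sqrt_one]
    rw [norm_mul]
    linear_combination ‖a n‖ * ‖holPair n ψ‖ * this
  simp only [e1, mul_pow] at h
  have e2 : ∀ (τ : ℝ) (n : ℕ), √((2 * (n : ℝ) + 2) ^ τ) ^ 2 = (2 * (n : ℝ) + 2) ^ τ :=
    fun τ n => Real.sq_sqrt (by positivity)
  simp only [e2] at h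
  refine h.trans (mul_le_mul_of_nonneg_left (Real.sqrt_le_sqrt ?_) (Real.sqrt_nonneg _))
  refine le_trans (Finset.sum_le_sum fun n _ => ?_)
    ((summable_sobNorm σ ψ).sum_le_tsum D fun n _ => by positivity)
  have := norm_holPair_le n ψ
  gcongr

/-- The combination `∑_{n ∈ D} aₙ φₙ`. -/
noncomputable def holSum (D : Finset ℕ) (a : ℕ → ℂ) : 𝓢(Plane, ℂ) := ∑ n ∈ D, a n • holHermite n

lemma toTempered_holSum (D : Finset ℕ) (a : ℕ → ℂ) (ψ : 𝓢(Plane, ℂ)) :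
    SchwartzMap.toTemperedDistributionCLM Plane ℂ volume (holSum D a) ψ
      = ∑ n ∈ D, a n * holPair n ψ := by
  rw [SchwartzMap.toTemperedDistributionCLM_apply_apply volume]
  have e : ∀ x, ψ x • holSum D a x = ∑ n ∈ D, a n * (ψ x * holHermite n x) := fun x => by
    rw [holSum, sum_apply, Finset.smul_sum]
    refine Finset.sum_congr rfl fun n _ => ?_
    rw [smul_apply, smul_eq_mul, smul_eq_mul]
    ring
  simp only [e]
  rw [integral_finsetSum]
  · simp only [integral_const_mul, holPair]
  · exact fun n _ => ((SchwartzMap.pairing (ContinuousLinearMap.mul ℂ ℂ) ψ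
      (holHermite n)).integrable (μ := volume)).const_mul _

lemma toTempered_holSum_mem (D : Finset ℕ) (a : ℕ → ℂ) :
    SchwartzMap.toTemperedDistributionCLM Plane ℂ volume (holSum D a) ∈ negSobolevInter :=
  (Submodule.mem_iInf _).2 fun σ => ⟨_, Real.sqrt_nonneg _, fun ψ => by
    rw [toTempered_holSum]
    exact (norm_sum_le _ _).trans (sum_norm_mul_holPair_le σ D a ψ)⟩

/-- The combination `∑_{n ∈ D} aₙ φₙ` as an element of `X^{-1}`. -/
noncomputable def holX (D : Finset ℕ) (a : ℕ → ℂ) : XNegOne :=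
  ⟨SchwartzMap.toTemperedDistributionCLM Plane ℂ volume (holSum D a), toTempered_holSum_mem D a⟩

lemma holX_toDist (D : Finset ℕ) (a : ℕ → ℂ) (ψ : 𝓢(Plane, ℂ)) :
    (holX D a).toDist ψ = ∑ n ∈ D, a n * holPair n ψ := toTempered_holSum D a ψ

lemma holX_sub (D : Finset ℕ) (a b : ℕ → ℂ) : holX D a - holX D b = holX D (a - b) :=
  XNegOne.ext fun ψ => by
    change (holX D a).toDist ψ - (holX D b).toDist ψ = _
    simp only [holX_toDist, ← Finset.sum_sub_distrib, Pi.sub_apply, sub_mul]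

lemma norm_holX_le {σ : ℝ} (hσ : 1 < σ) (D : Finset ℕ) (a : ℕ → ℂ) :
    ‖(holX D a).toHNeg hσ‖ ≤ √(∑ n ∈ D, (2 * (n : ℝ) + 2) ^ (-σ) * ‖a n‖ ^ 2) :=
  HNeg.norm_le_of_forall _ (Real.sqrt_nonneg _) fun ψ => by
    change ‖(holX D a).toDist ψ‖ ≤ _
    rw [holX_toDist]
    exact (norm_sum_le _ _).trans (sum_norm_mul_holPair_le σ D a ψ)

lemma continuous_holX (D : Finset ℕ) : Continuous (holX D) := by
  refine continuous_iff_continuousAt.2 fun a => XNegOne.tendsto_iff.2 fun j => ?_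
  refine tendsto_iff_norm_sub_tendsto_zero.2 ?_
  simp only [← XNegOne.toHNeg_sub, holX_sub]
  refine squeeze_zero (fun b => norm_nonneg _) (fun b => norm_holX_le _ D (b - a)) ?_
  have h : Continuous fun b : ℕ → ℂ =>
      √(∑ n ∈ D, (2 * (n : ℝ) + 2) ^ (-order j) * ‖(b - a) n‖ ^ 2) := by
    simp only [Pi.sub_apply]
    fun_prop
  have h0 := h.tendsto a
  simpa using h0

end CR

namespace CR

/-! ### Identification of the spectral projections -/

lemma holPair_eq_zero {k n : ℕ} (hkn : n ≠ k) {χ : 𝓢(Plane, ℂ)} (hχ : χ ∈ eigenspace k) :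
    holPair n χ = 0 := by
  have h := inner_eq_zero hkn (toLp_mem (conjSchwartz_mem (holHermite_mem n))) (toLp_mem hχ)
  rw [inner_toLp] at h
  simpa only [holPair, conjSchwartz_apply, Complex.conj_conj, mul_comm] using h

lemma holPair_conj (m n : ℕ) :
    holPair n (conjSchwartz (holHermite m)) = if m = n then 1 else 0 :=
  integral_conj_holHermite_mul_holHermite m n

lemma integrable_schwartz_mul (f g : 𝓢(Plane, ℂ)) : Integrable fun x => f x * g x :=
  (SchwartzMap.pairing (ContinuousLinearMap.mul ℂ ℂ) f g).integrable

/-- Two candidates differ by an element of E_k, whose conjugate is again in E_k and may be used as a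
test function; the difference then has norm zero. Since a candidate is exhibited, finite
dimensionality of E_k plays no role. -/
lemma eigenComponent_eq {k : ℕ} {ℓ : 𝓢(Plane, ℂ) → ℂ} {φ : 𝓢(Plane, ℂ)} (hφ : φ ∈ eigenspace k)
    (h : ∀ χ ∈ eigenspace k, ∫ x, χ x * φ x = ℓ χ) : eigenComponent k ℓ = φ := by
  have hex : ∃ φ ∈ eigenspace k, ∀ χ ∈ eigenspace k, ∫ x, χ x * φ x = ℓ χ := ⟨φ, hφ, h⟩
  have h1 := hex.choose_spec
  rw [eigenComponent, dif_pos hex]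
  set ξ := hex.choose
  have h2 : ξ - φ ∈ eigenspace k := sub_mem h1.1 hφ
  have h3 : ∫ x, starRingEnd ℂ ((ξ - φ) x) * (ξ - φ) x = 0 := by
    have e : ∀ x, starRingEnd ℂ ((ξ - φ) x) * (ξ - φ) x
        = conjSchwartz (ξ - φ) x * ξ x - conjSchwartz (ξ - φ) x * φ x := fun x => by
      rw [conjSchwartz_apply, sub_apply, mul_sub]
    simp only [e]
    rw [integral_sub (integrable_schwartz_mul _ _) (integrable_schwartz_mul _ _),
      h1.2 _ (conjSchwartz_mem h2), h _ (conjSchwartz_mem h2), sub_self]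
  rw [← inner_toLp, inner_self_eq_zero] at h3
  have h4 : (ξ - φ).toLp 2 (volume : Measure Plane) = (0 : 𝓢(Plane, ℂ)).toLp 2 volume :=
    h3.trans (map_zero (SchwartzMap.toLpCLM ℂ ℂ 2 (volume : Measure Plane))).symm
  exact sub_eq_zero.1 (SchwartzMap.injective_toLp 2 volume h4)

lemma integral_mul_smul_holHermite (χ : 𝓢(Plane, ℂ)) (n : ℕ) (c : ℂ) :
    ∫ x, χ x * (c • holHermite n) x = c * holPair n χ := by
  rw [holPair, ← integral_const_mul]
  refine integral_congr_ae (ae_of_all _ fun x => ?_)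
  simp only [smul_apply, smul_eq_mul]
  ring

lemma spectralProj_eq {N : ℕ} {ℓ : 𝓢(Plane, ℂ) → ℂ} {a : ℕ → ℂ}
    (h : ∀ k ∈ Finset.range (N + 1), ∀ χ ∈ eigenspace k, ℓ χ = a k * holPair k χ) :
    spectralProj N ℓ = holSum (Finset.range (N + 1)) a := by
  refine Finset.sum_congr rfl fun k hk => eigenComponent_eq
    (Submodule.smul_mem _ _ (holHermite_mem k)) fun χ hχ => ?_
  rw [integral_mul_smul_holHermite, h k hk χ hχ]

/-- The coefficient of `u` along `φₙ`. -/
noncomputable def coeff (u : XNegOne) (n : ℕ) : ℂ := u.toDist (conjSchwartz (holHermite n))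

/-- The distributions all of whose spectral components are multiples of the `φₖ`. -/
def holSet : Set XNegOne :=
  {u | ∀ k, ∀ χ ∈ eigenspace k, u.toDist χ = coeff u k * holPair k χ}

lemma continuous_coeff (n : ℕ) : Continuous fun u => coeff u n := XNegOne.continuous_toDist _

/-- Closedness yields Borel measurability, through which an almost sure property of the series
becomes one of its law. -/
lemma isClosed_holSet : IsClosed holSet := by
  simp only [holSet, Set.ofPred_forall]
  exact isClosed_iInter fun k => isClosed_iInter fun χ => isClosed_iInter fun _ =>
    isClosed_eq (XNegOne.continuous_toDist χ) ((continuous_coeff k).mul continuous_const)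

lemma truncFun_of_mem {u : XNegOne} (hu : u ∈ holSet) (N : ℕ) :
    truncFun N u = spectralProj N fun ψ => ∫ z, ψ z * trilinear
      (holSum (Finset.range (N + 1)) (coeff u)) (holSum (Finset.range (N + 1)) (coeff u))
      (holSum (Finset.range (N + 1)) (coeff u)) z := by
  rw [truncFun, spectralProj_eq fun k _ => hu k]

end CR

namespace CR

/-! ### Mean values over the Cayley transform of the line -/

/-- The Cayley transform `(1 - iλ)/(1 + iλ)`, of modulus one. -/
noncomputable def cayley (l : ℝ) : ℂ := (1 - l * Complex.I) / (1 + l * Complex.I)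

lemma one_add_mul_I_ne_zero (l : ℝ) : (1 : ℂ) + l * Complex.I ≠ 0 := fun h => by
  simpa using congrArg Complex.re h

lemma one_sub_mul_I_ne_zero (l : ℝ) : (1 : ℂ) - l * Complex.I ≠ 0 := fun h => by
  simpa using congrArg Complex.re h

lemma norm_cayley (l : ℝ) : ‖cayley l‖ = 1 := by
  have h : (1 : ℂ) - l * Complex.I = starRingEnd ℂ (1 + l * Complex.I) := by
    simp [sub_eq_add_neg]
  rw [cayley, h, norm_div, RCLike.norm_conj, div_self]
  exact norm_ne_zero_iff.2 (one_add_mul_I_ne_zero l)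

lemma continuous_cayley : Continuous cayley :=
  (by fun_prop : Continuous fun l : ℝ => 1 - (l : ℂ) * Complex.I).div
    (by fun_prop) one_add_mul_I_ne_zero

lemma tendsto_cayley {F : Filter ℝ} (h : Tendsto (fun l : ℝ => |l|) F atTop) :
    Tendsto cayley F (𝓝 (-1)) := by
  have h1 : Tendsto (fun l : ℝ => ‖(1 : ℂ) + l * Complex.I‖) F atTop :=
    tendsto_atTop_mono (fun l => by
      simpa using Complex.abs_im_le_norm ((1 : ℂ) + l * Complex.I)) h
  have h2 : Tendsto (fun l : ℝ => ((1 : ℂ) + l * Complex.I)⁻¹) F (𝓝 0) :=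
    tendsto_inv₀_cobounded.comp (tendsto_norm_atTop_iff_cobounded.1 h1)
  have h3 := (h2.const_mul 2).const_add (-1)
  rw [mul_zero, add_zero] at h3
  refine h3.congr fun l => ?_
  have := one_add_mul_I_ne_zero l
  rw [cayley]
  field_simp
  ring

lemma integrable_inv_mul_cayley_pow (k : ℕ) :
    Integrable fun l : ℝ => (((1 + l ^ 2)⁻¹ : ℝ) : ℂ) * cayley l ^ k := by
  refine integrable_inv_one_add_sq.mono' ?_ (ae_of_all _ fun l => ?_)
  · refine Continuous.aestronglyMeasurable ((Complex.continuous_ofReal.comp ?_).mul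
      (continuous_cayley.pow k))
    exact (by fun_prop : Continuous fun l : ℝ => 1 + l ^ 2).inv₀ fun l => by positivity
  · rw [norm_mul, norm_pow, norm_cayley, one_pow, mul_one, Complex.norm_real,
      Real.norm_of_nonneg (by positivity)]

/-- For k ≠ 0 the integrand is the derivative of `cayley l ^ k / (-2 * I * k)`, which has the same
limit at both ends of the line because the Cayley transform tends to -1 at both. -/
lemma integral_inv_mul_cayley_pow (k : ℕ) :
    ∫ l : ℝ, (((1 + l ^ 2)⁻¹ : ℝ) : ℂ) * cayley l ^ k = if k = 0 then (Real.pi : ℂ) else 0 := by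
  split_ifs with hk
  · subst hk
    have h := integral_complex_ofReal (μ := volume) (f := fun l : ℝ => (1 + l ^ 2)⁻¹)
    rw [integral_univ_inv_one_add_sq] at h
    simp only [pow_zero, mul_one]
    exact h
  · have hd : ∀ l : ℝ, HasDerivAt (fun l : ℝ => cayley l ^ k / (-2 * Complex.I * k))
        ((((1 + l ^ 2)⁻¹ : ℝ) : ℂ) * cayley l ^ k) l := fun l => by
      have h0 := one_add_mul_I_ne_zero l
      have h0' := one_sub_mul_I_ne_zero l
      have h1 : HasDerivAt (fun l : ℝ => (l : ℂ) * Complex.I) Complex.I l := by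
        simpa using (Complex.ofRealCLM.hasDerivAt (x := l)).mul_const Complex.I
      have h2 := (((h1.const_sub 1).div (h1.const_add 1) h0).fun_pow k).div_const
        (-2 * Complex.I * k)
      refine h2.congr_deriv ?_
      obtain ⟨j, rfl⟩ := Nat.exists_eq_succ_of_ne_zero hk
      have hj : ((j + 1 : ℕ) : ℂ) ≠ 0 := by exact_mod_cast hk
      have h3 : (1 + (l : ℂ) ^ 2) = (1 + l * Complex.I) * (1 - l * Complex.I) := by
        linear_combination (l : ℂ) ^ 2 * Complex.I_sq
      have hI := Complex.I_ne_zero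
      simp only [Nat.succ_eq_add_one, Nat.add_sub_cancel, Pi.div_apply, cayley]
      push_cast at hj ⊢
      rw [h3, pow_succ ((1 - (l : ℂ) * Complex.I) / (1 + l * Complex.I)) j]
      field_simp
      ring
    rw [integral_of_hasDerivAt_of_tendsto hd (integrable_inv_mul_cayley_pow k)
      (((tendsto_cayley tendsto_abs_atBot_atTop).pow k).div_const _)
      (((tendsto_cayley tendsto_abs_atTop_atTop).pow k).div_const _), sub_self]

/-- The mean value property for polynomials in the Cayley transform. -/
lemma integral_inv_mul_eval_cayley (Q : Polynomial ℂ) :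
    ∫ l : ℝ, (((1 + l ^ 2)⁻¹ : ℝ) : ℂ) * Q.eval (cayley l) = Real.pi * Q.eval 0 := by
  simp only [Polynomial.eval_eq_sum_range, Finset.mul_sum, mul_left_comm _ (Q.coeff _)]
  rw [integral_finsetSum _ fun k _ => (integrable_inv_mul_cayley_pow k).const_mul _]
  refine Finset.sum_congr rfl fun k _ => ?_
  rw [integral_const_mul, integral_inv_mul_cayley_pow]
  split_ifs with hk
  · subst hk; simp [mul_comm]
  · simp [hk]

/-! ### Gaussian integrals of polynomials -/

lemma integrable_add_norm_pow_mul_exp (c : ℝ) (n : ℕ) {b : ℝ} (hb : 0 < b) :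
    Integrable fun q : ℂ => (c + ‖q‖) ^ n * Real.exp (-b * ‖q‖ ^ 2) := by
  have h0 : Integrable fun q : ℂ => Real.exp (-b * ‖q‖ ^ 2) := by
    simpa using integrable_norm_pow_mul_exp 0 hb
  have h1 : ∀ j : ℕ, Integrable fun q : ℂ => ‖q‖ ^ j * Real.exp (-b * ‖q‖ ^ 2) := fun j => by
    refine (h0.add (integrable_norm_pow_mul_exp j hb)).mono'
      (Continuous.aestronglyMeasurable (by fun_prop)) (ae_of_all _ fun q => ?_)
    rw [Real.norm_of_nonneg (by positivity)]
    have h2 : ‖q‖ ^ j ≤ 1 + ‖q‖ ^ (2 * j) := by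
      rw [mul_comm 2 j, pow_mul]
      nlinarith [sq_nonneg (‖q‖ ^ j - 1), pow_nonneg (norm_nonneg q) j]
    calc _ ≤ (1 + ‖q‖ ^ (2 * j)) * Real.exp (-b * ‖q‖ ^ 2) := by gcongr
      _ = _ := by simp only [Pi.add_apply]; ring
  simp only [add_pow, Finset.sum_mul]
  refine integrable_finsetSum _ fun j _ => ?_
  refine ((h1 (n - j)).const_mul (c ^ j * (n.choose j))).congr (ae_of_all _ fun q => ?_)
  simp only
  ring

lemma exists_norm_eval_le (P : Polynomial ℂ) :
    ∃ K : ℝ, 0 ≤ K ∧ ∀ z : ℂ, ‖P.eval z‖ ≤ K * (1 + ‖z‖) ^ P.natDegree := by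
  refine ⟨∑ k ∈ Finset.range (P.natDegree + 1), ‖P.coeff k‖, by positivity, fun z => ?_⟩
  rw [Polynomial.eval_eq_sum_range, Finset.sum_mul]
  refine (norm_sum_le _ _).trans (Finset.sum_le_sum fun k hk => ?_)
  rw [norm_mul, norm_pow]
  have h0 := norm_nonneg z
  have h1 : ‖z‖ ^ k ≤ (1 + ‖z‖) ^ P.natDegree :=
    (pow_le_pow_left₀ h0 (by linarith) k).trans
      (pow_le_pow_right₀ (by linarith) (Nat.lt_succ_iff.1 (Finset.mem_range.1 hk)))
  gcongr

lemma integrable_pow_mul_conj_pow_mul_exp (m n : ℕ) {b : ℝ} (hb : 0 < b) :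
    Integrable fun q : ℂ => q ^ m * starRingEnd ℂ q ^ n
      * ((Real.exp (-b * ‖q‖ ^ 2) : ℝ) : ℂ) := by
  refine (integrable_add_norm_pow_mul_exp 0 (m + n) hb).mono'
    (Continuous.aestronglyMeasurable (by fun_prop)) (ae_of_all _ fun q => ?_)
  rw [norm_mul, norm_mul, norm_pow, norm_pow, RCLike.norm_conj, Complex.norm_real,
    Real.norm_of_nonneg (Real.exp_pos _).le, zero_add, pow_add]

lemma integral_pow_mul_conj_pow_mul_exp (m n : ℕ) {b : ℝ} (hb : 0 < b) :
    ∫ q : ℂ, q ^ m * starRingEnd ℂ q ^ n * ((Real.exp (-b * ‖q‖ ^ 2) : ℝ) : ℂ)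
      = if m = n then (Real.pi : ℂ) * n.factorial / (b : ℂ) ^ (n + 1) else 0 := by
  split_ifs with h
  · subst h
    have h1 := integral_complex_ofReal (μ := volume)
      (f := fun q : ℂ => ‖q‖ ^ (2 * m) * Real.exp (-b * ‖q‖ ^ 2))
    rw [integral_norm_pow_mul_exp m hb] at h1
    refine Eq.trans (integral_congr_ae (ae_of_all _ fun q => ?_)) (h1.trans ?_)
    · simp only
      rw [← mul_pow, Complex.mul_conj', Complex.ofReal_mul, pow_mul]
      push_cast
      rfl
    · push_cast; rfl
  -- The radial weight is chosen to trade the factor exp(-r²) contained in the product of two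
  -- Hermite functions for exp(-b r²).
  · have h1 := integral_radial_conj_hol_mul_hol
      (fun r => ((Real.exp (-b * r ^ 2 + r ^ 2) : ℝ) : ℂ)) (Ne.symm h)
    have hm : ((1 / √(Real.pi * m.factorial) : ℝ) : ℂ) ≠ 0 := by
      have : (0 : ℝ) < 1 / √(Real.pi * m.factorial) := by positivity
      exact_mod_cast this.ne'
    have hn : ((1 / √(Real.pi * n.factorial) : ℝ) : ℂ) ≠ 0 := by
      have : (0 : ℝ) < 1 / √(Real.pi * n.factorial) := by positivity
      exact_mod_cast this.ne'
    have e : ∀ q : ℂ, ((Real.exp (-b * ‖q‖ ^ 2 + ‖q‖ ^ 2) : ℝ) : ℂ)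
        * (starRingEnd ℂ (hol n q) * hol m q)
        = ((1 / √(Real.pi * m.factorial) : ℝ) : ℂ) * ((1 / √(Real.pi * n.factorial) : ℝ) : ℂ)
          * (q ^ m * starRingEnd ℂ q ^ n * ((Real.exp (-b * ‖q‖ ^ 2) : ℝ) : ℂ)) := fun q => by
      have e1 : Real.exp (-b * ‖q‖ ^ 2) = Real.exp (-b * ‖q‖ ^ 2 + ‖q‖ ^ 2)
          * Real.exp (-(‖q‖ ^ 2 / 2)) * Real.exp (-(‖q‖ ^ 2 / 2)) := by
        rw [← Real.exp_add, ← Real.exp_add]; congr 1; ring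
      rw [hol_eq, hol_eq, e1, map_mul, map_mul, Complex.conj_ofReal, Complex.conj_ofReal, map_pow,
        Complex.ofReal_mul, Complex.ofReal_mul]
      ring
    simp only [e, integral_const_mul] at h1
    exact (mul_eq_zero.1 h1).resolve_left (mul_ne_zero hm hn)

/-- Multiplication by c is a rotation followed by a real dilation in dimension two. -/
lemma integral_comp_complex_mul (f : ℂ → ℂ) {c : ℂ} (hc : c ≠ 0) :
    ∫ x : ℂ, f (c * x) = (((‖c‖ ^ 2)⁻¹ : ℝ) : ℂ) * ∫ x, f x := by
  have hc' : (‖c‖ : ℂ) ≠ 0 := by exact_mod_cast norm_ne_zero_iff.2 hc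
  let a : Circle := ⟨c / ‖c‖, (mem_sphere_zero_iff_norm (r := 1)).2 (by simp [hc])⟩
  have h := (rotation a).measurePreserving.integral_comp
    (rotation a).toHomeomorph.measurableEmbedding fun y : ℂ => f (‖c‖ • y)
  have e : ∀ x : ℂ, ‖c‖ • rotation a x = c * x := fun x => by
    rw [rotation_apply, Complex.real_smul, ← mul_assoc]
    congr 1
    exact mul_div_cancel₀ _ hc'
  simp only [e] at h
  rw [h, Measure.integral_comp_smul, Complex.finrank_real_complex, abs_of_nonneg (by positivity),
    Complex.real_smul]

/-! ### The trilinear operator on polynomials times the Gaussian -/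

lemma perp_toPlane (x : ℂ) : perp (toPlane x) = toPlane (Complex.I * x) := by
  ext i
  fin_cases i <;> simp [perp, toPlane_zero, toPlane_one]

/-- The points z, x + z, iλx + z and (1 + iλ)x + z are the vertices of a rectangle, so opposite
vertices have the same sum of squared norms. This removes λ from the Gaussian factor once q is the
variable. -/
lemma norm_sq_rectangle (x z : ℂ) (l : ℝ) :
    ‖x + z‖ ^ 2 + ‖l * (Complex.I * x) + z‖ ^ 2 + ‖x + l * (Complex.I * x) + z‖ ^ 2
      = ‖z‖ ^ 2 + 2 * ‖(1 + l * Complex.I) * x + z‖ ^ 2 := by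
  simp only [Complex.sq_norm, Complex.normSq_apply]
  simp
  ring

/-- The integrand of the trilinear operator after the substitution `q = (1 + iλ) x + z`. -/
noncomputable def gaussKernel (P : Polynomial ℂ) (z w q : ℂ) : ℂ :=
  P.eval ((q + z) / 2 + w * ((q - z) / 2)) * P.eval ((q + z) / 2 - w * ((q - z) / 2))
    * starRingEnd ℂ (P.eval q) * ((Real.exp (-1 * ‖q‖ ^ 2) : ℝ) : ℂ)

lemma trilinear_toPlane {f : Plane → ℂ} {P : Polynomial ℂ}
    (hf : ∀ z : ℂ, f (toPlane z) = P.eval z * ((Real.exp (-(‖z‖ ^ 2 / 2)) : ℝ) : ℂ)) (z : ℂ) :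
    trilinear f f f (toPlane z) = ((Real.exp (-(‖z‖ ^ 2 / 2)) : ℝ) : ℂ)
      * ∫ l : ℝ, ∫ q : ℂ, (((1 + l ^ 2)⁻¹ : ℝ) : ℂ) * gaussKernel P z (cayley l) q := by
  rw [trilinear, ← integral_const_mul]
  congr 1
  funext l
  rw [integral_plane]
  have h0 := one_add_mul_I_ne_zero l
  have hn : ‖(1 : ℂ) + l * Complex.I‖ ^ 2 = 1 + l ^ 2 := by
    rw [Complex.sq_norm, Complex.normSq_apply]
    simp
    ring
  have e : ∀ x : ℂ, f (toPlane x + toPlane z) * f (l • perp (toPlane x) + toPlane z)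
      * starRingEnd ℂ (f (toPlane x + l • perp (toPlane x) + toPlane z))
      = ((Real.exp (-(‖z‖ ^ 2 / 2)) : ℝ) : ℂ)
        * gaussKernel P z (cayley l) ((1 + l * Complex.I) * x + z) := fun x => by
    rw [perp_toPlane, ← map_smul toPlane, ← map_add, ← map_add, ← map_add, ← map_add,
      Complex.real_smul, hf, hf, hf, map_mul, Complex.conj_ofReal]
    -- With w the Cayley transform, (1 + w)/2 = 1/(1 + iλ) and (1 - w)/2 = iλ/(1 + iλ): the first
    -- two arguments become affine functions of w and -w.
    have e1 : ((1 + l * Complex.I) * x + z + z) / 2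
        + cayley l * (((1 + l * Complex.I) * x + z - z) / 2) = x + z := by
      rw [cayley]
      field_simp
      ring
    have e2 : ((1 + l * Complex.I) * x + z + z) / 2
        - cayley l * (((1 + l * Complex.I) * x + z - z) / 2) = l * (Complex.I * x) + z := by
      rw [cayley]
      field_simp
      ring
    have e3 : (1 + l * Complex.I) * x + z = x + l * (Complex.I * x) + z := by ring
    have e4 : Real.exp (-(‖z‖ ^ 2 / 2)) * Real.exp (-1 * ‖(1 + l * Complex.I) * x + z‖ ^ 2)
        = Real.exp (-(‖x + z‖ ^ 2 / 2)) * Real.exp (-(‖l * (Complex.I * x) + z‖ ^ 2 / 2))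
          * Real.exp (-(‖x + l * (Complex.I * x) + z‖ ^ 2 / 2)) := by
      rw [← Real.exp_add, ← Real.exp_add, ← Real.exp_add]
      congr 1
      linear_combination (-1 / 2) * -norm_sq_rectangle x z l
    have e4' := congrArg (fun t : ℝ => (t : ℂ)) e4
    simp only [Complex.ofReal_mul] at e4'
    rw [gaussKernel, e1, e2, ← e3]
    rw [← e3] at e4'
    linear_combination -(P.eval (x + z) * P.eval (l * (Complex.I * x) + z)
      * starRingEnd ℂ (P.eval ((1 + l * Complex.I) * x + z))) * e4'
  simp only [e]
  rw [integral_const_mul, integral_const_mul]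
  congr 1
  rw [integral_comp_complex_mul (fun y => gaussKernel P z (cayley l) (y + z)) h0, hn,
    integral_add_right_eq_self (fun y => gaussKernel P z (cayley l) y) z]

/-- Needed for Fubini. As the Cayley transform has modulus one, all three arguments of P are bounded
by |z| + |q| uniformly in λ, and the Gaussian dominates. -/
lemma integrable_gaussKernel (P : Polynomial ℂ) (z : ℂ) :
    Integrable (Function.uncurry fun (l : ℝ) (q : ℂ) =>
      (((1 + l ^ 2)⁻¹ : ℝ) : ℂ) * gaussKernel P z (cayley l) q) (volume.prod volume) := by
  obtain ⟨K, hK, hP⟩ := exists_norm_eval_le P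
  set D := P.natDegree
  refine (Integrable.mul_prod integrable_inv_one_add_sq
    ((integrable_add_norm_pow_mul_exp (1 + ‖z‖) (D + D + D) one_pos).const_mul
      (K * K * K))).mono' (Continuous.aestronglyMeasurable ?_) (ae_of_all _ ?_)
  · have hc := continuous_cayley
    have hi : Continuous fun p : ℝ × ℂ => (1 + p.1 ^ 2)⁻¹ :=
      (by fun_prop : Continuous fun p : ℝ × ℂ => 1 + p.1 ^ 2).inv₀ fun p => by positivity
    simp only [gaussKernel, Function.uncurry_def]
    fun_prop
  · rintro ⟨l, q⟩
    have hw := norm_cayley l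
    simp only [Function.uncurry_apply_pair, gaussKernel, norm_mul, RCLike.norm_conj,
      Complex.norm_real, Real.norm_of_nonneg (Real.exp_pos _).le]
    rw [Real.norm_of_nonneg (by positivity)]
    have b0 : ∀ y : ℂ, ‖y‖ ≤ ‖z‖ + ‖q‖ → ‖P.eval y‖ ≤ K * (1 + ‖z‖ + ‖q‖) ^ D := fun y hy => by
      exact (hP y).trans (mul_le_mul_of_nonneg_left
        (pow_le_pow_left₀ (by positivity) (by linarith) D) hK)
    have h1 : ‖(q + z) / 2‖ ≤ (‖q‖ + ‖z‖) / 2 := by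
      rw [norm_div, Complex.norm_ofNat]
      gcongr
      exact norm_add_le _ _
    have h2 : ‖cayley l * ((q - z) / 2)‖ ≤ (‖q‖ + ‖z‖) / 2 := by
      rw [norm_mul, hw, one_mul, norm_div, Complex.norm_ofNat]
      gcongr
      exact norm_sub_le _ _
    have b1 := b0 _ ((norm_add_le ((q + z) / 2) (cayley l * ((q - z) / 2))).trans (by linarith))
    have b2 := b0 _ ((norm_sub_le ((q + z) / 2) (cayley l * ((q - z) / 2))).trans (by linarith))
    have b3 := b0 q (by linarith [norm_nonneg z])
    calc _ ≤ (1 + l ^ 2)⁻¹ * (K * (1 + ‖z‖ + ‖q‖) ^ D * (K * (1 + ‖z‖ + ‖q‖) ^ D)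
          * (K * (1 + ‖z‖ + ‖q‖) ^ D) * Real.exp (-1 * ‖q‖ ^ 2)) := by gcongr
      _ = _ := by rw [pow_add, pow_add]; ring

lemma trilinear_eq_integral {f : Plane → ℂ} {P : Polynomial ℂ}
    (hf : ∀ z : ℂ, f (toPlane z) = P.eval z * ((Real.exp (-(‖z‖ ^ 2 / 2)) : ℝ) : ℂ)) (z : ℂ) :
    trilinear f f f (toPlane z) = ((Real.exp (-(‖z‖ ^ 2 / 2)) : ℝ) : ℂ)
      * ∫ q : ℂ, Real.pi * ((P * P).eval ((q + z) / 2) * starRingEnd ℂ (P.eval q)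
        * ((Real.exp (-1 * ‖q‖ ^ 2) : ℝ) : ℂ)) := by
  rw [trilinear_toPlane hf, integral_integral_swap (integrable_gaussKernel P z)]
  congr 2
  funext q
  -- For fixed q the product of the first two factors is a polynomial in the Cayley transform; its
  -- value at 0 is P((q + z)/2)².
  have h := integral_inv_mul_eval_cayley
    (P.comp (Polynomial.C ((q + z) / 2) + Polynomial.X * Polynomial.C ((q - z) / 2))
      * P.comp (Polynomial.C ((q + z) / 2) - Polynomial.X * Polynomial.C ((q - z) / 2)))
  simp only [Polynomial.eval_mul, Polynomial.eval_comp, Polynomial.eval_add, Polynomial.eval_sub,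
    Polynomial.eval_C, Polynomial.eval_X, zero_mul, add_zero, sub_zero] at h
  have e : ∀ l : ℝ, (((1 + l ^ 2)⁻¹ : ℝ) : ℂ) * gaussKernel P z (cayley l) q
      = (((1 + l ^ 2)⁻¹ : ℝ) : ℂ) * (P.eval ((q + z) / 2 + cayley l * ((q - z) / 2))
        * P.eval ((q + z) / 2 - cayley l * ((q - z) / 2)))
        * (starRingEnd ℂ (P.eval q) * ((Real.exp (-1 * ‖q‖ ^ 2) : ℝ) : ℂ)) := fun l => by
    rw [gaussKernel]; ring
  simp only [e]
  rw [integral_mul_const, h, Polynomial.eval_mul]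
  ring

end CR

namespace CR

/-! ### The trilinear operator on the lowest Landau level -/

lemma integral_shift_pow_mul_conj_pow (n c : ℕ) (z : ℂ) :
    ∫ q : ℂ, ((q + z) / 2) ^ n * starRingEnd ℂ q ^ c * ((Real.exp (-1 * ‖q‖ ^ 2) : ℝ) : ℂ)
      = (2 ^ n)⁻¹ * (n.choose c * z ^ (n - c)) * (Real.pi * c.factorial) := by
  have e : ∀ q : ℂ, ((q + z) / 2) ^ n * starRingEnd ℂ q ^ c
      * ((Real.exp (-1 * ‖q‖ ^ 2) : ℝ) : ℂ)
      = ∑ m ∈ Finset.range (n + 1), ((2 ^ n)⁻¹ * (n.choose m * z ^ (n - m)))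
        * (q ^ m * starRingEnd ℂ q ^ c * ((Real.exp (-1 * ‖q‖ ^ 2) : ℝ) : ℂ)) := fun q => by
    rw [div_pow, add_pow, Finset.sum_div, Finset.sum_mul, Finset.sum_mul]
    refine Finset.sum_congr rfl fun m _ => ?_
    rw [div_eq_mul_inv]
    ring
  simp only [e]
  rw [integral_finsetSum _ fun m _ =>
    (integrable_pow_mul_conj_pow_mul_exp m c one_pos).const_mul _]
  simp only [integral_const_mul, integral_pow_mul_conj_pow_mul_exp _ _ one_pos, mul_ite, mul_zero,
    Finset.sum_ite_eq', Finset.mem_range]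
  split_ifs with h
  · simp
  -- For c > n no monomial matches, and the vanishing binomial coefficient makes the truncated
  -- exponent n - c irrelevant.
  · rw [Nat.choose_eq_zero_of_lt (by omega)]
    simp

lemma integrable_shift_pow_mul_conj_pow (n c : ℕ) (z : ℂ) :
    Integrable fun q : ℂ => ((q + z) / 2) ^ n * starRingEnd ℂ q ^ c
      * ((Real.exp (-1 * ‖q‖ ^ 2) : ℝ) : ℂ) := by
  refine (integrable_add_norm_pow_mul_exp ‖z‖ (n + c) one_pos).mono'
    (Continuous.aestronglyMeasurable (by fun_prop)) (ae_of_all _ fun q => ?_)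
  rw [norm_mul, norm_mul, norm_pow, norm_pow, RCLike.norm_conj, Complex.norm_real,
    Real.norm_of_nonneg (Real.exp_pos _).le, pow_add]
  have h1 : ‖(q + z) / 2‖ ≤ ‖z‖ + ‖q‖ := by
    rw [norm_div, Complex.norm_ofNat]
    linarith [norm_add_le q z, norm_nonneg q, norm_nonneg z]
  have h2 : ‖q‖ ≤ ‖z‖ + ‖q‖ := by linarith [norm_nonneg z]
  gcongr

lemma eval_mul_conj_eval (R P : Polynomial ℂ) (y q : ℂ) :
    R.eval y * starRingEnd ℂ (P.eval q)
      = ∑ n ∈ Finset.range (R.natDegree + 1), ∑ c ∈ Finset.range (P.natDegree + 1),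
        R.coeff n * starRingEnd ℂ (P.coeff c) * (y ^ n * starRingEnd ℂ q ^ c) := by
  rw [Polynomial.eval_eq_sum_range, Polynomial.eval_eq_sum_range, map_sum, Finset.sum_mul_sum]
  refine Finset.sum_congr rfl fun n _ => Finset.sum_congr rfl fun c _ => ?_
  rw [map_mul, map_pow]
  ring

lemma integral_shift_eval (R P : Polynomial ℂ) (z : ℂ) :
    ∫ q : ℂ, R.eval ((q + z) / 2) * starRingEnd ℂ (P.eval q)
        * ((Real.exp (-1 * ‖q‖ ^ 2) : ℝ) : ℂ)
      = ∑ n ∈ Finset.range (R.natDegree + 1), ∑ c ∈ Finset.range (P.natDegree + 1),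
        R.coeff n * starRingEnd ℂ (P.coeff c)
          * ((2 ^ n)⁻¹ * (n.choose c * z ^ (n - c)) * (Real.pi * c.factorial)) := by
  simp only [eval_mul_conj_eval, Finset.sum_mul, mul_assoc (_ * _) (_ * _) (_ : ℂ)]
  rw [integral_finsetSum _ fun n _ => integrable_finsetSum _ fun c _ =>
    (integrable_shift_pow_mul_conj_pow n c z).const_mul _]
  refine Finset.sum_congr rfl fun n _ => ?_
  rw [integral_finsetSum _ fun c _ => (integrable_shift_pow_mul_conj_pow n c z).const_mul _]
  refine Finset.sum_congr rfl fun c _ => ?_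
  rw [integral_const_mul, integral_shift_pow_mul_conj_pow]

lemma integral_conj_pow_mul_eval (R P : Polynomial ℂ) (d : ℕ) :
    ∫ z : ℂ, starRingEnd ℂ z ^ d * (R.eval z * starRingEnd ℂ (P.eval z))
        * ((Real.exp (-2 * ‖z‖ ^ 2) : ℝ) : ℂ)
      = ∑ n ∈ Finset.range (R.natDegree + 1), ∑ c ∈ Finset.range (P.natDegree + 1),
        R.coeff n * starRingEnd ℂ (P.coeff c)
          * (if n = d + c then (Real.pi : ℂ) * (d + c).factorial / 2 ^ (d + c + 1) else 0) := by
  have e : ∀ z : ℂ, starRingEnd ℂ z ^ d * (R.eval z * starRingEnd ℂ (P.eval z))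
      * ((Real.exp (-2 * ‖z‖ ^ 2) : ℝ) : ℂ)
      = ∑ n ∈ Finset.range (R.natDegree + 1), ∑ c ∈ Finset.range (P.natDegree + 1),
        R.coeff n * starRingEnd ℂ (P.coeff c)
          * (z ^ n * starRingEnd ℂ z ^ (d + c) * ((Real.exp (-2 * ‖z‖ ^ 2) : ℝ) : ℂ)) := fun z => by
    rw [eval_mul_conj_eval, Finset.mul_sum, Finset.sum_mul]
    refine Finset.sum_congr rfl fun n _ => ?_
    rw [Finset.mul_sum, Finset.sum_mul]
    refine Finset.sum_congr rfl fun c _ => ?_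
    ring
  simp only [e]
  rw [integral_finsetSum _ fun n _ => integrable_finsetSum _ fun c _ =>
    (integrable_pow_mul_conj_pow_mul_exp n (d + c) two_pos).const_mul _]
  refine Finset.sum_congr rfl fun n _ => ?_
  rw [integral_finsetSum _ fun c _ =>
    (integrable_pow_mul_conj_pow_mul_exp n (d + c) two_pos).const_mul _]
  refine Finset.sum_congr rfl fun c _ => ?_
  rw [integral_const_mul, integral_pow_mul_conj_pow_mul_exp _ _ two_pos]
  push_cast
  rfl

/-- The cubic nonlinearity `|v|² v`. -/
noncomputable def cubic (v : ℂ) : ℂ := v * v * starRingEnd ℂ v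

/-- The resonant coefficient `2 π² ⟨φ_d, F⟩`. -/
noncomputable def resCoeff (d : ℕ) (F : ℂ → ℂ) : ℂ :=
  2 * Real.pi ^ 2 * ∫ z : ℂ, starRingEnd ℂ (hol d z) * F z

lemma sq_inv_sqrt_pi_factorial (d : ℕ) :
    ((1 / √(Real.pi * d.factorial) : ℝ) : ℂ) * ((1 / √(Real.pi * d.factorial) : ℝ) : ℂ)
      = 1 / (Real.pi * d.factorial) := by
  rw [← Complex.ofReal_mul, div_mul_div_comm, Real.mul_self_sqrt (by positivity)]
  push_cast
  rw [one_mul]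

lemma resCoeff_mul_hol {v : ℂ → ℂ} {P : Polynomial ℂ}
    (hv : ∀ z : ℂ, v z = P.eval z * ((Real.exp (-(‖z‖ ^ 2 / 2)) : ℝ) : ℂ)) (d : ℕ) (z : ℂ) :
    resCoeff d (fun z => cubic (v z)) * hol d z
      = 2 * Real.pi / d.factorial * z ^ d * ((Real.exp (-(‖z‖ ^ 2 / 2)) : ℝ) : ℂ)
        * ∫ y : ℂ, starRingEnd ℂ y ^ d * ((P * P).eval y * starRingEnd ℂ (P.eval y))
          * ((Real.exp (-2 * ‖y‖ ^ 2) : ℝ) : ℂ) := by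
  have e : ∀ y : ℂ, starRingEnd ℂ (hol d y) * cubic (v y)
      = ((1 / √(Real.pi * d.factorial) : ℝ) : ℂ)
        * (starRingEnd ℂ y ^ d * ((P * P).eval y * starRingEnd ℂ (P.eval y))
          * ((Real.exp (-2 * ‖y‖ ^ 2) : ℝ) : ℂ)) := fun y => by
    have e1 : Real.exp (-2 * ‖y‖ ^ 2) = Real.exp (-(‖y‖ ^ 2 / 2)) * Real.exp (-(‖y‖ ^ 2 / 2))
        * Real.exp (-(‖y‖ ^ 2 / 2)) * Real.exp (-(‖y‖ ^ 2 / 2)) := by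
      rw [← Real.exp_add, ← Real.exp_add, ← Real.exp_add]; congr 1; ring
    rw [hol_eq, cubic, hv, e1]
    simp only [map_mul, map_pow, Complex.conj_ofReal, Complex.ofReal_mul, Polynomial.eval_mul]
    ring
  have hpi : (Real.pi : ℂ) ≠ 0 := by exact_mod_cast Real.pi_ne_zero
  have hd : (d.factorial : ℂ) ≠ 0 := by exact_mod_cast d.factorial_ne_zero
  simp only [resCoeff, e, integral_const_mul]
  rw [hol_eq]
  generalize (∫ y : ℂ, (_ : ℂ)) = B
  have h := sq_inv_sqrt_pi_factorial d
  generalize ((1 / √(Real.pi * d.factorial) : ℝ) : ℂ) = s at h ⊢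
  have e2 : 2 * (Real.pi : ℂ) ^ 2 * (1 / (Real.pi * d.factorial)) = 2 * Real.pi / d.factorial := by
    field_simp
  rw [← e2, ← h]
  ring

/-- On functions of the form polynomial times Gaussian, the trilinear operator is the projection
of the cubic nonlinearity onto the span of the `φ_d`. -/
lemma trilinear_eq_sum {f : Plane → ℂ} {P : Polynomial ℂ}
    (hf : ∀ z : ℂ, f (toPlane z) = P.eval z * ((Real.exp (-(‖z‖ ^ 2 / 2)) : ℝ) : ℂ))
    {K : ℕ} (hK : (P * P).natDegree ≤ K) (z : ℂ) :
    trilinear f f f (toPlane z)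
      = ∑ d ∈ Finset.range (K + 1), resCoeff d (fun z => cubic (f (toPlane z))) * hol d z := by
  simp only [resCoeff_mul_hol hf, integral_conj_pow_mul_eval]
  rw [trilinear_eq_integral hf, integral_const_mul, integral_shift_eval]
  simp only [Finset.mul_sum]
  conv_rhs => rw [Finset.sum_comm]
  refine Finset.sum_congr rfl fun n hn => ?_
  conv_rhs => rw [Finset.sum_comm]
  refine Finset.sum_congr rfl fun c _ => ?_
  have hn' := Finset.mem_range.1 hn
  by_cases h : c ≤ n
  -- Only the frequency d = n - c receives the pair (n, c). It is in range since d ≤ n ≤ K, and the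
  -- two coefficients agree by the factorial formula for the binomial.
  · obtain ⟨d, rfl⟩ := Nat.exists_eq_add_of_le' h
    rw [Finset.sum_eq_single_of_mem d (Finset.mem_range.2 (by omega)) fun j _ hj => by
      rw [if_neg (by omega)]; simp, if_pos rfl, Nat.add_sub_cancel]
    have h1 : ((d + c).choose c : ℂ) * c.factorial * d.factorial = (d + c).factorial := by
      have := Nat.choose_mul_factorial_mul_factorial (Nat.le_add_left c d)
      rw [Nat.add_sub_cancel] at this
      exact_mod_cast this
    have hd : (d.factorial : ℂ) ≠ 0 := by exact_mod_cast d.factorial_ne_zero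
    rw [← h1, pow_succ]
    field_simp
    ring
  · rw [Finset.sum_eq_zero fun j _ => by rw [if_neg (by omega)]; simp,
      Nat.choose_eq_zero_of_lt (by omega)]
    simp

/-- The combination `∑_{n ∈ D} aₙ φₙ` in complex coordinates. -/
noncomputable def holComb (D : Finset ℕ) (a : ℕ → ℂ) (z : ℂ) : ℂ := ∑ n ∈ D, a n * hol n z

lemma holSum_toPlane (D : Finset ℕ) (a : ℕ → ℂ) (z : ℂ) :
    holSum D a (toPlane z) = holComb D a z := by
  rw [holSum, sum_apply]
  rfl

/-- The polynomial part of `∑_{n ∈ D} aₙ φₙ`. -/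
noncomputable def holPoly (D : Finset ℕ) (a : ℕ → ℂ) : Polynomial ℂ :=
  ∑ n ∈ D, Polynomial.C (a n * (1 / √(Real.pi * n.factorial) : ℝ)) * Polynomial.X ^ n

lemma holComb_eq_holPoly (D : Finset ℕ) (a : ℕ → ℂ) (z : ℂ) :
    holComb D a z = (holPoly D a).eval z * ((Real.exp (-(‖z‖ ^ 2 / 2)) : ℝ) : ℂ) := by
  rw [holComb, holPoly, Polynomial.eval_finsetSum, Finset.sum_mul]
  refine Finset.sum_congr rfl fun n _ => ?_
  rw [hol_eq, Polynomial.eval_mul, Polynomial.eval_C, Polynomial.eval_pow, Polynomial.eval_X]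
  ring

/-- The coefficients of `𝒯_N(u)` in terms of those of `u`. -/
noncomputable def truncCoeff (N : ℕ) (a : ℕ → ℂ) (d : ℕ) : ℂ :=
  resCoeff d fun z => cubic (holComb (Finset.range (N + 1)) a z)

lemma truncFun_eq {u : XNegOne} (hu : u ∈ holSet) (N : ℕ) :
    truncFun N u = holSum (Finset.range (N + 1)) (truncCoeff N (coeff u)) := by
  rw [truncFun_of_mem hu]
  set V := holSum (Finset.range (N + 1)) (coeff u) with hV
  set P := holPoly (Finset.range (N + 1)) (coeff u)
  have hf : ∀ z : ℂ, V (toPlane z) = P.eval z * ((Real.exp (-(‖z‖ ^ 2 / 2)) : ℝ) : ℂ) :=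
    fun z => by rw [hV, holSum_toPlane, holComb_eq_holPoly]
  -- The first entry covers every frequency produced by the cubic term; the second ensures that all
  -- frequencies kept by the outer projector are in range.
  set K := max (P * P).natDegree N
  have ht : ∀ x : Plane, trilinear V V V x
      = holSum (Finset.range (K + 1)) (truncCoeff N (coeff u)) x := fun x => by
    obtain ⟨z, rfl⟩ := toPlane.surjective x
    rw [trilinear_eq_sum hf (le_max_left _ N), holSum_toPlane, holComb]
    simp only [hV, holSum_toPlane]
    rfl
  simp only [ht]
  refine spectralProj_eq fun k hk χ hχ => ?_
  have h := toTempered_holSum (Finset.range (K + 1)) (truncCoeff N (coeff u)) χ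
  rw [SchwartzMap.toTemperedDistributionCLM_apply_apply volume] at h
  refine h.trans (Finset.sum_eq_single_of_mem k ?_ fun n _ hn => by
    rw [holPair_eq_zero hn hχ, mul_zero])
  have := Finset.mem_range.1 hk
  have := le_max_right (P * P).natDegree N
  exact Finset.mem_range.2 (by omega)

lemma trunc_eq {u : XNegOne} (hu : u ∈ holSet) (N : ℕ) :
    trunc N u = holX (Finset.range (N + 1)) (truncCoeff N (coeff u)) :=
  Subtype.ext (congrArg (SchwartzMap.toTemperedDistributionCLM Plane ℂ volume) (truncFun_eq hu N))

end CR

namespace CR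

/-! ### Moments of Gaussian linear forms -/

lemma lintegral_ofReal_exp_neg_norm_sq :
    ∫⁻ z : ℂ, ENNReal.ofReal (Real.pi⁻¹ * Real.exp (-‖z‖ ^ 2)) = 1 := by
  have h := integral_norm_pow_mul_exp 0 one_pos
  have hi := integrable_norm_pow_mul_exp 0 one_pos
  simp only [mul_zero, pow_zero, one_mul, neg_mul, Nat.factorial_zero, Nat.cast_one, mul_one,
    zero_add, pow_one, div_one] at h hi
  rw [← ofReal_integral_eq_lintegral_ofReal (hi.const_mul _) (ae_of_all _ fun z => by positivity),
    integral_const_mul, h, inv_mul_cancel₀ Real.pi_ne_zero, ENNReal.ofReal_one]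

/-- Completing the square, so that the exponential moments of the complex Gaussian follow from
translation invariance. -/
lemma re_mul_sub_norm_sq (w z : ℂ) :
    (w * z).re + -‖z‖ ^ 2 = ‖w‖ ^ 2 / 4 + -‖z - starRingEnd ℂ w / 2‖ ^ 2 := by
  simp only [Complex.sq_norm, Complex.normSq_apply]
  simp
  ring

lemma lintegral_exp_re_mul_stdComplexGaussian (w : ℂ) :
    ∫⁻ z, ENNReal.ofReal (Real.exp (w * z).re) ∂stdComplexGaussian
      = ENNReal.ofReal (Real.exp (‖w‖ ^ 2 / 4)) := by
  rw [stdComplexGaussian, lintegral_withDensity_eq_lintegral_mul _ (by fun_prop) (by fun_prop)]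
  have e : ∀ z : ℂ, ((fun z : ℂ => ENNReal.ofReal (Real.pi⁻¹ * Real.exp (-‖z‖ ^ 2)))
      * fun z => ENNReal.ofReal (Real.exp (w * z).re)) z
      = ENNReal.ofReal (Real.exp (‖w‖ ^ 2 / 4)) * ENNReal.ofReal
        (Real.pi⁻¹ * Real.exp (-‖z - starRingEnd ℂ w / 2‖ ^ 2)) := fun z => by
    have h := congrArg Real.exp (re_mul_sub_norm_sq w z)
    rw [Real.exp_add, Real.exp_add] at h
    rw [Pi.mul_apply, ← ENNReal.ofReal_mul (by positivity), ← ENNReal.ofReal_mul (by positivity)]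
    congr 1
    linear_combination Real.pi⁻¹ * h
  simp only [e]
  rw [lintegral_const_mul _ (by fun_prop), lintegral_sub_right_eq_self
    (fun z : ℂ => ENNReal.ofReal (Real.pi⁻¹ * Real.exp (-‖z‖ ^ 2))),
    lintegral_ofReal_exp_neg_norm_sq, mul_one]

section

variable {Ω : Type*} [MeasurableSpace Ω] {P : Measure Ω} {g : ℕ → Ω → ℂ}

lemma mgf_re_mul {X : Ω → ℂ} (hX : Measurable X) (hlaw : P.map X = stdComplexGaussian) (w : ℂ) :
    mgf (fun ω => (w * X ω).re) P 1 = Real.exp (‖w‖ ^ 2 / 4) := by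
  have h := lintegral_exp_re_mul_stdComplexGaussian w
  rw [← hlaw, lintegral_map (by fun_prop) hX] at h
  rw [mgf, integral_eq_lintegral_of_nonneg_ae (ae_of_all _ fun ω => (Real.exp_pos _).le)
    (Measurable.aestronglyMeasurable (by fun_prop))]
  simp only [one_mul]
  rw [h, ENNReal.toReal_ofReal (Real.exp_pos _).le]

lemma mgf_re_sum (hg : ∀ n, Measurable (g n)) (hlaw : ∀ n, P.map (g n) = stdComplexGaussian)
    (hindep : iIndepFun g P) (D : Finset ℕ) (c : ℕ → ℂ) :
    mgf (fun ω => (∑ n ∈ D, c n * g n ω).re) P 1 = Real.exp ((∑ n ∈ D, ‖c n‖ ^ 2) / 4) := by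
  have h1 : iIndepFun (fun n ω => (c n * g n ω).re) P :=
    hindep.comp (fun n z => (c n * z).re) fun n => by fun_prop
  have h2 := h1.mgf_sum (t := 1) (fun n => by have := hg n; fun_prop) D
  have e : (∑ n ∈ D, fun ω => (c n * g n ω).re) = fun ω => (∑ n ∈ D, c n * g n ω).re := by
    funext ω
    rw [Finset.sum_apply, Complex.re_sum]
  rw [e] at h2
  rw [h2, Finset.sum_div, Real.exp_sum]
  exact Finset.prod_congr rfl fun n _ => mgf_re_mul (hg n) (hlaw n) (c n)

lemma lintegral_exp_re_sum (hg : ∀ n, Measurable (g n))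
    (hlaw : ∀ n, P.map (g n) = stdComplexGaussian)
    (hindep : iIndepFun g P) (D : Finset ℕ) (c : ℕ → ℂ) (t : ℂ) :
    ∫⁻ ω, ENNReal.ofReal (Real.exp (t * ∑ n ∈ D, c n * g n ω).re) ∂P
      = ENNReal.ofReal (Real.exp (‖t‖ ^ 2 * (∑ n ∈ D, ‖c n‖ ^ 2) / 4)) := by
  have h := mgf_re_sum hg hlaw hindep D fun n => t * c n
  simp only [norm_mul, mul_pow, ← Finset.mul_sum, mul_assoc, mgf, one_mul] at h
  rw [← h, ofReal_integral_eq_lintegral_ofReal _ (ae_of_all _ fun ω => (Real.exp_pos _).le)]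
  refine Integrable.of_integral_ne_zero ?_
  rw [h]
  exact (Real.exp_pos _).ne'

lemma exists_rpow_le_mul_exp (r : ℝ) (hr : 0 ≤ r) :
    ∃ C : ℝ, 0 < C ∧ ∀ x : ℝ, 0 ≤ x → x ^ r ≤ C * Real.exp x := by
  obtain ⟨n, hn⟩ := exists_nat_ge r
  refine ⟨1 + n.factorial, by positivity, fun x hx => ?_⟩
  have h1 := Real.pow_div_factorial_le_exp x hx n
  rw [div_le_iff₀ (by positivity)] at h1
  have h2 := Real.one_le_exp hx
  have h3 : x ^ r ≤ 1 + x ^ n := by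
    rcases le_total x 1 with h | h
    · linarith [Real.rpow_le_one hx h hr, pow_nonneg hx n]
    · have := Real.rpow_le_rpow_of_exponent_le h hn
      rw [Real.rpow_natCast] at this
      linarith
  nlinarith

/-- Since |z| ≤ 2 max(|Re z|, |Im z|), exponentials of four real linear forms suffice, and their
expectations are explicit by independence. -/
lemma exp_norm_le (z : ℂ) : Real.exp ‖z‖ ≤ Real.exp (2 * z).re + Real.exp (-2 * z).re
    + Real.exp (-2 * Complex.I * z).re + Real.exp (2 * Complex.I * z).re := by
  have h1 := Complex.norm_le_abs_re_add_abs_im z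
  have h2 : ∀ x : ℝ, Real.exp (2 * |x|) ≤ Real.exp (2 * x) + Real.exp (-2 * x) := fun x => by
    rcases abs_cases x with ⟨h, -⟩ | ⟨h, -⟩
    · rw [h]; linarith [Real.exp_pos (-2 * x)]
    · rw [h]
      have : 2 * -x = -2 * x := by ring
      rw [this]
      linarith [Real.exp_pos (2 * x)]
  have h3 : Real.exp (|z.re| + |z.im|) ≤ Real.exp (2 * |z.re|) + Real.exp (2 * |z.im|) := by
    rcases le_total |z.re| |z.im| with h | h
    · exact (Real.exp_le_exp.2 (by linarith)).trans (le_add_of_nonneg_left (Real.exp_pos _).le)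
    · exact (Real.exp_le_exp.2 (by linarith)).trans (le_add_of_nonneg_right (Real.exp_pos _).le)
  have e1 : (2 * z).re = 2 * z.re := by simp
  have e2 : (-2 * z).re = -2 * z.re := by simp
  have e3 : (-2 * Complex.I * z).re = 2 * z.im := by simp
  have e4 : (2 * Complex.I * z).re = -2 * z.im := by simp
  rw [e1, e2, e3, e4]
  linarith [h2 z.re, h2 z.im, Real.exp_le_exp.2 h1]

/-- Moments of a Gaussian linear form are controlled by its variance. -/
lemma exists_moment_bound (hg : ∀ n, Measurable (g n))
    (hlaw : ∀ n, P.map (g n) = stdComplexGaussian) (hindep : iIndepFun g P) {r : ℝ} (hr : 0 < r) :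
    ∃ C : ℝ, 0 < C ∧ ∀ (D : Finset ℕ) (c : ℕ → ℂ),
      ∫⁻ ω, ENNReal.ofReal (‖∑ n ∈ D, c n * g n ω‖ ^ r) ∂P
        ≤ ENNReal.ofReal (C * (∑ n ∈ D, ‖c n‖ ^ 2) ^ (r / 2)) := by
  obtain ⟨C, hC, hb⟩ := exists_rpow_le_mul_exp r hr.le
  refine ⟨C * (4 * Real.exp 1), by positivity, fun D c => ?_⟩
  set S : ℝ := ∑ n ∈ D, ‖c n‖ ^ 2 with hS
  rcases (Finset.sum_nonneg fun n _ => sq_nonneg ‖c n‖ : 0 ≤ S).eq_or_lt with h0 | h0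
  -- With zero variance all coefficients vanish; this case is separated because the form is
  -- normalized by √S below.
  · have hz : ∀ n ∈ D, c n = 0 := fun n hn => by
      have := (Finset.sum_eq_zero_iff_of_nonneg fun n _ => sq_nonneg ‖c n‖).1 h0.symm n hn
      simpa using this
    have e : ∀ ω, ∑ n ∈ D, c n * g n ω = 0 := fun ω =>
      Finset.sum_eq_zero fun n hn => by rw [hz n hn, zero_mul]
    simp only [e, norm_zero, Real.zero_rpow hr.ne', ENNReal.ofReal_zero, lintegral_zero]
    exact zero_le
  replace h0 : 0 < S := h0
  have hs : 0 < √S := Real.sqrt_pos.2 h0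
  have hsS : S ^ (r / 2) = √S ^ r := by
    rw [Real.sqrt_eq_rpow, ← Real.rpow_mul h0.le]
    congr 1
    ring
  have hpt : ∀ ω, ENNReal.ofReal (‖∑ n ∈ D, c n * g n ω‖ ^ r)
      ≤ ENNReal.ofReal (S ^ (r / 2) * C)
        * (ENNReal.ofReal (Real.exp ((2 * (√S : ℂ)⁻¹) * ∑ n ∈ D, c n * g n ω).re)
        + ENNReal.ofReal (Real.exp ((-2 * (√S : ℂ)⁻¹) * ∑ n ∈ D, c n * g n ω).re)
        + ENNReal.ofReal (Real.exp ((-2 * Complex.I * (√S : ℂ)⁻¹) * ∑ n ∈ D, c n * g n ω).re)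
        + ENNReal.ofReal
          (Real.exp ((2 * Complex.I * (√S : ℂ)⁻¹) * ∑ n ∈ D, c n * g n ω).re)) := fun ω => by
    set L := ∑ n ∈ D, c n * g n ω
    rw [← ENNReal.ofReal_add (by positivity) (by positivity),
      ← ENNReal.ofReal_add (by positivity) (by positivity),
      ← ENNReal.ofReal_add (by positivity) (by positivity),
      ← ENNReal.ofReal_mul (by positivity), hsS]
    refine ENNReal.ofReal_le_ofReal ?_
    have h1 := exp_norm_le ((√S : ℂ)⁻¹ * L)
    have h2 := hb ‖(√S : ℂ)⁻¹ * L‖ (norm_nonneg _)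
    have h3 : ‖L‖ = √S * ‖(√S : ℂ)⁻¹ * L‖ := by
      rw [norm_mul, norm_inv, Complex.norm_real, Real.norm_of_nonneg hs.le,
        mul_inv_cancel_left₀ hs.ne']
    rw [h3, Real.mul_rpow hs.le (norm_nonneg _), mul_assoc]
    refine mul_le_mul_of_nonneg_left (h2.trans (mul_le_mul_of_nonneg_left ?_ hC.le))
      (by positivity)
    simpa only [mul_assoc] using h1
  refine (lintegral_mono hpt).trans ?_
  have hm : ∀ t : ℂ, Measurable fun ω =>
      ENNReal.ofReal (Real.exp (t * ∑ n ∈ D, c n * g n ω).re) := fun t => by fun_prop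
  -- After normalization each of the four exponential moments equals e, whence the constant 4e.
  have hn : ∀ t : ℂ, ‖t‖ = 2 → ‖t * (√S : ℂ)⁻¹‖ ^ 2 * S / 4 = 1 := fun t ht => by
    rw [norm_mul, ht, norm_inv, Complex.norm_real, Real.norm_of_nonneg hs.le, mul_pow, inv_pow,
      Real.sq_sqrt h0.le, mul_assoc, inv_mul_cancel₀ h0.ne']
    norm_num
  rw [lintegral_const_mul _ (by fun_prop),
    lintegral_add_right _ (hm _), lintegral_add_right _ (hm _), lintegral_add_right _ (hm _),
    lintegral_exp_re_sum hg hlaw hindep, lintegral_exp_re_sum hg hlaw hindep,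
    lintegral_exp_re_sum hg hlaw hindep, lintegral_exp_re_sum hg hlaw hindep,
    ← hS, hn _ (by simp), hn _ (by simp), hn _ (by simp), hn _ (by simp),
    ← ENNReal.ofReal_add (by positivity) (by positivity),
    ← ENNReal.ofReal_add (by positivity) (by positivity),
    ← ENNReal.ofReal_add (by positivity) (by positivity),
    ← ENNReal.ofReal_mul (by positivity)]
  exact ENNReal.ofReal_le_ofReal (le_of_eq (by ring))

/-! ### The random series -/

lemma summable_two_mul_add_two_rpow {σ : ℝ} (hσ : 1 < σ) :
    Summable fun n : ℕ => (2 * (n : ℝ) + 2) ^ (-σ) := by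
  have h := (summable_nat_add_iff 1).2 (Real.summable_nat_rpow.2 (by linarith : -σ < -1))
  refine (h.mul_left ((2 : ℝ) ^ (-σ))).congr fun n => ?_
  rw [← Real.mul_rpow (by norm_num) (by positivity)]
  push_cast
  congr 1
  ring

/-- The variables have uniformly bounded second moments and the weights are summable for σ > 1, so
by Tonelli the random sum has finite expectation. -/
lemma ae_summable_norm_sq (hg : ∀ n, Measurable (g n))
    (hlaw : ∀ n, P.map (g n) = stdComplexGaussian) (hindep : iIndepFun g P)
    {σ : ℝ} (hσ : 1 < σ) :
    ∀ᵐ ω ∂P, Summable fun n : ℕ => (2 * (n : ℝ) + 2) ^ (-σ) * ‖g n ω‖ ^ 2 := by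
  obtain ⟨C, hC, hb⟩ := exists_moment_bound hg hlaw hindep two_pos
  have h1 : ∀ n : ℕ, ∫⁻ ω, ENNReal.ofReal ((2 * (n : ℝ) + 2) ^ (-σ) * ‖g n ω‖ ^ 2) ∂P
      ≤ ENNReal.ofReal ((2 * (n : ℝ) + 2) ^ (-σ) * C) := fun n => by
    have h := hb {n} fun _ => 1
    simp only [Finset.sum_singleton, one_mul, norm_one, one_pow, Real.one_rpow, mul_one,
      Real.rpow_two] at h
    have hm : Measurable fun ω => ENNReal.ofReal (‖g n ω‖ ^ 2) := by
      have := hg n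
      fun_prop
    simp only [ENNReal.ofReal_mul (by positivity : 0 ≤ (2 * (n : ℝ) + 2) ^ (-σ))]
    rw [lintegral_const_mul _ hm]
    gcongr
  have h2 : ∫⁻ ω, ∑' n : ℕ, ENNReal.ofReal ((2 * (n : ℝ) + 2) ^ (-σ) * ‖g n ω‖ ^ 2) ∂P ≠ ∞ := by
    rw [lintegral_tsum fun n => by have := hg n; fun_prop]
    refine ne_top_of_le_ne_top ?_ (ENNReal.tsum_le_tsum h1)
    rw [← ENNReal.ofReal_tsum_of_nonneg (fun n => by positivity)
      ((summable_two_mul_add_two_rpow hσ).mul_right C)]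
    exact ENNReal.ofReal_ne_top
  have h3 := ae_lt_top' (AEMeasurable.tsum fun n => by
    have := hg n
    fun_prop) h2
  filter_upwards [h3] with ω hω
  have h4 := ENNReal.summable_toReal hω.ne
  refine h4.congr fun n => ENNReal.toReal_ofReal (by positivity)

end

end CR

namespace CR

/-! ### Convergence and measurability of the random series -/

lemma holX_sub_holX {M N : ℕ} (h : M ≤ N) (a : ℕ → ℂ) :
    holX (Finset.range N) a - holX (Finset.range M) a = holX (Finset.Ico M N) a :=
  XNegOne.ext fun ψ => by
    change (holX _ a).toDist ψ - (holX _ a).toDist ψ = _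
    simp only [holX_toDist]
    rw [Finset.sum_Ico_eq_sub _ h]

lemma exists_tendsto_holX {a : ℕ → ℂ}
    (ha : ∀ j, Summable fun n : ℕ => (2 * (n : ℝ) + 2) ^ (-order j) * ‖a n‖ ^ 2) :
    ∃ u, Tendsto (fun N => holX (Finset.range N) a) atTop (𝓝 u) := by
  refine XNegOne.exists_tendsto fun j => cauchySeq_tendsto_of_complete ?_
  set f : ℕ → ℝ := fun n => (2 * (n : ℝ) + 2) ^ (-order j) * ‖a n‖ ^ 2
  have hf0 : ∀ n, 0 ≤ f n := fun n => by positivity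
  refine cauchySeq_of_le_tendsto_0' (fun N => √(∑' n, f n - ∑ n ∈ Finset.range N, f n))
    (fun M N hMN => ?_) ?_
  · rw [dist_comm, dist_eq_norm, ← XNegOne.toHNeg_sub, holX_sub_holX hMN]
    refine (norm_holX_le _ _ a).trans (Real.sqrt_le_sqrt ?_)
    rw [Finset.sum_Ico_eq_sub _ hMN]
    exact sub_le_sub_right ((ha j).sum_le_tsum _ fun n _ => hf0 n) _
  · have h := ((ha j).hasSum.tendsto_sum_nat.const_sub (∑' n, f n)).sqrt
    rwa [sub_self, Real.sqrt_zero] at h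

lemma summable_mul_holPair {a : ℕ → ℂ} {σ : ℝ}
    (ha : Summable fun n : ℕ => (2 * (n : ℝ) + 2) ^ (-σ) * ‖a n‖ ^ 2) (ψ : 𝓢(Plane, ℂ)) :
    Summable fun n => a n * holPair n ψ := by
  refine Summable.of_norm (summable_of_sum_le (fun n => norm_nonneg _) fun D =>
    (sum_norm_mul_holPair_le σ D a ψ).trans (mul_le_mul_of_nonneg_right
      (Real.sqrt_le_sqrt (ha.sum_le_tsum D fun n _ => by positivity)) (sobNorm_nonneg σ ψ)))

lemma hasSum_of_tendsto_holX {a : ℕ → ℂ}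
    (ha : ∀ j, Summable fun n : ℕ => (2 * (n : ℝ) + 2) ^ (-order j) * ‖a n‖ ^ 2) {u : XNegOne}
    (hu : Tendsto (fun N => holX (Finset.range N) a) atTop (𝓝 u)) (ψ : 𝓢(Plane, ℂ)) :
    HasSum (fun n => a n * holPair n ψ) (u.toDist ψ) := by
  have h1 := ((XNegOne.continuous_toDist ψ).tendsto u).comp hu
  have h2 := (summable_mul_holPair (ha 0) ψ).hasSum
  have h3 := h2.tendsto_sum_nat
  simp only [Function.comp_def, holX_toDist] at h1
  rw [tendsto_nhds_unique h1 h3]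
  exact h2

/-- `tsum` requires unconditional convergence. In the pointwise topology on distributions this
follows from absolute summability of the series paired with each test function. -/
lemma noise_eq_of_tendsto {Ω : Type*} {g : ℕ → Ω → ℂ} {ω : Ω}
    (ha : ∀ j, Summable fun n : ℕ => (2 * (n : ℝ) + 2) ^ (-order j) * ‖g n ω‖ ^ 2) {u : XNegOne}
    (hu : Tendsto (fun N => holX (Finset.range N) fun n => g n ω) atTop (𝓝 u)) :
    noise g ω = u := by
  have h1 : HasSum (fun n : ℕ => g n ω •
      SchwartzMap.toTemperedDistributionCLM Plane ℂ volume (holHermite n)) u.toDist := by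
    rw [HasSum, PointwiseConvergenceCLM.tendsto_iff_forall_tendsto]
    intro ψ
    refine (hasSum_of_tendsto_holX ha hu ψ).congr fun D => ?_
    rw [← toTempered_holSum, holSum, map_sum]
    simp only [map_smul]
  have h2 : noiseDist g ω = u.toDist := h1.tsum_eq
  have h3 : noiseDist g ω ∈ negSobolevInter := by rw [h2]; exact u.2
  exact (dif_pos h3).trans (Subtype.ext h2)

lemma coeff_of_hasSum {a : ℕ → ℂ} {u : XNegOne}
    (h : ∀ ψ, HasSum (fun n => a n * holPair n ψ) (u.toDist ψ)) : coeff u = a := by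
  funext n
  refine (h (conjSchwartz (holHermite n))).unique ?_
  have h1 := hasSum_single (f := fun m => a m * holPair m (conjSchwartz (holHermite n))) n
    fun m hm => by rw [holPair_conj, if_neg (Ne.symm hm), mul_zero]
  rwa [holPair_conj, if_pos rfl, mul_one] at h1

lemma mem_holSet_of_hasSum {a : ℕ → ℂ} {u : XNegOne}
    (h : ∀ ψ, HasSum (fun n => a n * holPair n ψ) (u.toDist ψ)) : u ∈ holSet := by
  intro k χ hχ
  rw [coeff_of_hasSum h]
  exact (h χ).unique (hasSum_single k fun m hm => by rw [holPair_eq_zero hm hχ, mul_zero])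

section

variable {Ω : Type*} [MeasurableSpace Ω] {P : Measure Ω} {g : ℕ → Ω → ℂ}

lemma ae_tendsto_noise (hg : ∀ n, Measurable (g n))
    (hlaw : ∀ n, P.map (g n) = stdComplexGaussian) (hindep : iIndepFun g P) :
    ∀ᵐ ω ∂P, Tendsto (fun N => holX (Finset.range N) fun n => g n ω) atTop (𝓝 (noise g ω))
      ∧ noise g ω ∈ holSet ∧ coeff (noise g ω) = fun n => g n ω := by
  have h := ae_all_iff.2 fun j => ae_summable_norm_sq hg hlaw hindep (one_lt_order j)
  filter_upwards [h] with ω hω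
  obtain ⟨u, hu⟩ := exists_tendsto_holX hω
  have hs := hasSum_of_tendsto_holX hω hu
  rw [noise_eq_of_tendsto hω hu]
  exact ⟨hu, mem_holSet_of_hasSum hs, coeff_of_hasSum hs⟩

/-- The noise is almost surely the limit of its partial sums, which are continuous functions of the
coefficient sequence. -/
lemma aemeasurable_noise (hg : ∀ n, Measurable (g n))
    (hlaw : ∀ n, P.map (g n) = stdComplexGaussian) (hindep : iIndepFun g P) :
    AEMeasurable (noise g) P := by
  refine aemeasurable_of_tendsto_metrizable_ae atTop
    (f := fun N ω => holX (Finset.range N) fun n => g n ω) (fun N => ?_)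
    ((ae_tendsto_noise hg hlaw hindep).mono fun ω h => h.1)
  exact ((continuous_holX (Finset.range N)).measurable.comp
    (measurable_pi_lambda _ hg)).aemeasurable

lemma ae_mem_holSet (hg : ∀ n, Measurable (g n))
    (hlaw : ∀ n, P.map (g n) = stdComplexGaussian) (hindep : iIndepFun g P) :
    ∀ᵐ u ∂(whiteNoise P g), u ∈ holSet := by
  exact (ae_map_iff (p := fun u => u ∈ holSet) (aemeasurable_noise hg hlaw hindep)
    isClosed_holSet.measurableSet).2 ((ae_tendsto_noise hg hlaw hindep).mono fun ω h => h.2.1)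

end

end CR

namespace CR

/-! ### A weighted Bessel inequality -/

lemma integrable_radWeight_conj_mul {s : ℝ} (hs0 : 0 ≤ s) (hs : s ≤ 2) (m n : ℕ) :
    Integrable fun z => (radWeight s z : ℂ) * (starRingEnd ℂ (hol m z) * hol n z) := by
  refine ((integrable_radWeight_mul m hs0 hs).add (integrable_radWeight_mul n hs0 hs)).mono'
    (Continuous.aestronglyMeasurable ?_) (ae_of_all _ fun z => ?_)
  · have h1 := continuous_radWeight s
    have h2 := continuous_hol m
    have h3 := continuous_hol n
    fun_prop
  · have h := radWeight_pos s z
    rw [norm_mul, norm_mul, RCLike.norm_conj, Complex.norm_real, Real.norm_of_nonneg h.le,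
      Pi.add_apply, ← mul_add]
    refine mul_le_mul_of_nonneg_left ?_ h.le
    nlinarith [sq_nonneg (‖hol m z‖ - ‖hol n z‖), sq_nonneg (‖hol m z‖ + ‖hol n z‖)]

lemma continuous_holComb (D : Finset ℕ) (a : ℕ → ℂ) : Continuous (holComb D a) :=
  continuous_finsetSum _ fun n _ => continuous_const.mul (continuous_hol n)

/-- The weight is radial, so the cross terms integrate to zero and the weighted norm stays diagonal.
-/
lemma integral_radWeight_norm_holComb_sq {s : ℝ} (hs0 : 0 ≤ s) (hs : s ≤ 2) (D : Finset ℕ)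
    (a : ℕ → ℂ) : Integrable (fun z => radWeight s z * ‖holComb D a z‖ ^ 2) ∧
      ∫ z, radWeight s z * ‖holComb D a z‖ ^ 2
        = ∑ n ∈ D, ‖a n‖ ^ 2 * ∫ z, radWeight s z * ‖hol n z‖ ^ 2 := by
  have e : ∀ z, ((radWeight s z * ‖holComb D a z‖ ^ 2 : ℝ) : ℂ)
      = ∑ m ∈ D, ∑ n ∈ D, starRingEnd ℂ (a m) * a n
        * ((radWeight s z : ℂ) * (starRingEnd ℂ (hol m z) * hol n z)) := fun z => by
    rw [Complex.ofReal_mul, Complex.ofReal_pow, ← Complex.conj_mul', holComb, map_sum,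
      Finset.sum_mul_sum, Finset.mul_sum]
    refine Finset.sum_congr rfl fun m _ => ?_
    rw [Finset.mul_sum]
    refine Finset.sum_congr rfl fun n _ => ?_
    rw [map_mul]
    ring
  have hi : ∀ m n : ℕ, Integrable fun z => starRingEnd ℂ (a m) * a n
      * ((radWeight s z : ℂ) * (starRingEnd ℂ (hol m z) * hol n z)) := fun m n =>
    (integrable_radWeight_conj_mul hs0 hs m n).const_mul _
  have hint : Integrable fun z => ((radWeight s z * ‖holComb D a z‖ ^ 2 : ℝ) : ℂ) := by
    simp only [e]
    exact integrable_finsetSum _ fun m _ => integrable_finsetSum _ fun n _ => hi m n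
  refine ⟨hint.re, Complex.ofReal_injective ?_⟩
  rw [← integral_complex_ofReal]
  simp only [e]
  rw [integral_finsetSum _ fun m _ => integrable_finsetSum _ fun n _ => hi m n]
  push_cast
  refine Finset.sum_congr rfl fun m hm => ?_
  rw [integral_finsetSum _ fun n _ => hi m n, Finset.sum_eq_single_of_mem m hm]
  · rw [integral_const_mul, Complex.conj_mul', ← integral_complex_ofReal]
    congr 2
    funext z
    rw [Complex.conj_mul']
    push_cast
    rfl
  · intro n _ hn
    rw [integral_const_mul]
    have := integral_radial_conj_hol_mul_hol (fun r => (((1 + r ^ 2) ^ s : ℝ) : ℂ)) (Ne.symm hn)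
    simp only [radWeight]
    rw [this, mul_zero]

/-- The `φ_d` coefficients of a function of the weighted `L²` space. -/
lemma sum_rpow_mul_norm_coeff_sq_le {s : ℝ} (hs0 : 0 ≤ s) (hs : s ≤ 2) (D : Finset ℕ) {F : ℂ → ℂ}
    (hF : Continuous F) (hFi : Integrable fun z => radWeight (-s) z * ‖F z‖ ^ 2) :
    ∑ d ∈ D, ((d : ℝ) + 1) ^ (-s) * ‖∫ z, starRingEnd ℂ (hol d z) * F z‖ ^ 2
      ≤ 6 * ∫ z, radWeight (-s) z * ‖F z‖ ^ 2 := by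
  set c : ℕ → ℂ := fun d => ∫ z, starRingEnd ℂ (hol d z) * F z with hc
  set S := ∑ d ∈ D, ((d : ℝ) + 1) ^ (-s) * ‖c d‖ ^ 2 with hS
  set I := ∫ z, radWeight (-s) z * ‖F z‖ ^ 2 with hI
  -- The test combination for duality: its scalar product with F is exactly S, and by the weighted
  -- estimate for φ_d its own weighted norm squared is at most 6 S.
  set a : ℕ → ℂ := fun d => ((((d : ℝ) + 1) ^ (-s) : ℝ) : ℂ) * c d with ha
  obtain ⟨hi1, hi2⟩ := integral_radWeight_norm_holComb_sq hs0 hs D a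
  have hyoung : ∀ (t : ℝ), 0 < t → ∀ u v z, ‖u‖ * ‖v‖ ≤ t / 2 * (radWeight s z * ‖(u : ℂ)‖ ^ 2)
      + (2 * t)⁻¹ * (radWeight (-s) z * ‖(v : ℂ)‖ ^ 2) := fun t ht u v z => by
    have h := radWeight_pos s z
    have e : radWeight (-s) z = (radWeight s z)⁻¹ := Real.rpow_neg (by positivity) s
    rw [e, mul_inv, ← sub_nonneg]
    have : t / 2 * (radWeight s z * ‖u‖ ^ 2) + 2⁻¹ * t⁻¹ * ((radWeight s z)⁻¹ * ‖v‖ ^ 2)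
        - ‖u‖ * ‖v‖ = (2 * t * radWeight s z)⁻¹ * (t * radWeight s z * ‖u‖ - ‖v‖) ^ 2 := by
      field_simp
      ring
    rw [this]
    positivity
  have hint : ∀ d, Integrable fun z => starRingEnd ℂ (hol d z) * F z := fun d => by
    refine (((integrable_radWeight_mul d hs0 hs).const_mul (1 / 2)).add
      (hFi.const_mul (2 * 1)⁻¹)).mono' (Continuous.aestronglyMeasurable ?_)
      (ae_of_all _ fun z => ?_)
    · have := continuous_hol d
      fun_prop
    · rw [norm_mul, RCLike.norm_conj]
      exact hyoung 1 one_pos _ _ z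
  have hdual : ∫ z, starRingEnd ℂ (holComb D a z) * F z = (S : ℂ) := by
    have e : ∀ z, starRingEnd ℂ (holComb D a z) * F z
        = ∑ d ∈ D, starRingEnd ℂ (a d) * (starRingEnd ℂ (hol d z) * F z) := fun z => by
      rw [holComb, map_sum, Finset.sum_mul]
      refine Finset.sum_congr rfl fun d _ => ?_
      rw [map_mul, mul_assoc]
    simp only [e]
    rw [integral_finsetSum _ fun d _ => (hint d).const_mul _, hS, Complex.ofReal_sum]
    refine Finset.sum_congr rfl fun d _ => ?_
    rw [integral_const_mul, ha, map_mul, Complex.conj_ofReal, mul_assoc, Complex.conj_mul']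
    push_cast
    rfl
  have h1 : ∑ d ∈ D, ‖a d‖ ^ 2 * ∫ z, radWeight s z * ‖hol d z‖ ^ 2 ≤ 6 * S := by
    rw [hS, Finset.mul_sum]
    refine Finset.sum_le_sum fun d _ => ?_
    have h2 := integral_radWeight_mul_le d hs0 hs
    have h3 : ((d : ℝ) + 1) ^ (-s) * ((d : ℝ) + 1) ^ s = 1 := by
      rw [← Real.rpow_add (by positivity), neg_add_cancel, Real.rpow_zero]
    have h4 : ‖a d‖ = ((d : ℝ) + 1) ^ (-s) * ‖c d‖ := by
      rw [ha, norm_mul, Complex.norm_real, Real.norm_of_nonneg (by positivity)]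
    calc _ ≤ ‖a d‖ ^ 2 * (6 * ((d : ℝ) + 1) ^ s) := by gcongr
      _ = 6 * (((d : ℝ) + 1) ^ (-s) * ‖c d‖ ^ 2)
          * (((d : ℝ) + 1) ^ (-s) * ((d : ℝ) + 1) ^ s) := by rw [h4]; ring
      _ = _ := by rw [h3, mul_one]
  have hS0 : 0 ≤ S := Finset.sum_nonneg fun d _ => by positivity
  -- Young's inequality with t = 1/6 gives S ≤ S/2 + 3I, and the finite quantity S/2 is absorbed
  -- into the left-hand side.
  have h5 : S ≤ 1 / 6 / 2 * (6 * S) + (2 * (1 / 6))⁻¹ * I := by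
    have h6 : S = ‖∫ z, starRingEnd ℂ (holComb D a z) * F z‖ := by
      rw [hdual, Complex.norm_real, Real.norm_of_nonneg hS0]
    calc S ≤ ∫ z, ‖starRingEnd ℂ (holComb D a z) * F z‖ := by
          rw [h6]
          exact norm_integral_le_integral_norm _
      _ ≤ ∫ z, 1 / 6 / 2 * (radWeight s z * ‖holComb D a z‖ ^ 2)
          + (2 * (1 / 6))⁻¹ * (radWeight (-s) z * ‖F z‖ ^ 2) := by
        refine integral_mono_of_nonneg (ae_of_all _ fun z => norm_nonneg _)
          ((hi1.const_mul _).add (hFi.const_mul _)) (ae_of_all _ fun z => ?_)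
        simp only [norm_mul, RCLike.norm_conj]
        exact hyoung _ (by norm_num) _ _ z
      _ ≤ _ := by
        rw [integral_add (hi1.const_mul _) (hFi.const_mul _), integral_const_mul,
          integral_const_mul, hi2]
        gcongr
  linarith

/-- The finite measure with density `(1 + |z|²)^{-s}`. -/
noncomputable def radMeasure (s : ℝ) : Measure ℂ :=
  volume.withDensity fun z => ENNReal.ofReal (radWeight (-s) z)

lemma isFiniteMeasure_radMeasure {s : ℝ} (hs : 1 < s) : IsFiniteMeasure (radMeasure s) :=
  isFiniteMeasure_withDensity_ofReal (integrable_radWeight_neg hs).2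

lemma lintegral_radMeasure (s : ℝ) {f : ℂ → ℝ} (hf : Measurable f) :
    ∫⁻ z, ENNReal.ofReal (f z) ∂(radMeasure s)
      = ∫⁻ z, ENNReal.ofReal (radWeight (-s) z * f z) := by
  have hw := (continuous_radWeight (-s)).measurable
  rw [radMeasure, lintegral_withDensity_eq_lintegral_mul _ (by fun_prop) (by fun_prop)]
  refine lintegral_congr fun z => ?_
  rw [Pi.mul_apply, ENNReal.ofReal_mul (radWeight_pos _ z).le]

/-- Jensen's inequality for a finite measure. -/
lemma lintegral_sq_rpow_le {α : Type*} [MeasurableSpace α] (ν : Measure α) [IsFiniteMeasure ν]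
    {p : ℝ} (hp : 2 ≤ p) {f : α → ℝ} (hf : Measurable f) (hf0 : ∀ x, 0 ≤ f x) :
    (∫⁻ x, ENNReal.ofReal (f x ^ 2) ∂ν) ^ (p / 2)
      ≤ ν Set.univ ^ (p / 2 - 1) * ∫⁻ x, ENNReal.ofReal (f x ^ p) ∂ν := by
  have h := eLpNorm'_le_eLpNorm'_mul_rpow_measure_univ (μ := ν) two_pos hp
    hf.aestronglyMeasurable
  have e : ∀ q : ℝ, 0 < q → ∀ x, ‖f x‖ₑ ^ q = ENNReal.ofReal (f x ^ q) := fun q hq x => by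
    rw [← ofReal_norm, Real.norm_of_nonneg (hf0 x), ENNReal.ofReal_rpow_of_nonneg (hf0 x) hq.le]
  simp only [eLpNorm', e 2 two_pos, e p (by linarith), Real.rpow_two] at h
  have h2 := ENNReal.rpow_le_rpow h (by linarith : 0 ≤ p)
  rw [ENNReal.mul_rpow_of_nonneg _ _ (by linarith), ← ENNReal.rpow_mul, ← ENNReal.rpow_mul,
    ← ENNReal.rpow_mul, one_div_mul_cancel (by linarith : p ≠ 0), ENNReal.rpow_one] at h2
  have e1 : 1 / 2 * p = p / 2 := by ring
  have e2 : (1 / 2 - 1 / p) * p = p / 2 - 1 := by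
    have : p ≠ 0 := by linarith
    field_simp
  rwa [e1, e2, mul_comm] at h2

/-- Of the exponent σ, the part s is kept for the Bessel inequality and the excess σ - s is spent on
decay in the lowest frequency. -/
lemma weight_le_of_le {σ s : ℝ} (h0 : 0 ≤ s) (hs : s ≤ σ) {m d : ℕ} (hm : 1 ≤ m) (hd : m ≤ d + 1) :
    (2 * (d : ℝ) + 2) ^ (-σ) ≤ (m : ℝ) ^ (-(σ - s)) * ((d : ℝ) + 1) ^ (-s) := by
  have hm' : (0 : ℝ) < m := by exact_mod_cast hm
  have hd' : (m : ℝ) ≤ d + 1 := by exact_mod_cast hd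
  have h1 : (2 * (d : ℝ) + 2) ^ (-σ) ≤ ((d : ℝ) + 1) ^ (-σ) :=
    Real.rpow_le_rpow_of_nonpos (by positivity) (by linarith [(d.cast_nonneg : (0 : ℝ) ≤ d)])
      (by linarith)
  have h2 : ((d : ℝ) + 1) ^ (-σ) = ((d : ℝ) + 1) ^ (-(σ - s)) * ((d : ℝ) + 1) ^ (-s) := by
    rw [← Real.rpow_add (by positivity)]
    congr 1
    ring
  rw [h2] at h1
  exact h1.trans (mul_le_mul_of_nonneg_right
    (Real.rpow_le_rpow_of_nonpos hm' hd' (by linarith)) (by positivity))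

/-- The `ℋ^{-σ}` norm of the projection of `F` onto high frequencies. -/
lemma exists_holX_resCoeff_bound {p σ s : ℝ} (hp : 2 ≤ p) (hσ : 1 < σ) (hs1 : 1 < s) (hs2 : s ≤ 2)
    (hsσ : s ≤ σ) :
    ∃ C : ℝ≥0∞, C ≠ ∞ ∧ ∀ (m : ℕ) (D : Finset ℕ) (F : ℂ → ℂ), 1 ≤ m → (∀ d ∈ D, m ≤ d + 1) →
      Continuous F → ‖(holX D fun d => resCoeff d F).toHNeg hσ‖ₑ ^ p
        ≤ C * ENNReal.ofReal ((m : ℝ) ^ (-(σ - s)))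
          * ∫⁻ z, ENNReal.ofReal (‖F z‖ ^ p) ∂(radMeasure s) := by
  have hfin := isFiniteMeasure_radMeasure hs1
  have hpi := Real.pi_pos
  -- The square of the factor 2π² in `resCoeff`, times the constant 6 of the weighted Bessel
  -- inequality.
  set K : ℝ := 24 * Real.pi ^ 4 with hK
  refine ⟨ENNReal.ofReal K ^ (p / 2) * radMeasure s Set.univ ^ (p / 2 - 1),
    ENNReal.mul_ne_top (ENNReal.rpow_ne_top_of_nonneg (by linarith) ENNReal.ofReal_ne_top)
      (ENNReal.rpow_ne_top_of_nonneg (by linarith) (measure_ne_top _ _)),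
    fun m D F hm hD hF => ?_⟩
  have hjen := lintegral_sq_rpow_le (radMeasure s) hp hF.norm.measurable fun z => norm_nonneg _
  have hm1 : (1 : ℝ) ≤ m := by exact_mod_cast hm
  -- The decay factor is at most 1 and p/2 ≥ 1, so the power created by passing from 2 to p may be
  -- dropped.
  have hdecay : ENNReal.ofReal ((m : ℝ) ^ (-(σ - s))) ^ (p / 2)
      ≤ ENNReal.ofReal ((m : ℝ) ^ (-(σ - s))) := by
    have h1 : ENNReal.ofReal ((m : ℝ) ^ (-(σ - s))) ≤ 1 := by
      rw [ENNReal.ofReal_le_one]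
      exact Real.rpow_le_one_of_one_le_of_nonpos hm1 (by linarith)
    exact (ENNReal.rpow_le_rpow_of_exponent_ge h1 (by linarith)).trans_eq (ENNReal.rpow_one _)
  have hmain : ‖(holX D fun d => resCoeff d F).toHNeg hσ‖ₑ ^ (2 : ℝ)
      ≤ ENNReal.ofReal K * ENNReal.ofReal ((m : ℝ) ^ (-(σ - s)))
        * ∫⁻ z, ENNReal.ofReal (‖F z‖ ^ 2) ∂(radMeasure s) := by
    -- If the weighted norm is infinite the right-hand side is infinite, its other factors being
    -- positive; otherwise F satisfies the integrability hypothesis of the Bessel inequality.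
    by_cases htop : ∫⁻ z, ENNReal.ofReal (‖F z‖ ^ 2) ∂(radMeasure s) = ∞
    · rw [htop, ENNReal.mul_top]
      · exact le_top
      · rw [← ENNReal.ofReal_mul (by positivity)]
        exact (ENNReal.ofReal_pos.2 (by positivity)).ne'
    have hFm := hF.measurable
    rw [lintegral_radMeasure s (f := fun z => ‖F z‖ ^ 2) (by fun_prop)] at htop ⊢
    have h0 : ∀ z, 0 ≤ radWeight (-s) z * ‖F z‖ ^ 2 := fun z =>
      mul_nonneg (radWeight_pos _ z).le (sq_nonneg _)
    have hi : Integrable fun z => radWeight (-s) z * ‖F z‖ ^ 2 :=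
      ⟨((continuous_radWeight _).mul (hF.norm.pow 2)).aestronglyMeasurable, by
        rw [hasFiniteIntegral_iff_ofReal (ae_of_all _ h0)]
        exact lt_top_iff_ne_top.2 htop⟩
    rw [← ofReal_integral_eq_lintegral_ofReal hi (ae_of_all _ h0),
      ← ENNReal.ofReal_mul (by positivity), ← ENNReal.ofReal_mul (by positivity),
      ← ofReal_norm, ENNReal.ofReal_rpow_of_nonneg (norm_nonneg _) (by norm_num), Real.rpow_two]
    refine ENNReal.ofReal_le_ofReal ?_
    have hb := norm_holX_le hσ D fun d => resCoeff d F
    refine (pow_le_pow_left₀ (norm_nonneg _) hb 2).trans ?_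
    rw [Real.sq_sqrt (Finset.sum_nonneg fun d _ => by positivity)]
    have hB := sum_rpow_mul_norm_coeff_sq_le (by linarith) hs2 D hF hi
    have hr : ∀ d, ‖resCoeff d F‖ ^ 2
        = 4 * Real.pi ^ 4 * ‖∫ z, starRingEnd ℂ (hol d z) * F z‖ ^ 2 := fun d => by
      rw [resCoeff, norm_mul, norm_mul, norm_pow, Complex.norm_real, Complex.norm_ofNat,
        Real.norm_of_nonneg hpi.le]
      ring
    calc ∑ d ∈ D, (2 * (d : ℝ) + 2) ^ (-σ) * ‖resCoeff d F‖ ^ 2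
        ≤ ∑ d ∈ D, 4 * Real.pi ^ 4 * (m : ℝ) ^ (-(σ - s)) * (((d : ℝ) + 1) ^ (-s)
          * ‖∫ z, starRingEnd ℂ (hol d z) * F z‖ ^ 2) := by
          refine Finset.sum_le_sum fun d hd => ?_
          rw [hr]
          have := weight_le_of_le (by linarith) hsσ hm (hD d hd)
          calc _ ≤ ((m : ℝ) ^ (-(σ - s)) * ((d : ℝ) + 1) ^ (-s))
              * (4 * Real.pi ^ 4 * ‖∫ z, starRingEnd ℂ (hol d z) * F z‖ ^ 2) := by gcongr
            _ = _ := by ring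
      _ ≤ 4 * Real.pi ^ 4 * (m : ℝ) ^ (-(σ - s))
          * (6 * ∫ z, radWeight (-s) z * ‖F z‖ ^ 2) := by
        rw [← Finset.mul_sum]
        gcongr
      _ = _ := by rw [hK]; ring
  have e : ‖(holX D fun d => resCoeff d F).toHNeg hσ‖ₑ ^ p
      = (‖(holX D fun d => resCoeff d F).toHNeg hσ‖ₑ ^ (2 : ℝ)) ^ (p / 2) := by
    rw [← ENNReal.rpow_mul]
    congr 1
    ring
  rw [e]
  refine (ENNReal.rpow_le_rpow hmain (by linarith)).trans ?_
  rw [ENNReal.mul_rpow_of_nonneg _ _ (by linarith), ENNReal.mul_rpow_of_nonneg _ _ (by linarith)]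
  calc _ ≤ ENNReal.ofReal K ^ (p / 2) * ENNReal.ofReal ((m : ℝ) ^ (-(σ - s)))
        * (radMeasure s Set.univ ^ (p / 2 - 1)
          * ∫⁻ z, ENNReal.ofReal (‖F z‖ ^ p) ∂(radMeasure s)) := by gcongr
    _ = _ := by ring

end CR

namespace CR

/-! ### Linearity of the resonant coefficients -/

lemma continuous_cubic : Continuous cubic := by
  unfold cubic
  fun_prop

lemma norm_cubic (v : ℂ) : ‖cubic v‖ = ‖v‖ ^ 3 := by
  rw [cubic, norm_mul, norm_mul, RCLike.norm_conj]
  ring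

lemma norm_cubic_sub_le (v w : ℂ) :
    ‖cubic v - cubic w‖ ≤ 2 * ‖v - w‖ * (‖v‖ ^ 2 + ‖w‖ ^ 2) := by
  have e : cubic v - cubic w = v * v * starRingEnd ℂ (v - w)
      + (v - w) * (v * starRingEnd ℂ w) + (v - w) * (w * starRingEnd ℂ w) := by
    rw [cubic, cubic, map_sub]
    ring
  have h := norm_add₃_le (a := v * v * starRingEnd ℂ (v - w))
    (b := (v - w) * (v * starRingEnd ℂ w)) (c := (v - w) * (w * starRingEnd ℂ w))
  rw [← e] at h
  simp only [norm_mul, RCLike.norm_conj] at h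
  nlinarith [norm_nonneg (v - w), mul_nonneg (norm_nonneg (v - w)) (sq_nonneg (‖v‖ - ‖w‖)),
    mul_nonneg (norm_nonneg (v - w)) (sq_nonneg ‖v‖),
    mul_nonneg (norm_nonneg (v - w)) (sq_nonneg ‖w‖)]

lemma integrable_hol (n : ℕ) : Integrable (hol n) :=
  (measurePreserving_toPlane.integrable_comp_emb measurableEmbedding_toPlane).2
    (holHermite n).integrable

lemma norm_hol_le_one (n : ℕ) (z : ℂ) : ‖hol n z‖ ≤ 1 := by
  have h := sum_norm_hol_sq_le {n} z
  rw [Finset.sum_singleton] at h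
  have h2 : Real.pi⁻¹ ≤ 1 := inv_le_one_of_one_le₀ (by linarith [Real.pi_gt_three])
  nlinarith [norm_nonneg (hol n z)]

lemma integrable_conj_hol_mul_cubic (d : ℕ) (D : Finset ℕ) (a : ℕ → ℂ) :
    Integrable fun z => starRingEnd ℂ (hol d z) * cubic (holComb D a z) := by
  have hV : ∀ z, ‖holComb D a z‖ ≤ ∑ n ∈ D, ‖a n‖ := fun z =>
    (norm_sum_le _ _).trans (Finset.sum_le_sum fun n _ => by
      rw [norm_mul]
      exact mul_le_of_le_one_right (norm_nonneg _) (norm_hol_le_one n z))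
  refine ((integrable_hol d).norm.mul_const ((∑ n ∈ D, ‖a n‖) ^ 3)).mono'
    (Continuous.aestronglyMeasurable ?_) (ae_of_all _ fun z => ?_)
  · have h1 := continuous_hol d
    have h2 := continuous_holComb D a
    have h3 := continuous_cubic
    fun_prop
  · rw [norm_mul, RCLike.norm_conj, norm_cubic]
    exact mul_le_mul_of_nonneg_left (pow_le_pow_left₀ (norm_nonneg _) (hV z) 3) (norm_nonneg _)

lemma truncCoeff_sub (M N : ℕ) (a : ℕ → ℂ) (d : ℕ) :
    truncCoeff N a d - truncCoeff M a d
      = resCoeff d fun z => cubic (holComb (Finset.range (N + 1)) a z)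
        - cubic (holComb (Finset.range (M + 1)) a z) := by
  simp only [truncCoeff, resCoeff, mul_sub]
  rw [integral_sub (integrable_conj_hol_mul_cubic _ _ _) (integrable_conj_hol_mul_cubic _ _ _),
    mul_sub]

/-- The element `𝒯_N` of a formal series with the given coefficients. -/
noncomputable def truncX (N : ℕ) (a : ℕ → ℂ) : XNegOne :=
  holX (Finset.range (N + 1)) (truncCoeff N a)

/-- Up to M both projectors act, so the difference of the cubic terms appears; beyond M only the
cubic term of level N contributes. The two pieces are small for different reasons. -/
lemma truncX_sub {M N : ℕ} (h : M ≤ N) (a : ℕ → ℂ) :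
    truncX N a - truncX M a
      = holX (Finset.range (M + 1)) (fun d => resCoeff d fun z =>
          cubic (holComb (Finset.range (N + 1)) a z)
            - cubic (holComb (Finset.range (M + 1)) a z))
        + holX (Finset.Ico (M + 1) (N + 1)) (fun d => resCoeff d fun z =>
          cubic (holComb (Finset.range (N + 1)) a z)) := by
  refine XNegOne.ext fun ψ => ?_
  change (holX _ _).toDist ψ - (holX _ _).toDist ψ = (holX _ _).toDist ψ + (holX _ _).toDist ψ
  simp only [holX_toDist, ← truncCoeff_sub, sub_mul, Finset.sum_sub_distrib]
  have e := Finset.sum_Ico_eq_sub (fun n => truncCoeff N a n * holPair n ψ)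
    (Nat.succ_le_succ h)
  simp only [truncCoeff, Nat.succ_eq_add_one] at e ⊢
  rw [e]
  ring

lemma enorm_add_rpow_le {E : Type*} [NormedAddCommGroup E] {p : ℝ} (hp : 0 ≤ p) (x y : E) :
    ‖x + y‖ₑ ^ p ≤ 2 ^ p * (‖x‖ₑ ^ p + ‖y‖ₑ ^ p) := by
  have h : ‖x + y‖ₑ ≤ 2 * max ‖x‖ₑ ‖y‖ₑ := by
    rw [two_mul]
    refine (enorm_add_le x y).trans ?_
    exact add_le_add (le_max_left _ _) (le_max_right _ _)
  refine (ENNReal.rpow_le_rpow h hp).trans ?_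
  rw [ENNReal.mul_rpow_of_nonneg _ _ hp]
  gcongr
  rcases le_total ‖x‖ₑ ‖y‖ₑ with h | h
  · rw [max_eq_right h]; exact le_add_self
  · rw [max_eq_left h]; exact le_self_add

lemma add_rpow_le {p x y : ℝ} (hp : 0 ≤ p) (hx : 0 ≤ x) (hy : 0 ≤ y) :
    (x + y) ^ p ≤ 2 ^ p * (x ^ p + y ^ p) := by
  have h : x + y ≤ 2 * max x y := by linarith [le_max_left x y, le_max_right x y]
  refine (Real.rpow_le_rpow (by positivity) h hp).trans ?_
  rw [Real.mul_rpow two_pos.le (le_max_of_le_left hx)]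
  gcongr
  rcases le_total x y with h | h
  · rw [max_eq_right h]; exact le_add_of_nonneg_left (by positivity)
  · rw [max_eq_left h]; exact le_add_of_nonneg_right (by positivity)

lemma lintegral_mul_le_sqrt {α : Type*} [MeasurableSpace α] (μ : Measure α) {f h : α → ℝ}
    (hf : Measurable f) (hh : Measurable h) (hf0 : ∀ x, 0 ≤ f x) (hh0 : ∀ x, 0 ≤ h x) :
    ∫⁻ x, ENNReal.ofReal (f x * h x) ∂μ
      ≤ (∫⁻ x, ENNReal.ofReal (f x ^ 2) ∂μ) ^ (1 / 2 : ℝ)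
        * (∫⁻ x, ENNReal.ofReal (h x ^ 2) ∂μ) ^ (1 / 2 : ℝ) := by
  have h1 := ENNReal.lintegral_mul_le_Lp_mul_Lq μ Real.HolderConjugate.two_two
    (f := fun x => ENNReal.ofReal (f x)) (g := fun x => ENNReal.ofReal (h x))
    (by fun_prop) (by fun_prop)
  have e : ∀ t : ℝ, 0 ≤ t → ENNReal.ofReal t ^ (2 : ℝ) = ENNReal.ofReal (t ^ 2) := fun t ht => by
    rw [ENNReal.ofReal_rpow_of_nonneg ht two_pos.le, Real.rpow_two]
  simp only [e _ (hf0 _), e _ (hh0 _), Pi.mul_apply, ← ENNReal.ofReal_mul (hf0 _)] at h1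
  exact h1

section

variable {Ω : Type*} [MeasurableSpace Ω] {P : Measure Ω} {g : ℕ → Ω → ℂ}

lemma exists_moment_bound_holComb (hg : ∀ n, Measurable (g n))
    (hlaw : ∀ n, P.map (g n) = stdComplexGaussian) (hindep : iIndepFun g P) {r : ℝ} (hr : 0 < r) :
    ∃ C : ℝ, 0 < C ∧ ∀ (D : Finset ℕ) (z : ℂ),
      ∫⁻ ω, ENNReal.ofReal (‖holComb D (fun n => g n ω) z‖ ^ r) ∂P
        ≤ ENNReal.ofReal (C * (∑ n ∈ D, ‖hol n z‖ ^ 2) ^ (r / 2)) := by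
  obtain ⟨C, hC, hb⟩ := exists_moment_bound hg hlaw hindep hr
  refine ⟨C, hC, fun D z => ?_⟩
  simpa only [holComb, mul_comm] using hb D fun n => hol n z

lemma sum_norm_hol_sq_le_one (D : Finset ℕ) (z : ℂ) : ∑ n ∈ D, ‖hol n z‖ ^ 2 ≤ 1 :=
  (sum_norm_hol_sq_le D z).trans (inv_le_one_of_one_le₀ (by linarith [Real.pi_gt_three]))

lemma exists_uniform_moment_bound (hg : ∀ n, Measurable (g n))
    (hlaw : ∀ n, P.map (g n) = stdComplexGaussian) (hindep : iIndepFun g P) {r : ℝ} (hr : 0 < r) :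
    ∃ C : ℝ, 0 < C ∧ ∀ (D : Finset ℕ) (z : ℂ),
      ∫⁻ ω, ENNReal.ofReal (‖holComb D (fun n => g n ω) z‖ ^ r) ∂P ≤ ENNReal.ofReal C := by
  obtain ⟨C, hC, hb⟩ := exists_moment_bound_holComb hg hlaw hindep hr
  refine ⟨C, hC, fun D z => (hb D z).trans (ENNReal.ofReal_le_ofReal ?_)⟩
  exact mul_le_of_le_one_right hC.le (Real.rpow_le_one
    (Finset.sum_nonneg fun n _ => sq_nonneg _) (sum_norm_hol_sq_le_one D z) (by positivity))

lemma measurable_holComb (hg : ∀ n, Measurable (g n)) (D : Finset ℕ) :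
    Measurable fun q : Ω × ℂ => holComb D (fun n => g n q.1) q.2 := by
  have h := fun n => (continuous_hol n).measurable
  unfold holComb
  fun_prop

lemma holComb_range_sub {M N : ℕ} (h : M ≤ N) (a : ℕ → ℂ) (z : ℂ) :
    holComb (Finset.range (N + 1)) a z - holComb (Finset.range (M + 1)) a z
      = holComb (Finset.Ico (M + 1) (N + 1)) a z :=
  (Finset.sum_Ico_eq_sub _ (Nat.succ_le_succ h)).symm

/-- Pointwise moments of the difference of the truncated cubic nonlinearities. -/
lemma exists_cubic_sub_bound (hg : ∀ n, Measurable (g n))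
    (hlaw : ∀ n, P.map (g n) = stdComplexGaussian) (hindep : iIndepFun g P) {p : ℝ} (hp : 2 ≤ p) :
    ∃ C : ℝ≥0∞, C ≠ ∞ ∧ ∀ (M N : ℕ) (z : ℂ), M ≤ N →
      ∫⁻ ω, ENNReal.ofReal (‖cubic (holComb (Finset.range (N + 1)) (fun n => g n ω) z)
        - cubic (holComb (Finset.range (M + 1)) (fun n => g n ω) z)‖ ^ p) ∂P
        ≤ C * ENNReal.ofReal (∑ n ∈ Finset.Ico (M + 1) (N + 1), ‖hol n z‖ ^ 2) := by
  obtain ⟨C₁, hC₁, h1⟩ := exists_moment_bound_holComb hg hlaw hindep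
    (by linarith : 0 < p * 2)
  obtain ⟨C₂, hC₂, h2⟩ := exists_uniform_moment_bound hg hlaw hindep
    (by linarith : 0 < p * 2 * 2)
  refine ⟨ENNReal.ofReal (2 ^ p * 2 ^ p) * (2 * (ENNReal.ofReal C₁ ^ (1 / 2 : ℝ)
    * ENNReal.ofReal C₂ ^ (1 / 2 : ℝ))), by finiteness, fun M N z hMN => ?_⟩
  set τ := ∑ n ∈ Finset.Ico (M + 1) (N + 1), ‖hol n z‖ ^ 2 with hτ
  have hτ0 : 0 ≤ τ := Finset.sum_nonneg fun n _ => sq_nonneg _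
  have hτ1 : τ ≤ 1 := sum_norm_hol_sq_le_one _ z
  have hm : ∀ D : Finset ℕ, Measurable fun ω => holComb D (fun n => g n ω) z := fun D =>
    (measurable_holComb hg D).comp (measurable_id.prodMk measurable_const)
  set A : Finset ℕ → Ω → ℂ := fun D ω => holComb D (fun n => g n ω) z with hA
  -- Cauchy–Schwarz separates the high-frequency factor, which carries the smallness, from the two
  -- factors with uniformly bounded moments.
  have hcs : ∀ D : Finset ℕ, ∫⁻ ω, ENNReal.ofReal
      (‖A (Finset.Ico (M + 1) (N + 1)) ω‖ ^ p * ‖A D ω‖ ^ (p * 2)) ∂P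
      ≤ ENNReal.ofReal C₁ ^ (1 / 2 : ℝ) * ENNReal.ofReal C₂ ^ (1 / 2 : ℝ)
        * ENNReal.ofReal τ := fun D => by
    have hm1 := hm (Finset.Ico (M + 1) (N + 1))
    have hm2 := hm D
    have h3 := lintegral_mul_le_sqrt P (f := fun ω => ‖A (Finset.Ico (M + 1) (N + 1)) ω‖ ^ p)
      (h := fun ω => ‖A D ω‖ ^ (p * 2)) (by fun_prop) (by fun_prop) (fun ω => by positivity)
      (fun ω => by positivity)
    have e : ∀ (x : ℂ) (q : ℝ), (‖x‖ ^ q) ^ 2 = ‖x‖ ^ (q * 2) := fun x q => by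
      rw [Real.rpow_mul (norm_nonneg _), Real.rpow_two]
    simp only [e] at h3
    refine h3.trans ?_
    have h4 : (∫⁻ ω, ENNReal.ofReal (‖A (Finset.Ico (M + 1) (N + 1)) ω‖ ^ (p * 2)) ∂P)
        ^ (1 / 2 : ℝ) ≤ ENNReal.ofReal C₁ ^ (1 / 2 : ℝ) * ENNReal.ofReal τ := by
      refine (ENNReal.rpow_le_rpow (h1 _ z) (by norm_num)).trans ?_
      rw [← hτ, ENNReal.ofReal_mul hC₁.le, ENNReal.mul_rpow_of_nonneg _ _ (by norm_num)]
      gcongr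
      rw [ENNReal.ofReal_rpow_of_nonneg (by positivity) (by norm_num), ← Real.rpow_mul hτ0]
      refine ENNReal.ofReal_le_ofReal ?_
      -- The exponent is p/2 ≥ 1 and the tail variance τ is at most 1. A bound linear in τ can be
      -- integrated in z term by term.
      calc τ ^ (p * 2 / 2 * (1 / 2)) ≤ τ ^ (1 : ℝ) :=
            Real.rpow_le_rpow_of_exponent_ge' hτ0 hτ1 zero_le_one (by linarith)
        _ = τ := Real.rpow_one τ
    have h5 := ENNReal.rpow_le_rpow (h2 D z) (by norm_num : (0 : ℝ) ≤ 1 / 2)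
    calc _ ≤ (ENNReal.ofReal C₁ ^ (1 / 2 : ℝ) * ENNReal.ofReal τ)
          * ENNReal.ofReal C₂ ^ (1 / 2 : ℝ) := mul_le_mul' h4 h5
      _ = _ := by ring
  have hpt : ∀ ω, ENNReal.ofReal (‖cubic (A (Finset.range (N + 1)) ω)
      - cubic (A (Finset.range (M + 1)) ω)‖ ^ p) ≤ ENNReal.ofReal (2 ^ p * 2 ^ p)
        * (ENNReal.ofReal (‖A (Finset.Ico (M + 1) (N + 1)) ω‖ ^ p
            * ‖A (Finset.range (N + 1)) ω‖ ^ (p * 2))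
          + ENNReal.ofReal (‖A (Finset.Ico (M + 1) (N + 1)) ω‖ ^ p
            * ‖A (Finset.range (M + 1)) ω‖ ^ (p * 2))) := fun ω => by
    rw [← ENNReal.ofReal_add (by positivity) (by positivity), ← ENNReal.ofReal_mul (by positivity)]
    refine ENNReal.ofReal_le_ofReal ?_
    have h6 := norm_cubic_sub_le (A (Finset.range (N + 1)) ω) (A (Finset.range (M + 1)) ω)
    have e : A (Finset.range (N + 1)) ω - A (Finset.range (M + 1)) ω
        = A (Finset.Ico (M + 1) (N + 1)) ω := holComb_range_sub hMN _ z
    rw [e] at h6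
    have h7 := Real.rpow_le_rpow (norm_nonneg _) h6 (by linarith : 0 ≤ p)
    rw [Real.mul_rpow (by positivity) (by positivity), Real.mul_rpow two_pos.le (norm_nonneg _)]
      at h7
    have h8 := add_rpow_le (by linarith : 0 ≤ p) (sq_nonneg ‖A (Finset.range (N + 1)) ω‖)
      (sq_nonneg ‖A (Finset.range (M + 1)) ω‖)
    have e2 : ∀ x : ℂ, (‖x‖ ^ 2) ^ p = ‖x‖ ^ (p * 2) := fun x => by
      rw [mul_comm, Real.rpow_mul (norm_nonneg _), Real.rpow_two]
    rw [e2, e2] at h8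
    refine h7.trans ((mul_le_mul_of_nonneg_left h8 (by positivity)).trans_eq ?_)
    ring
  refine (lintegral_mono hpt).trans ?_
  have hm1 := hm (Finset.Ico (M + 1) (N + 1))
  have hm2 := hm (Finset.range (N + 1))
  have hm3 := hm (Finset.range (M + 1))
  rw [lintegral_const_mul _ (by fun_prop), lintegral_add_left (by fun_prop)]
  calc _ ≤ ENNReal.ofReal (2 ^ p * 2 ^ p)
        * (ENNReal.ofReal C₁ ^ (1 / 2 : ℝ) * ENNReal.ofReal C₂ ^ (1 / 2 : ℝ) * ENNReal.ofReal τ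
        + ENNReal.ofReal C₁ ^ (1 / 2 : ℝ) * ENNReal.ofReal C₂ ^ (1 / 2 : ℝ)
          * ENNReal.ofReal τ) := by gcongr <;> exact hcs _
    _ = _ := by ring

lemma exists_cubic_bound (hg : ∀ n, Measurable (g n))
    (hlaw : ∀ n, P.map (g n) = stdComplexGaussian) (hindep : iIndepFun g P) {p : ℝ} (hp : 2 ≤ p) :
    ∃ C : ℝ≥0∞, C ≠ ∞ ∧ ∀ (D : Finset ℕ) (z : ℂ),
      ∫⁻ ω, ENNReal.ofReal (‖cubic (holComb D (fun n => g n ω) z)‖ ^ p) ∂P ≤ C := by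
  obtain ⟨C, hC, h⟩ := exists_uniform_moment_bound hg hlaw hindep (by linarith : 0 < 3 * p)
  refine ⟨ENNReal.ofReal C, ENNReal.ofReal_ne_top, fun D z => ?_⟩
  have e : ∀ x : ℂ, ‖cubic x‖ ^ p = ‖x‖ ^ (3 * p) := fun x => by
    rw [norm_cubic, Real.rpow_mul (norm_nonneg _)]
    norm_cast
  simpa only [e] using h D z

end

/-- The weighted mass of the high frequencies decays. -/
lemma exists_lintegral_tail_bound {s : ℝ} (hs1 : 1 < s) (hs2 : s ≤ 2) :
    ∃ C : ℝ, 0 < C ∧ ∀ M N : ℕ, 1 ≤ M →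
      ∫⁻ z, ENNReal.ofReal (∑ n ∈ Finset.Ico (M + 1) (N + 1), ‖hol n z‖ ^ 2) ∂(radMeasure s)
        ≤ ENNReal.ofReal (C * (M : ℝ) ^ (-((s - 1) / 2))) := by
  -- The exponent s is split as (s + 1)/2 + (s - 1)/2: the first part exceeds 1 and sums the series,
  -- the second yields the decay in M.
  have hsum : Summable fun n : ℕ => ((n : ℝ) + 1) ^ (-((s + 1) / 2)) := by
    have h := (summable_nat_add_iff 1).2
      (Real.summable_nat_rpow.2 (by linarith : -((s + 1) / 2) < -1))
    exact h.congr fun n => by push_cast; rfl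
  set K := ∑' n : ℕ, ((n : ℝ) + 1) ^ (-((s + 1) / 2)) with hK
  have hK0 : 0 ≤ K := tsum_nonneg fun n => by positivity
  refine ⟨6 * (K + 1), by positivity, fun M N hM => ?_⟩
  have hM0 : (0 : ℝ) < M := by exact_mod_cast hM
  have hm : ∀ n, Measurable fun z => ‖hol n z‖ ^ 2 := fun n =>
    ((continuous_hol n).norm.pow 2).measurable
  rw [lintegral_radMeasure s (by fun_prop)]
  have hi : ∀ n, Integrable fun z => radWeight (-s) z * ‖hol n z‖ ^ 2 := fun n => by
    refine (integrable_norm_hol_sq n).mono'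
      ((continuous_radWeight _).mul ((continuous_hol n).norm.pow 2)).aestronglyMeasurable
      (ae_of_all _ fun z => ?_)
    rw [Real.norm_of_nonneg (mul_nonneg (radWeight_pos _ z).le (sq_nonneg _))]
    exact mul_le_of_le_one_left (sq_nonneg _) (Real.rpow_le_one_of_one_le_of_nonpos
      (by nlinarith [sq_nonneg ‖z‖]) (by linarith))
  simp only [Finset.mul_sum]
  rw [← ofReal_integral_eq_lintegral_ofReal (integrable_finsetSum _ fun n _ => hi n)
    (ae_of_all _ fun z => Finset.sum_nonneg fun n _ =>
      mul_nonneg (radWeight_pos _ z).le (sq_nonneg _)),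
    integral_finsetSum _ fun n _ => hi n]
  refine ENNReal.ofReal_le_ofReal ?_
  calc _ ≤ ∑ n ∈ Finset.Ico (M + 1) (N + 1),
        6 * (M : ℝ) ^ (-((s - 1) / 2)) * ((n : ℝ) + 1) ^ (-((s + 1) / 2)) := by
        refine Finset.sum_le_sum fun n hn => ?_
        refine (integral_radWeight_neg_mul_le n (by linarith) hs2).trans ?_
        have hn' : (M : ℝ) ≤ n + 1 := by
          have := (Finset.mem_Ico.1 hn).1
          exact_mod_cast (by omega : M ≤ n + 1)
        have e : ((n : ℝ) + 1) ^ (-s)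
            = ((n : ℝ) + 1) ^ (-((s - 1) / 2)) * ((n : ℝ) + 1) ^ (-((s + 1) / 2)) := by
          rw [← Real.rpow_add (by positivity)]
          congr 1
          ring
        rw [e, ← mul_assoc]
        have := Real.rpow_le_rpow_of_nonpos hM0 hn' (by linarith : -((s - 1) / 2) ≤ 0)
        gcongr
    _ ≤ 6 * (M : ℝ) ^ (-((s - 1) / 2)) * K := by
        rw [← Finset.mul_sum]
        gcongr
        exact hsum.sum_le_tsum _ fun n _ => by positivity
    _ ≤ _ := by
        have : 0 ≤ (M : ℝ) ^ (-((s - 1) / 2)) := by positivity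
        nlinarith

end CR

namespace CR

/-! ### Moments of the truncated nonlinearity -/

lemma XNegOne.toHNeg_add {σ : ℝ} (hσ : 1 < σ) (u v : XNegOne) :
    (u + v).toHNeg hσ = u.toHNeg hσ + v.toHNeg hσ := rfl

section

variable {Ω : Type*} [MeasurableSpace Ω] {P : Measure Ω} {g : ℕ → Ω → ℂ}

lemma exists_truncX_bounds [IsProbabilityMeasure P] (hg : ∀ n, Measurable (g n))
    (hlaw : ∀ n, P.map (g n) = stdComplexGaussian) (hindep : iIndepFun g P) {p σ : ℝ}
    (hp : 2 ≤ p) (hσ : 1 < σ) :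
    ∃ δ : ℝ, 0 < δ ∧ ∃ C : ℝ≥0∞, C ≠ ∞ ∧
      (∀ N, ∫⁻ ω, ‖(truncX N fun n => g n ω).toHNeg hσ‖ₑ ^ p ∂P ≤ C) ∧
      ∀ M N, 1 ≤ M → M ≤ N →
        ∫⁻ ω, ‖(truncX N (fun n => g n ω) - truncX M fun n => g n ω).toHNeg hσ‖ₑ ^ p ∂P
          ≤ C * ENNReal.ofReal ((M : ℝ) ^ (-δ)) := by
  -- The weight must be integrable (s > 1), must leave room for decay at high frequencies (s < σ),
  -- and must stay in the range of the weighted estimates (s ≤ 2).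
  obtain ⟨s, hs1, hs⟩ := exists_between (lt_min hσ one_lt_two)
  have hsσ : s < σ := hs.trans_le (min_le_left _ _)
  have hs2 : s ≤ 2 := (hs.trans_le (min_le_right _ _)).le
  have hfin := isFiniteMeasure_radMeasure hs1
  obtain ⟨C₁, hC₁, h1⟩ := exists_holX_resCoeff_bound hp hσ hs1 hs2 hsσ.le
  obtain ⟨C₂, hC₂, h2⟩ := exists_cubic_bound hg hlaw hindep hp
  obtain ⟨C₃, hC₃, h3⟩ := exists_cubic_sub_bound hg hlaw hindep hp
  obtain ⟨C₄, hC₄, h4⟩ := exists_lintegral_tail_bound hs1 hs2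
  set ν := radMeasure s with hν
  set V : ℕ → Ω → ℂ → ℂ := fun N ω z =>
    cubic (holComb (Finset.range (N + 1)) (fun n => g n ω) z) with hV
  have hVc : ∀ N ω, Continuous (V N ω) := fun N ω =>
    continuous_cubic.comp (continuous_holComb _ _)
  have hVm : ∀ N, Measurable fun q : Ω × ℂ => V N q.1 q.2 := fun N =>
    continuous_cubic.measurable.comp (measurable_holComb hg _)
  have hp0 : 0 ≤ p := by linarith
  have hI : ∀ N, ∫⁻ ω, ∫⁻ z, ENNReal.ofReal (‖V N ω z‖ ^ p) ∂ν ∂P ≤ C₂ * ν Set.univ := fun N => by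
    have hm := hVm N
    rw [lintegral_lintegral_swap (by simp only [Function.uncurry_def]; fun_prop)]
    exact (lintegral_mono fun z => h2 _ z).trans_eq (lintegral_const _)
  have hJ : ∀ M N, 1 ≤ M → M ≤ N → ∫⁻ ω, ∫⁻ z, ENNReal.ofReal (‖V N ω z - V M ω z‖ ^ p) ∂ν ∂P
      ≤ C₃ * ENNReal.ofReal (C₄ * (M : ℝ) ^ (-((s - 1) / 2))) := fun M N hM hMN => by
    have hm := hVm N
    have hm' := hVm M
    have hh : ∀ n, Measurable fun z => ‖hol n z‖ ^ 2 := fun n =>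
      ((continuous_hol n).norm.pow 2).measurable
    rw [lintegral_lintegral_swap (by simp only [Function.uncurry_def]; fun_prop)]
    refine (lintegral_mono fun z => h3 M N z hMN).trans ?_
    rw [lintegral_const_mul _ (by fun_prop)]
    gcongr
    exact h4 M N hM
  -- The first rate comes from the tail of the variance, the second from the high frequencies of the
  -- cubic term.
  set δ := min ((s - 1) / 2) (σ - s) with hδ
  have hδ0 : 0 < δ := lt_min (by linarith) (by linarith)
  refine ⟨δ, hδ0, C₁ * (C₂ * ν Set.univ) + 2 ^ p * (C₁ * (C₃ * ENNReal.ofReal C₄)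
    + C₁ * (C₂ * ν Set.univ)), by finiteness, fun N => ?_, fun M N hM hMN => ?_⟩
  · have hb : ∀ ω, ‖(truncX N fun n => g n ω).toHNeg hσ‖ₑ ^ p
        ≤ C₁ * ∫⁻ z, ENNReal.ofReal (‖V N ω z‖ ^ p) ∂ν := fun ω => by
      -- With lowest frequency parameter 1 the decay factor is 1, giving the plain bound.
      have h := h1 1 (Finset.range (N + 1)) (V N ω) le_rfl (fun d _ => by omega) (hVc N ω)
      rwa [Nat.cast_one, Real.one_rpow, ENNReal.ofReal_one, mul_one] at h
    refine (lintegral_mono hb).trans ?_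
    rw [lintegral_const_mul' _ _ hC₁]
    refine le_trans ?_ le_self_add
    gcongr
    exact hI N
  · have hM1 : (1 : ℝ) ≤ M := by exact_mod_cast hM
    have hb : ∀ ω, ‖(truncX N (fun n => g n ω) - truncX M fun n => g n ω).toHNeg hσ‖ₑ ^ p
        ≤ 2 ^ p * (C₁ * ∫⁻ z, ENNReal.ofReal (‖V N ω z - V M ω z‖ ^ p) ∂ν
          + C₁ * ENNReal.ofReal ((M : ℝ) ^ (-(σ - s)))
            * ∫⁻ z, ENNReal.ofReal (‖V N ω z‖ ^ p) ∂ν) := fun ω => by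
      rw [truncX_sub hMN, XNegOne.toHNeg_add]
      refine (enorm_add_rpow_le hp0 _ _).trans
        (mul_le_mul' le_rfl (add_le_add ?_ ?_))
      · have h := h1 1 (Finset.range (M + 1)) (fun z => V N ω z - V M ω z) le_rfl
          (fun d _ => by omega) ((hVc N ω).sub (hVc M ω))
        rwa [Nat.cast_one, Real.one_rpow, ENNReal.ofReal_one, mul_one] at h
      · exact h1 M (Finset.Ico (M + 1) (N + 1)) (V N ω) hM
          (fun d hd => by have := (Finset.mem_Ico.1 hd).1; omega) (hVc N ω)
    have hmN := hVm N
    have hmM := hVm M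
    have hmeas : Measurable fun ω => ∫⁻ z, ENNReal.ofReal (‖V N ω z - V M ω z‖ ^ p) ∂ν :=
      Measurable.lintegral_prod_right' (f := fun q : Ω × ℂ =>
        ENNReal.ofReal (‖V N q.1 q.2 - V M q.1 q.2‖ ^ p)) (by fun_prop)
    refine (lintegral_mono hb).trans ?_
    rw [lintegral_const_mul' _ _ (by finiteness), lintegral_add_left (hmeas.const_mul _),
      lintegral_const_mul' _ _ hC₁, lintegral_const_mul' _ _ (by finiteness)]
    have e1 : ENNReal.ofReal ((M : ℝ) ^ (-((s - 1) / 2))) ≤ ENNReal.ofReal ((M : ℝ) ^ (-δ)) :=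
      ENNReal.ofReal_le_ofReal (Real.rpow_le_rpow_of_exponent_le hM1
        (neg_le_neg (min_le_left _ _)))
    have e2 : ENNReal.ofReal ((M : ℝ) ^ (-(σ - s))) ≤ ENNReal.ofReal ((M : ℝ) ^ (-δ)) :=
      ENNReal.ofReal_le_ofReal (Real.rpow_le_rpow_of_exponent_le hM1
        (neg_le_neg (min_le_right _ _)))
    have hJ' := hJ M N hM hMN
    rw [ENNReal.ofReal_mul hC₄.le] at hJ'
    calc _ ≤ 2 ^ p * (C₁ * (C₃ * (ENNReal.ofReal C₄ * ENNReal.ofReal ((M : ℝ) ^ (-δ))))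
          + C₁ * ENNReal.ofReal ((M : ℝ) ^ (-δ)) * (C₂ * ν Set.univ)) := by
          gcongr
          · exact hJ'.trans (by gcongr)
          · exact hI N
      _ = 2 ^ p * (C₁ * (C₃ * ENNReal.ofReal C₄) + C₁ * (C₂ * ν Set.univ))
          * ENNReal.ofReal ((M : ℝ) ^ (-δ)) := by ring
      _ ≤ _ := by
          gcongr
          exact le_add_self

/-! ### Transfer to the white noise measure -/

lemma ae_trunc_eq (hg : ∀ n, Measurable (g n))
    (hlaw : ∀ n, P.map (g n) = stdComplexGaussian) (hindep : iIndepFun g P) :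
    ∀ᵐ ω ∂P, ∀ N, trunc N (noise g ω) = truncX N fun n => g n ω := by
  filter_upwards [ae_tendsto_noise hg hlaw hindep] with ω h N
  rw [trunc_eq h.2.1, h.2.2]
  rfl

lemma measurable_truncCoeff (N d : ℕ) : Measurable fun a : ℕ → ℂ => truncCoeff N a d := by
  have h := fun n => (continuous_hol n).measurable
  have hc := continuous_cubic.measurable
  have hm : Measurable fun q : (ℕ → ℂ) × ℂ => starRingEnd ℂ (hol d q.2)
      * cubic (holComb (Finset.range (N + 1)) q.1 q.2) := by
    unfold holComb
    have : Measurable (starRingEnd ℂ) := Complex.continuous_conj.measurable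
    fun_prop
  exact (hm.stronglyMeasurable.integral_prod_right' (ν := volume)).measurable.const_mul _

/-- The spectral projections are defined by choice, so measurability is proved for the explicit
formula in the coefficients, which agrees with `trunc` on the full-measure set `holSet`. -/
lemma aestronglyMeasurable_trunc (hg : ∀ n, Measurable (g n))
    (hlaw : ∀ n, P.map (g n) = stdComplexGaussian) (hindep : iIndepFun g P) {σ : ℝ} (hσ : 1 < σ)
    (N : ℕ) : AEStronglyMeasurable (fun u => (trunc N u).toHNeg hσ) (whiteNoise P g) := by
  have h1 : StronglyMeasurable fun a : ℕ → ℂ => (holX (Finset.range (N + 1)) a).toHNeg hσ :=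
    ((XNegOne.continuous_toHNeg hσ).comp (continuous_holX _)).stronglyMeasurable
  have h2 : Measurable fun u : XNegOne => truncCoeff N (coeff u) :=
    measurable_pi_lambda _ fun d => (measurable_truncCoeff N d).comp
      (measurable_pi_lambda _ fun n => (continuous_coeff n).measurable)
  refine (h1.comp_measurable h2).aestronglyMeasurable.congr ?_
  filter_upwards [ae_mem_holSet hg hlaw hindep] with u hu
  rw [trunc_eq hu]
  rfl

lemma exists_trunc_bounds [IsProbabilityMeasure P] (hg : ∀ n, Measurable (g n))
    (hlaw : ∀ n, P.map (g n) = stdComplexGaussian) (hindep : iIndepFun g P) {p σ : ℝ}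
    (hp : 2 ≤ p) (hσ : 1 < σ) :
    ∃ δ : ℝ, 0 < δ ∧ ∃ C : ℝ, 0 < C ∧
      (∀ N, ∫⁻ u, ‖(trunc N u).toHNeg hσ‖ₑ ^ p ∂(whiteNoise P g) ≤ ENNReal.ofReal C) ∧
      ∀ M N, 1 ≤ M → M ≤ N →
        ∫⁻ u, ‖(trunc N u).toHNeg hσ - (trunc M u).toHNeg hσ‖ₑ ^ p ∂(whiteNoise P g)
          ≤ ENNReal.ofReal (C * (M : ℝ) ^ (-δ)) := by
  obtain ⟨δ, hδ, C, hC, h1, h2⟩ := exists_truncX_bounds hg hlaw hindep hp hσ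
  have hm := aestronglyMeasurable_trunc hg hlaw hindep hσ
  have hn := aemeasurable_noise hg hlaw hindep
  have hC' : C ≤ ENNReal.ofReal (C.toReal + 1) := by
    rw [ENNReal.ofReal_add ENNReal.toReal_nonneg zero_le_one, ENNReal.ofReal_toReal hC]
    exact le_self_add
  refine ⟨δ, hδ, C.toReal + 1, by positivity, fun N => ?_, fun M N hM hMN => ?_⟩
  · refine le_trans (le_of_eq ?_) ((h1 N).trans hC')
    rw [whiteNoise, lintegral_map' ((hm N).enorm.pow_const p) hn]
    refine lintegral_congr_ae ?_
    filter_upwards [ae_trunc_eq hg hlaw hindep] with ω hω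
    rw [hω]
  · rw [ENNReal.ofReal_mul (by positivity)]
    refine le_trans (le_of_eq ?_) ((h2 M N hM hMN).trans (by gcongr))
    rw [whiteNoise, lintegral_map' (((hm N).fun_sub (hm M)).enorm.pow_const p) hn]
    refine lintegral_congr_ae ?_
    filter_upwards [ae_trunc_eq hg hlaw hindep] with ω hω
    simp only [hω, XNegOne.toHNeg_sub]

end

end CR

namespace CR

/-! ### Limit along the powers of two, and the proposition -/

open Classical in
/-- The limit of the truncated nonlinearities along the powers of two, where it exists. -/
noncomputable def limitMap (u : XNegOne) : XNegOne :=
  if h : ∃ v, Tendsto (fun k : ℕ => trunc (2 ^ k) u) atTop (𝓝 v) then h.choose else 0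

lemma tendsto_limitMap {u : XNegOne} (h : ∃ v, Tendsto (fun k : ℕ => trunc (2 ^ k) u) atTop (𝓝 v)) :
    Tendsto (fun k : ℕ => trunc (2 ^ k) u) atTop (𝓝 (limitMap u)) := by
  rw [limitMap, dif_pos h]
  exact h.choose_spec

lemma eLpNorm_le_of_lintegral_le {α E : Type*} [MeasurableSpace α] [NormedAddCommGroup E]
    {μ : Measure α} {p : ℝ} (hp : 2 ≤ p) {f : α → E} {C : ℝ} (hC : 0 ≤ C)
    (h : ∫⁻ x, ‖f x‖ₑ ^ p ∂μ ≤ ENNReal.ofReal C) :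
    eLpNorm f (ENNReal.ofReal p) μ ≤ ENNReal.ofReal (C ^ (1 / p)) := by
  have hp0 : 0 < p := by linarith
  rw [eLpNorm_eq_lintegral_rpow_enorm_toReal (ENNReal.ofReal_pos.2 hp0).ne' ENNReal.ofReal_ne_top,
    ENNReal.toReal_ofReal hp0.le, ← ENNReal.ofReal_rpow_of_nonneg hC (by positivity)]
  exact ENNReal.rpow_le_rpow h (by positivity)

section

variable {Ω : Type*} [MeasurableSpace Ω] {P : Measure Ω} [IsProbabilityMeasure P] {g : ℕ → Ω → ℂ}

/-- The truncated nonlinearities are bounded and Cauchy in `L^p`, with a polynomial rate. -/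
lemma exists_eLpNorm_trunc_bounds (hg : ∀ n, Measurable (g n))
    (hlaw : ∀ n, P.map (g n) = stdComplexGaussian) (hindep : iIndepFun g P) {p σ : ℝ}
    (hp : 2 ≤ p) (hσ : 1 < σ) :
    ∃ δ : ℝ, 0 < δ ∧ ∃ K : ℝ, 0 < K ∧
      (∀ N, MemLp (fun u => (trunc N u).toHNeg hσ) (ENNReal.ofReal p) (whiteNoise P g)) ∧
      ∀ L M N, 1 ≤ L → L ≤ M → L ≤ N →
        eLpNorm (fun u => (trunc N u).toHNeg hσ - (trunc M u).toHNeg hσ) (ENNReal.ofReal p)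
          (whiteNoise P g) ≤ ENNReal.ofReal (K * (L : ℝ) ^ (-δ)) := by
  obtain ⟨δ, hδ, C, hC, h1, h2⟩ := exists_trunc_bounds hg hlaw hindep hp hσ
  have hp0 : 0 < p := by linarith
  have hord : ∀ L M N, 1 ≤ L → L ≤ M → M ≤ N →
      eLpNorm (fun u => (trunc N u).toHNeg hσ - (trunc M u).toHNeg hσ) (ENNReal.ofReal p)
        (whiteNoise P g) ≤ ENNReal.ofReal (C ^ (1 / p) * (L : ℝ) ^ (-(δ / p))) := by
    intro L M N hL hLM hMN
    have hL' : (0 : ℝ) < L := by exact_mod_cast hL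
    have hLM' : (L : ℝ) ≤ M := by exact_mod_cast hLM
    refine (eLpNorm_le_of_lintegral_le hp (by positivity)
      (h2 M N (hL.trans hLM) hMN)).trans (ENNReal.ofReal_le_ofReal ?_)
    rw [Real.mul_rpow hC.le (by positivity), ← Real.rpow_mul (by positivity)]
    have e : -δ * (1 / p) = -(δ / p) := by ring
    rw [e]
    have := Real.rpow_le_rpow_of_nonpos hL' hLM' (neg_nonpos.2 (div_pos hδ hp0).le)
    gcongr
  refine ⟨δ / p, by positivity, C ^ (1 / p), by positivity, fun N =>
    ⟨aestronglyMeasurable_trunc hg hlaw hindep hσ N,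
      (eLpNorm_le_of_lintegral_le hp hC.le (h1 N)).trans_lt ENNReal.ofReal_lt_top⟩,
    fun L M N hL hM hN => ?_⟩
  rcases le_total M N with h | h
  · exact hord L M N hL hM h
  · refine le_trans (le_of_eq ?_) (hord L N M hL hN h)
    exact eLpNorm_sub_comm (fun u => (trunc N u).toHNeg hσ) (fun u => (trunc M u).toHNeg hσ) _ _

lemma tendsto_ofReal_mul_rpow_neg {K δ : ℝ} (hδ : 0 < δ) :
    Tendsto (fun N : ℕ => ENNReal.ofReal (K * (N : ℝ) ^ (-δ))) atTop (𝓝 0) := by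
  have h := ((tendsto_rpow_neg_atTop hδ).comp tendsto_natCast_atTop_atTop).const_mul K
  rw [mul_zero] at h
  have h2 := (ENNReal.continuous_ofReal.tendsto 0).comp h
  rw [ENNReal.ofReal_zero] at h2
  exact h2

/-- Almost sure convergence along the powers of two. -/
lemma ae_tendsto_limitMap (hg : ∀ n, Measurable (g n))
    (hlaw : ∀ n, P.map (g n) = stdComplexGaussian) (hindep : iIndepFun g P) :
    ∀ᵐ u ∂(whiteNoise P g), Tendsto (fun k : ℕ => trunc (2 ^ k) u) atTop (𝓝 (limitMap u)) := by
  have h : ∀ j, ∀ᵐ u ∂(whiteNoise P g), ∃ l : HNeg (order j),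
      Tendsto (fun k : ℕ => (trunc (2 ^ k) u).toHNeg (one_lt_order j)) atTop (𝓝 l) := fun j => by
    obtain ⟨δ, hδ, K, hK, hmem, hcau⟩ :=
      exists_eLpNorm_trunc_bounds hg hlaw hindep le_rfl (one_lt_order j)
    have hr1 : (2 : ℝ) ^ (-δ) < 1 := Real.rpow_lt_one_of_one_lt_of_neg one_lt_two (by linarith)
    have hr0 : (0 : ℝ) < 2 ^ (-δ) := by positivity
    -- Along powers of two the polynomial rate becomes geometric, hence summable. The exponent 2 is
    -- enough here, as the almost sure limit does not depend on p; K + 1 in place of K provides the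
    -- strict inequality required.
    refine Lp.ae_tendsto_of_cauchy_eLpNorm (p := ENNReal.ofReal 2)
      (B := fun k => ENNReal.ofReal ((K + 1) * ((2 : ℝ) ^ (-δ)) ^ k))
      (fun k => (hmem (2 ^ k)).1) (by simp) ?_ fun L n m hn hm => ?_
    · rw [← ENNReal.ofReal_tsum_of_nonneg (fun k => by positivity)
        ((summable_geometric_of_lt_one hr0.le hr1).mul_left _)]
      exact ENNReal.ofReal_ne_top
    · refine (hcau (2 ^ L) (2 ^ m) (2 ^ n) Nat.one_le_two_pow
        (Nat.pow_le_pow_right two_pos hm) (Nat.pow_le_pow_right two_pos hn)).trans_lt ?_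
      have e : ((2 ^ L : ℕ) : ℝ) ^ (-δ) = ((2 : ℝ) ^ (-δ)) ^ L := by
        push_cast
        rw [← Real.rpow_natCast, ← Real.rpow_natCast, ← Real.rpow_mul two_pos.le,
          ← Real.rpow_mul two_pos.le, mul_comm]
      rw [e]
      refine (ENNReal.ofReal_lt_ofReal_iff (by positivity)).2 ?_
      have : 0 < ((2 : ℝ) ^ (-δ)) ^ L := by positivity
      nlinarith
  filter_upwards [ae_all_iff.2 h] with u hu
  exact tendsto_limitMap (XNegOne.exists_tendsto hu)

end

end CR

open CR
theorem proposition4p1 {Ω : Type*} [MeasurableSpace Ω] (P : Measure Ω) [IsProbabilityMeasure P]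
    (g : ℕ → Ω → ℂ) (hg : ∀ n, Measurable (g n)) (hlaw : ∀ n, P.map (g n) = stdComplexGaussian)
    (hindep : iIndepFun g P) :
    IsProbabilityMeasure (whiteNoise P g) ∧
    (∀ (p σ : ℝ) (_ : 2 ≤ p) (hσ : 1 < σ),
      (∀ N : ℕ, MemLp (fun u => (trunc N u).toHNeg hσ) (ENNReal.ofReal p) (whiteNoise P g)) ∧
      (∀ ε : ℝ≥0∞, 0 < ε → ∃ N₀ : ℕ, ∀ M N : ℕ, N₀ ≤ M → N₀ ≤ N →
        eLpNorm (fun u => (trunc N u).toHNeg hσ - (trunc M u).toHNeg hσ)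
          (ENNReal.ofReal p) (whiteNoise P g) ≤ ε) ∧
      ∃ δ : ℝ, 0 < δ ∧ ∃ C : ℝ, 0 < C ∧ ∀ M N : ℕ, 1 ≤ M → M < N →
        ∫ u, ‖(trunc N u).toHNeg hσ - (trunc M u).toHNeg hσ‖ ^ p ∂(whiteNoise P g)
          ≤ C * (M : ℝ) ^ (-δ)) ∧
    ∃ T : XNegOne → XNegOne, ∀ (p σ : ℝ) (_ : 2 ≤ p) (hσ : 1 < σ),
      MemLp (fun u => (T u).toHNeg hσ) (ENNReal.ofReal p) (whiteNoise P g) ∧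
      Tendsto (fun N => eLpNorm (fun u => (trunc N u).toHNeg hσ - (T u).toHNeg hσ)
        (ENNReal.ofReal p) (whiteNoise P g)) atTop (𝓝 0) ∧
      ∃ C : ℝ, eLpNorm (fun u => (T u).toHNeg hσ) (ENNReal.ofReal p) (whiteNoise P g)
        ≤ ENNReal.ofReal C := by
  -- A single map serves all p and σ because the almost sure convergence takes place in X^{-1}
  -- itself.
  refine ⟨Measure.isProbabilityMeasure_map (aemeasurable_noise hg hlaw hindep),
    fun p σ hp hσ => ?_, limitMap, fun p σ hp hσ => ?_⟩
  · obtain ⟨η, hη, K, hK, hmem, hcau⟩ := exists_eLpNorm_trunc_bounds hg hlaw hindep hp hσ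
    refine ⟨hmem, fun ε hε => ?_, ?_⟩
    · obtain ⟨L, hL⟩ := eventually_atTop.1 ((tendsto_ofReal_mul_rpow_neg (K := K) hη).eventually
        (ge_mem_nhds hε))
      exact ⟨max L 1, fun M N hM hN => (hcau (max L 1) M N (le_max_right _ _) hM hN).trans
        (hL _ (le_max_left _ _))⟩
    · obtain ⟨δ, hδ, C, hC, -, h2⟩ := exists_trunc_bounds hg hlaw hindep hp hσ
      refine ⟨δ, hδ, C, hC, fun M N hM hMN => ?_⟩
      have hm := aestronglyMeasurable_trunc hg hlaw hindep hσ
      rw [integral_eq_lintegral_of_nonneg_ae (ae_of_all _ fun u => by positivity)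
        (((hm N).fun_sub (hm M)).norm.aemeasurable.pow_const p).aestronglyMeasurable]
      refine ENNReal.toReal_le_of_le_ofReal (by positivity)
        (le_trans (le_of_eq (lintegral_congr fun u => ?_)) (h2 M N hM hMN.le))
      rw [← ofReal_norm, ENNReal.ofReal_rpow_of_nonneg (norm_nonneg _) (by linarith)]
  · obtain ⟨η, hη, K, hK, hmem, hcau⟩ := exists_eLpNorm_trunc_bounds hg hlaw hindep hp hσ
    have hlim : ∀ᵐ u ∂(whiteNoise P g), Tendsto (fun k : ℕ => (trunc (2 ^ k) u).toHNeg hσ) atTop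
        (𝓝 ((limitMap u).toHNeg hσ)) :=
      (ae_tendsto_limitMap hg hlaw hindep).mono fun u hu =>
        ((XNegOne.continuous_toHNeg hσ).tendsto _).comp hu
    have hmT : AEStronglyMeasurable (fun u => (limitMap u).toHNeg hσ) (whiteNoise P g) :=
      aestronglyMeasurable_of_tendsto_ae atTop (fun k => (hmem (2 ^ k)).1) hlim
    -- Fatou's lemma along the powers of two, with N fixed: once 2^k ≥ N the Cauchy bound depends on
    -- N only and passes to the limit.
    have hdiff : ∀ N, 1 ≤ N → eLpNorm (fun u => (trunc N u).toHNeg hσ - (limitMap u).toHNeg hσ)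
        (ENNReal.ofReal p) (whiteNoise P g) ≤ ENNReal.ofReal (K * (N : ℝ) ^ (-η)) := fun N hN => by
      refine (Lp.eLpNorm_lim_le_liminf_eLpNorm
        (f := fun (k : ℕ) u => (trunc N u).toHNeg hσ - (trunc (2 ^ k) u).toHNeg hσ)
        (fun k => (hmem N).1.fun_sub (hmem (2 ^ k)).1) _
        (hlim.mono fun u hu => hu.const_sub _)).trans ?_
      refine (liminf_le_liminf (eventually_atTop.2 ⟨N, fun k hk =>
        hcau N (2 ^ k) N hN (hk.trans Nat.lt_two_pow_self.le) le_rfl⟩)).trans_eq ?_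
      exact liminf_const _
    have hT : MemLp (fun u => (limitMap u).toHNeg hσ) (ENNReal.ofReal p) (whiteNoise P g) := by
      -- Integrability of the limit follows by writing it as 𝒯_1 minus the difference 𝒯_1 - 𝒯.
      have h1 : MemLp (fun u => (trunc 1 u).toHNeg hσ - (limitMap u).toHNeg hσ)
          (ENNReal.ofReal p) (whiteNoise P g) :=
        ⟨(hmem 1).1.fun_sub hmT, (hdiff 1 le_rfl).trans_lt ENNReal.ofReal_lt_top⟩
      refine ((hmem 1).sub h1).ae_eq (ae_of_all _ fun u => ?_)
      simp only [Pi.sub_apply, sub_sub_cancel]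
    refine ⟨hT, ?_, _, (ENNReal.ofReal_toReal hT.2.ne).ge⟩
    exact tendsto_of_tendsto_of_tendsto_of_le_of_le' tendsto_const_nhds
      (tendsto_ofReal_mul_rpow_neg (K := K) hη) (Eventually.of_forall fun N => zero_le)
      (eventually_atTop.2 ⟨1, hdiff⟩)
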